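/- **Setting.** For $\phi\in\mathbb R$, a unit vector $\vec n=(n_x,n_y,n_z)\in\mathbb R^3$ and $\theta\in\mathbb R$, let $\mathcal T_{\phi,\vec n,\theta}$ be the nearest-neighbour qubit quantum cellular automaton (QCA) on $\mathbb Z$ with transition rule $$\mathcal T_0(A)=X^\dagger(I\otimes U^\dagger A\,U\otimes I)X,\qquad X=(C_\phi\otimes I)(I\otimes C_\phi),\qquad U=\exp(-i\theta\,\vec n\cdot\vec\sigma),$$ where $C_\phi|a\rangle|b\rangle=e^{i\phi ab}|a\rangle|b\rangle$ and $\sigma_z|a\rangle=(-1)^a|a\rangle$ for $a,b\in\{0,1\}$. Write $\mathcal T_{\phi,\theta}$ when $\vec n=(0,0,1)$, i.e. $U=e^{-i\theta\sigma_z}$. Let $P$ be a rank-two projection on two neighbouring cells and $(\psi_0,\psi_1)$ an orthonormal basis of its range. For $f\ge1$ put $J=\bigotimes_{x\in\mathbb Z_f}\sum_k|k\rangle\langle\psi_k|$, the $x$-th factor acting on the cells $2x,2x+1$ of $\mathbb Z_{2f}$, and $\mathcal V(A)=J^\dagger AJ$. A nearest-neighbour qubit QCA $\mathcal S$ is a *(size-2)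 renormalisation* of $\mathcal T$ through $P$ in the basis $(\psi_0,\psi_1)$ if $\mathcal T_w^2\circ\mathcal V=\mathcal V\circ\mathcal S_w$ for every $f$ such that the neighbourhood $\{-2,\dots,2\}$ of $\mathcal T^2$ is regular on $\mathbb Z_{2f}$ (no new overlaps of neighbourhoods arise from wrapping), where $\mathcal T_w,\mathcal S_w$ are the automorphisms with the same transition rules on the rings $\mathbb Z_{2f}$, $\mathbb Z_f$. Let $Q_1=|00\rangle\langle00|+|11\rangle\langle11|$ and $Q_2=|01\rangle\langle01|+|10\rangle\langle10|$. **Theorem.** 1. *Diagonal case.* If $n_x=n_y=0$ (so $n_z=\pm1$), then $\mathcal T_{\phi,\vec n,\theta}$ is renormalised to $\mathcal T_{\phi',\theta'}$ with - $P=Q_1$: $(\phi',\theta')=(2\phi,\ \phi+4n_z\theta)$ in the basis $(|00\rangle,|11\rangle)$, and $(2\phi,\ -4n_z\theta-3\phi)$ in the basis $(|11\rangle,|00\rangle)$ (for $n_z=-1$: $(2\phi,\phi-4\theta)$ and $(2\phi,4\theta-3\phi)$); - $P=Q_2$: $(\phi',\theta')=(-2\phi,\ \phi)$ in both orders of the basis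 $|01\rangle,|10\rangle$; - $P=I\otimes|c\rangle\langle c|$ or $P=|c\rangle\langle c|\otimes I$, $c\in\{0,1\}$: $(\phi',\theta')=(0,\ \pm2(n_z\theta+c\,\phi))$, with the sign $+$ if the varying qubit of $\psi_k$ is $|k\rangle$ and $-$ if it is $|1-k\rangle$. 2. *Anti-diagonal case.* If $n_z=0$ and $\cos\theta=0$ (e.g. $\theta=\pi/2$), then $\mathcal T_{\phi,\vec n,\theta}$ is renormalised to $\mathcal T_{\phi',\theta'}$ with $(\phi',\theta')=(2\phi,-\phi)$ for $P=Q_1$, $(-2\phi,\phi)$ for $P=Q_2$ (in both orders of the computational basis), and $(0,\pm(2c-1)\phi)$ for $P=I\otimes|c\rangle\langle c|$ or $|c\rangle\langle c|\otimes I$, with the same sign rule as in 1. 3. *Nothing else.* Let $\phi\notin\pi\mathbb Z$. If a QCA $\mathcal S$ is a renormalisation of $\mathcal T_{\phi,\vec n,\theta}$ through some $P$ in some basis, then $U$ is diagonal ($n_x=n_y=0$, or $\sin\theta=0$, in which case $U=\pm I$ and $n_z\theta$ is to be read as $0$) or anti-diagonal ($n_z=0$, $\cos\theta=0$), $P$ is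 one of the projections listed above, and $\mathcal S$ is, up to the same change of orthonormal basis in every coarse-grained cell, the corresponding $\mathcal T_{\phi',\theta'}$ of 1 or 2. 4. *Fixed points.* Let $\phi\notin2\pi\mathbb Z$. Then $\mathcal T_{\phi,\vec n,\theta}$ is a renormalisation of itself through some $P$ in some basis if and only if $n_x=n_y=0$ and there is $m\in\mathbb Z$ with $\phi=\frac{2m\pi}3$ and $n_z\theta\equiv\frac{2m\pi}3\pmod\pi$ (i.e., up to an irrelevant sign of $U$, $\phi=\theta=\frac{2m\pi}3$ with $U=e^{-i\theta\sigma_z}$), and $P$ is then necessarily $Q_2$. For every $m\in\mathbb Z$, $\mathcal T_{2m\pi/3,\,2m\pi/3}$ is renormalised to itself through $P=Q_2$ in the basis $(|01\rangle,|10\rangle)$. -/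

import Mathlib

open scoped Matrix Kronecker

noncomputable section

/-- The algebra of operators on the qubits sitting at the points of `L`, written as matrices in
the computational basis (for finite `L` this is the tensor product of the cell algebras). -/
abbrev QOp (L : Type) : Type := Matrix (L → Fin 2) (L → Fin 2) ℂ

/-- Operators on one qubit. -/
abbrev QMat : Type := Matrix (Fin 2) (Fin 2) ℂ

/-- The operator `B ⊗ I`, with `B` acting on the cells `e i` (for injective `e`) and the identity
acting on all the others. -/
def embedOp {K L : Type} (e : K → L) (B : QOp K) : QOp L :=
  open Classical in
  fun s t => if ∀ y, y ∉ Set.range e → s y = t y then B (s ∘ e) (t ∘ e) else 0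

/-- The one-cell operator `A` acting on the cell `x`. -/
def onSite {L : Type} (x : L) (A : QMat) : QOp L :=
  open Classical in
  fun s t => if ∀ y, y ≠ x → s y = t y then A (s x) (t x) else 0

/-- The controlled-phase gate on the cells `x`, `y`:
`C_φ |a⟩|b⟩ = exp (i φ a b) |a⟩|b⟩` for `a, b ∈ {0, 1}`. -/
def ctrlPhase {L : Type} [DecidableEq (L → Fin 2)] (φ : ℝ) (x y : L) : QOp L :=
  Matrix.diagonal fun s =>
    Complex.exp (Complex.I * (φ : ℂ) * ((s x : ℕ) : ℂ) * ((s y : ℕ) : ℂ))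

/-- `n · σ` for the Pauli matrices, with `σ_z |a⟩ = (-1)^a |a⟩`. -/
def pauliVec (n : EuclideanSpace ℝ (Fin 3)) : QMat :=
  (n 0 : ℂ) • !![0, 1; 1, 0] + (n 1 : ℂ) • !![0, -Complex.I; Complex.I, 0]
    + (n 2 : ℂ) • !![1, 0; 0, -1]

/-- `U_n = exp (-i θ n · σ)`. -/
def rotGate (n : EuclideanSpace ℝ (Fin 3)) (θ : ℝ) : QMat :=
  NormedSpace.exp ((-Complex.I * (θ : ℂ)) • pauliVec n)

/-- `exp (-i θ σ_z)`. -/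
def zGate (θ : ℝ) : QMat := rotGate (EuclideanSpace.single 2 1) θ

/-- A nearest-neighbour rule: it sends an operator of the cell `0` to an operator of the cells
`-1, 0, 1` (numbered by `Fin 3` in this order). -/
abbrev CellRule : Type := QMat → QOp (Fin 3)

/-- `R` is the transition rule of a nearest-neighbour qubit QCA on `ℤ`: it is a unital
`*`-homomorphism, and the images of different cells commute.  Only cells at distance `1` or `2`
have overlapping neighbourhoods; the five cells `-1, 0, 1, 2, 3` are numbered by `Fin 5`.
Such rules and the QCAs on `ℤ` determine each other. -/
structure IsQCA (R : CellRule) : Prop where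
  isHom : ∃ h : QMat →⋆ₐ[ℂ] QOp (Fin 3), ∀ A, h A = R A
  comm_one : ∀ A B : QMat,
    Commute (embedOp (![0, 1, 2] : Fin 3 → Fin 5) (R A))
      (embedOp (![1, 2, 3] : Fin 3 → Fin 5) (R B))
  comm_two : ∀ A B : QMat,
    Commute (embedOp (![0, 1, 2] : Fin 3 → Fin 5) (R A))
      (embedOp (![2, 3, 4] : Fin 3 → Fin 5) (R B))

/-- The qubit QCA built from two layers of controlled-phase gates `C_φ` and one layer of local
gates `U`: `T₀(A) = X† (I ⊗ U† A U ⊗ I) X` with `X = (C_φ ⊗ I)(I ⊗ C_φ)`. -/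
def qubitQCA (φ : ℝ) (U : QMat) : CellRule := fun A =>
  (ctrlPhase φ (0 : Fin 3) 1 * ctrlPhase φ 1 2)ᴴ * onSite 1 (Uᴴ * A * U)
    * (ctrlPhase φ 0 1 * ctrlPhase φ 1 2)

/-- The rule `R` after the change of basis `W` in every cell. -/
def localConj (W : QMat) (R : CellRule) : CellRule := fun A =>
  (Matrix.of fun s t : Fin 3 → Fin 2 => ∏ i, W (s i) (t i)) * R (Wᴴ * A * W)
    * (Matrix.of fun s t : Fin 3 → Fin 2 => ∏ i, W (s i) (t i))ᴴ

/-- A neighbourhood scheme `N ⊂ ℤ` is regular for the wrapping `ℤ → ℤ_n`: whenever the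
neighbourhoods `N_x = x + N` and `N_y = y + N` meet, the points of `N_x ∪ N_y` that the wrapping
sends into both wrapped neighbourhoods are exactly the points of `N_x ∩ N_y`. -/
def IsRegularNbhd (N : Set ℤ) (n : ℕ) : Prop :=
  ∀ x y : ℤ, (((x + ·) '' N) ∩ ((y + ·) '' N)).Nonempty →
    {z : ℤ | (z : ZMod n) ∈ (fun w : ℤ => (x : ZMod n) + (w : ZMod n)) '' N
        ∧ (z : ZMod n) ∈ (fun w : ℤ => (y : ZMod n) + (w : ZMod n)) '' N}
      ∩ (((x + ·) '' N) ∪ ((y + ·) '' N))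
    = ((x + ·) '' N) ∩ ((y + ·) '' N)

/-- `Φ` is the wrapped evolution on `ℤ_n` with transition rule `R`. -/
def IsWrapped (R : CellRule) (n : ℕ) [NeZero n]
    (Φ : QOp (ZMod n) ≃⋆ₐ[ℂ] QOp (ZMod n)) : Prop :=
  ∀ (x : ZMod n) (A : QMat), Φ (onSite x A) = embedOp ![x - 1, x, x + 1] (R A)

/-- A pair of vectors in the space of a tile of two cells. -/
abbrev TileFrame : Type := Fin 2 → (Fin 2 × Fin 2 → ℂ)

/-- `|a⟩|b⟩`. -/
def ket (a b : Fin 2) : Fin 2 × Fin 2 → ℂ := Pi.single (a, b) 1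

/-- `|a⟩⟨a|`. -/
def proj1 (a : Fin 2) : QMat := Matrix.single a a 1

/-- `ψ` is an orthonormal basis of the range of the (rank-two) projection `P` of a tile. -/
def IsFrameOf (ψ : TileFrame) (P : Matrix (Fin 2 × Fin 2) (Fin 2 × Fin 2) ℂ) : Prop :=
  (∀ k l, star (ψ k) ⬝ᵥ ψ l = if k = l then 1 else 0)
    ∧ ∑ k, Matrix.vecMulVec (ψ k) (star (ψ k)) = P

/-- `J = ⨂ₓ J_{Λₓ}` with `J_{Λₓ} = ∑ₖ |k⟩⟨ψₖ|` and tiles `Λₓ = {2x, 2x+1}`. -/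
def coarseJ (ψ : TileFrame) (f : ℕ) [NeZero f] :
    Matrix (ZMod f → Fin 2) (ZMod (2 * f) → Fin 2) ℂ := fun k s =>
  ∏ x : ZMod f, star (ψ (k x)
    (s ((2 * x.val : ℕ) : ZMod (2 * f)), s ((2 * x.val + 1 : ℕ) : ZMod (2 * f))))

/-- `V(A) = J† A J`. -/
def coarseV (ψ : TileFrame) (f : ℕ) [NeZero f] (A : QOp (ZMod f)) : QOp (ZMod (2 * f)) :=
  (coarseJ ψ f)ᴴ * A * coarseJ ψ f

/-- The QCA `S` is a size-`2` renormalisation of the QCA `T` through the projection `P` of a tile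
of two cells, the coarse-grained cell being described in the basis `ψ` of the range of `P`:
`T_w² ∘ V = V ∘ S_w` for every wrapping on `ℤ_{2f}` for which the neighbourhood
`{-2, …, 2}` of `T²` is regular. -/
def IsRenormalisation (T S : CellRule) (P : Matrix (Fin 2 × Fin 2) (Fin 2 × Fin 2) ℂ)
    (ψ : TileFrame) : Prop :=
  IsQCA T ∧ IsQCA S ∧ IsFrameOf ψ P ∧
    ∀ (f : ℕ) [NeZero f], IsRegularNbhd (Set.Icc (-2) 2) (2 * f) →
      ∃ (Tw : QOp (ZMod (2 * f)) ≃⋆ₐ[ℂ] QOp (ZMod (2 * f)))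
        (Sw : QOp (ZMod f) ≃⋆ₐ[ℂ] QOp (ZMod f)),
        IsWrapped T (2 * f) Tw ∧ IsWrapped S f Sw ∧
          ∀ A, Tw (Tw (coarseV ψ f A)) = coarseV ψ f (Sw A)

/-- `Q₁ = |00⟩⟨00| + |11⟩⟨11|`. -/
def projQ1 : Matrix (Fin 2 × Fin 2) (Fin 2 × Fin 2) ℂ :=
  proj1 0 ⊗ₖ proj1 0 + proj1 1 ⊗ₖ proj1 1

/-- `Q₂ = |01⟩⟨01| + |10⟩⟨10|`. -/
def projQ2 : Matrix (Fin 2 × Fin 2) (Fin 2 × Fin 2) ℂ :=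
  proj1 0 ⊗ₖ proj1 1 + proj1 1 ⊗ₖ proj1 0

/-- The flow of the QCA with phase `φ` and local gate `exp (-i ϑ σ_z)`: `FlowDiag φ ϑ P ψ φ' θ'`
lists the projections `P`, the bases `ψ` and the new parameters `φ'`, `θ'`. -/
inductive FlowDiag (φ ϑ : ℝ) :
    Matrix (Fin 2 × Fin 2) (Fin 2 × Fin 2) ℂ → TileFrame → ℝ → ℝ → Prop
  | q1 : FlowDiag φ ϑ projQ1 ![ket 0 0, ket 1 1] (2 * φ) (φ + 4 * ϑ)
  | q1flip : FlowDiag φ ϑ projQ1 ![ket 1 1, ket 0 0] (2 * φ) (-4 * ϑ - 3 * φ)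
  | q2 : FlowDiag φ ϑ projQ2 ![ket 0 1, ket 1 0] (-2 * φ) φ
  | q2flip : FlowDiag φ ϑ projQ2 ![ket 1 0, ket 0 1] (-2 * φ) φ
  | right (c : Fin 2) : FlowDiag φ ϑ (1 ⊗ₖ proj1 c) ![ket 0 c, ket 1 c]
      0 (2 * (ϑ + (c : ℕ) * φ))
  | rightflip (c : Fin 2) : FlowDiag φ ϑ (1 ⊗ₖ proj1 c) ![ket 1 c, ket 0 c]
      0 (-2 * (ϑ + (c : ℕ) * φ))
  | left (c : Fin 2) : FlowDiag φ ϑ (proj1 c ⊗ₖ 1) ![ket c 0, ket c 1]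
      0 (2 * (ϑ + (c : ℕ) * φ))
  | leftflip (c : Fin 2) : FlowDiag φ ϑ (proj1 c ⊗ₖ 1) ![ket c 1, ket c 0]
      0 (-2 * (ϑ + (c : ℕ) * φ))

/-- The flow of the QCA with phase `φ` and an anti-diagonal local gate. -/
inductive FlowAnti (φ : ℝ) :
    Matrix (Fin 2 × Fin 2) (Fin 2 × Fin 2) ℂ → TileFrame → ℝ → ℝ → Prop
  | q1 : FlowAnti φ projQ1 ![ket 0 0, ket 1 1] (2 * φ) (-φ)
  | q1flip : FlowAnti φ projQ1 ![ket 1 1, ket 0 0] (2 * φ) (-φ)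
  | q2 : FlowAnti φ projQ2 ![ket 0 1, ket 1 0] (-2 * φ) φ
  | q2flip : FlowAnti φ projQ2 ![ket 1 0, ket 0 1] (-2 * φ) φ
  | right (c : Fin 2) : FlowAnti φ (1 ⊗ₖ proj1 c) ![ket 0 c, ket 1 c]
      0 ((2 * (c : ℕ) - 1) * φ)
  | rightflip (c : Fin 2) : FlowAnti φ (1 ⊗ₖ proj1 c) ![ket 1 c, ket 0 c]
      0 (-(2 * (c : ℕ) - 1) * φ)
  | left (c : Fin 2) : FlowAnti φ (proj1 c ⊗ₖ 1) ![ket c 0, ket c 1]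
      0 ((2 * (c : ℕ) - 1) * φ)
  | leftflip (c : Fin 2) : FlowAnti φ (proj1 c ⊗ₖ 1) ![ket c 1, ket c 0]
      0 (-(2 * (c : ℕ) - 1) * φ)

/-- Up to a change of orthonormal basis `W` in the coarse-grained cell, the frame `ψ` and the rule
`S` are the frame `ψ₀` and the QCA with phase `φ'` and local gate `exp (-i θ' σ_z)`. -/
def IsLocallyEquivalent (ψ : TileFrame) (S : CellRule) (ψ₀ : TileFrame) (φ' θ' : ℝ) : Prop :=
  ∃ W ∈ Matrix.unitaryGroup (Fin 2) ℂ, (∀ k, ψ k = ∑ l, star (W k l) • ψ₀ l)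
    ∧ S = localConj W (qubitQCA φ' (zGate θ'))

end

noncomputable section

/-! ### Tensor products of matrices -/

/-- The tensor product `⨂ᵢ Mᵢ` of matrices, in the product basis. -/
def tensorOp {ι α β : Type} [Fintype ι] (M : ι → Matrix α β ℂ) : Matrix (ι → α) (ι → β) ℂ :=
  fun s t => ∏ i, M i (s i) (t i)

section Tensor

variable {ι α β γ : Type} [Fintype ι]

theorem tensorOp_mul [DecidableEq ι] [Fintype β] (M : ι → Matrix α β ℂ) (N : ι → Matrix β γ ℂ) :
    tensorOp M * tensorOp N = tensorOp fun i => M i * N i := by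
  ext s t
  simp only [tensorOp, Matrix.mul_apply, Finset.prod_univ_sum, Fintype.piFinset_univ,
    Finset.prod_mul_distrib]

theorem tensorOp_one [DecidableEq ι] [DecidableEq α] :
    tensorOp (fun _ : ι => (1 : Matrix α α ℂ)) = 1 := by
  ext s t
  by_cases h : s = t
  · subst h; simp [tensorOp]
  · obtain ⟨i, hi⟩ := Function.ne_iff.1 h
    rw [Matrix.one_apply_ne h]
    exact Finset.prod_eq_zero (Finset.mem_univ i) (Matrix.one_apply_ne hi)

theorem tensorOp_conjTranspose (M : ι → Matrix α β ℂ) :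
    (tensorOp M)ᴴ = tensorOp fun i => (M i)ᴴ := by
  ext s t
  simp [tensorOp, Matrix.conjTranspose_apply]

theorem tensorOp_update_mul_apply [DecidableEq ι] [Fintype α] [DecidableEq α] (x : ι)
    (A : Matrix α α ℂ) (M : Matrix (ι → α) γ ℂ) (s : ι → α) (t : γ) :
    (tensorOp (Function.update (fun _ => 1) x A) * M) s t
      = ∑ a, A (s x) a * M (Function.update s x a) t := by
  rw [Matrix.mul_apply]
  symm
  refine Finset.sum_of_injOn (fun a => Function.update s x a) ?_ ?_ ?_ ?_
  · intro a _ b _ hab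
    simpa using congrFun hab x
  · simp
  · intro u _ hu
    have : ∃ y, y ≠ x ∧ s y ≠ u y := by
      by_contra! h
      refine hu ⟨u x, by simp, ?_⟩
      funext y
      by_cases hy : y = x
      · subst hy; simp
      · simp [hy, h y hy]
    obtain ⟨y, hy, hne⟩ := this
    rw [tensorOp, Finset.prod_eq_zero (Finset.mem_univ y), zero_mul]
    simp [hy, Matrix.one_apply_ne hne]
  · intro a _
    congr 1
    rw [tensorOp, Finset.prod_eq_single x]
    · simp
    · intro y _ hy; simp [hy]
    · simp

end Tensor

/-! ### One-cell operators -/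

section OnSite

variable {L : Type} [Fintype L] [DecidableEq L]

theorem onSite_eq_tensorOp (x : L) (A : QMat) :
    onSite x A = tensorOp (Function.update (fun _ => 1) x A) := by
  ext s t
  unfold onSite tensorOp
  split_ifs with h
  · rw [Finset.prod_eq_single x]
    · simp
    · intro y _ hy; simp [hy, h y hy]
    · simp
  · push Not at h
    obtain ⟨y, hy, hne⟩ := h
    rw [Finset.prod_eq_zero (Finset.mem_univ y)]
    simp [hy, Matrix.one_apply_ne hne]

theorem onSite_mul (x : L) (A B : QMat) : onSite x A * onSite x B = onSite x (A * B) := by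
  simp only [onSite_eq_tensorOp, tensorOp_mul]
  congr 1
  funext y
  by_cases hy : y = x
  · subst hy; simp
  · simp [hy]

theorem onSite_one (x : L) : onSite x (1 : QMat) = 1 := by
  rw [onSite_eq_tensorOp, Function.update_eq_self_iff.2 rfl, tensorOp_one]

theorem onSite_conjTranspose (x : L) (A : QMat) : (onSite x A)ᴴ = onSite x Aᴴ := by
  simp only [onSite_eq_tensorOp, tensorOp_conjTranspose]
  congr 1
  funext y
  by_cases hy : y = x
  · subst hy; simp
  · simp [hy]

theorem onSite_add (x : L) (A B : QMat) : onSite x (A + B) = onSite x A + onSite x B := by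
  ext s t
  simp only [onSite, Matrix.add_apply]
  split_ifs <;> simp

theorem onSite_smul (x : L) (c : ℂ) (A : QMat) : onSite x (c • A) = c • onSite x A := by
  ext s t
  simp only [onSite, Matrix.smul_apply]
  split_ifs <;> simp

theorem onSite_commute {x y : L} (h : x ≠ y) (A B : QMat) :
    Commute (onSite x A) (onSite y B) := by
  rw [commute_iff_eq]
  simp only [onSite_eq_tensorOp, tensorOp_mul]
  congr 1
  funext z
  by_cases hx : z = x
  · subst hx; simp [h]
  · simp [hx]

theorem onSite_mul_tensorOp (x : L) (A : QMat) (M : L → QMat) :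
    onSite x A * tensorOp M = tensorOp (Function.update M x (A * M x)) := by
  simp only [onSite_eq_tensorOp, tensorOp_mul]
  congr 1
  funext y
  by_cases hy : y = x
  · subst hy; simp
  · simp [hy]

theorem tensorOp_mul_onSite (x : L) (A : QMat) (M : L → QMat) :
    tensorOp M * onSite x A = tensorOp (Function.update M x (M x * A)) := by
  simp only [onSite_eq_tensorOp, tensorOp_mul]
  congr 1
  funext y
  by_cases hy : y = x
  · subst hy; simp
  · simp [hy]

omit [DecidableEq L] in
theorem single_eq_tensorOp (s t : L → Fin 2) :
    (Matrix.single s t 1 : QOp L) = tensorOp fun x => Matrix.single (s x) (t x) 1 := by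
  ext u v
  simp only [tensorOp, Matrix.single_apply]
  split_ifs with h
  · obtain ⟨rfl, rfl⟩ := h; simp
  · by_contra hne
    have := Finset.prod_ne_zero_iff.1 (Ne.symm hne)
    refine h ⟨funext fun x => ?_, funext fun x => ?_⟩ <;>
    · have := this x (Finset.mem_univ x)
      simp at this
      simp [this]

/-- The one-cell operators generate the algebra of all operators. -/
theorem algHom_ext_onSite {B : Type} [Ring B] [Algebra ℂ B] (f g : QOp L →ₐ[ℂ] B)
    (h : ∀ x A, f (onSite x A) = g (onSite x A)) : f = g := by
  -- Product operators are built one cell at a time; matrix units are product operators and span the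
  -- algebra.
  have key : ∀ (M : L → QMat) (F : Finset L),
      f (tensorOp fun x => if x ∈ F then M x else 1)
        = g (tensorOp fun x => if x ∈ F then M x else 1) := by
    intro M F
    induction F using Finset.induction_on with
    | empty => simp [tensorOp_one]
    | insert x F hx ih =>
      have : (tensorOp fun y => if y ∈ insert x F then M y else 1)
          = onSite x (M x) * tensorOp fun y => if y ∈ F then M y else 1 := by
        rw [onSite_mul_tensorOp]
        congr 1
        funext y
        by_cases hy : y = x
        · subst hy; simp [hx]
        · simp [hy]
      rw [this, map_mul, map_mul, h, ih]
  apply AlgHom.ext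
  intro M
  rw [Matrix.matrix_eq_sum_single M]
  simp only [map_sum]
  refine Finset.sum_congr rfl fun s _ => Finset.sum_congr rfl fun t _ => ?_
  have := key (fun x => Matrix.single (s x) (t x) 1) Finset.univ
  simp only [Finset.mem_univ, if_true, ← single_eq_tensorOp] at this
  have e : Matrix.single s t (M s t) = M s t • (Matrix.single s t 1 : QOp L) := by simp
  rw [e, map_smul, map_smul, this]

end OnSite

/-! ### Phases and evolutions on rings -/

/-- `exp (i φ a b)`. -/
def phase (φ : ℝ) (a b : Fin 2) : ℂ :=
  Complex.exp (Complex.I * (φ : ℂ) * ((a : ℕ) : ℂ) * ((b : ℕ) : ℂ))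

theorem star_phase_mul (φ : ℝ) (a b : Fin 2) : star (phase φ a b) * phase φ a b = 1 := by
  simp only [phase, Complex.star_def, ← Complex.exp_conj, ← Complex.exp_add]
  simp

theorem phase_ne_zero (φ : ℝ) (a b : Fin 2) : phase φ a b ≠ 0 := Complex.exp_ne_zero _

@[simp] theorem phase_zero_left (φ : ℝ) (b : Fin 2) : phase φ 0 b = 1 := by simp [phase]

@[simp] theorem phase_zero_right (φ : ℝ) (b : Fin 2) : phase φ b 0 = 1 := by simp [phase]

theorem phase_one_one (φ : ℝ) : phase φ 1 1 = Complex.exp (Complex.I * φ) := by simp [phase]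

theorem phase_comm (φ : ℝ) (a b : Fin 2) : phase φ a b = phase φ b a := by
  simp only [phase]; ring_nf

/-- The phase collected by a configuration from all the bonds of the ring. -/
def ringPhase (φ : ℝ) (n : ℕ) [NeZero n] (s : ZMod n → Fin 2) : ℂ :=
  ∏ x, phase φ (s x) (s (x + 1))

/-- The unitary implementing one step on the ring. -/
def ringStep (φ : ℝ) (U : QMat) (n : ℕ) [NeZero n] : QOp (ZMod n) :=
  tensorOp (fun _ => U) * Matrix.diagonal (ringPhase φ n)

theorem star_ringPhase_mul (φ : ℝ) (n : ℕ) [NeZero n] (s : ZMod n → Fin 2) :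
    star (ringPhase φ n s) * ringPhase φ n s = 1 := by
  simp only [ringPhase, star_prod, ← Finset.prod_mul_distrib, star_phase_mul, Finset.prod_const_one]

theorem diagonal_conjTranspose_mul_self {α : Type} [Fintype α] [DecidableEq α] {d : α → ℂ}
    (hd : ∀ s, star (d s) * d s = 1) :
    (Matrix.diagonal d)ᴴ * Matrix.diagonal d = 1 := by
  rw [Matrix.diagonal_conjTranspose, Matrix.diagonal_mul_diagonal, ← Matrix.diagonal_one]
  congr 1
  funext s
  simpa using hd s

theorem ringStep_mem_unitary (φ : ℝ) {U : QMat} (hU : Uᴴ * U = 1) (n : ℕ) [NeZero n] :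
    (ringStep φ U n)ᴴ * ringStep φ U n = 1 := by
  rw [ringStep, Matrix.conjTranspose_mul, Matrix.mul_assoc,
    ← Matrix.mul_assoc _ _ (Matrix.diagonal _),
    tensorOp_conjTranspose, tensorOp_mul]
  simp only [hU, tensorOp_one, Matrix.one_mul]
  exact diagonal_conjTranspose_mul_self (star_ringPhase_mul φ n)

theorem qubitQCA_apply (φ : ℝ) (U A : QMat) (s t : Fin 3 → Fin 2) :
    qubitQCA φ U A s t = star (phase φ (s 0) (s 1) * phase φ (s 1) (s 2))
      * onSite 1 (Uᴴ * A * U) s t * (phase φ (t 0) (t 1) * phase φ (t 1) (t 2)) := by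
  simp only [qubitQCA, ctrlPhase, Matrix.diagonal_mul_diagonal, Matrix.diagonal_conjTranspose,
    Matrix.mul_diagonal, Matrix.diagonal_mul, phase, Pi.star_apply]

/-- A one-cell operator connects only configurations that differ at that cell, so conjugation by a
diagonal phase d sees d only through its ratios on such pairs. This is how a global bond phase can
replace the two local gates. -/
theorem embedOp_qubitQCA {L : Type} [Fintype L] [DecidableEq L] {e : Fin 3 → L}
    (he : Function.Injective e) (φ : ℝ) (U : QMat) (d : (L → Fin 2) → ℂ)
    (hd : ∀ s t : L → Fin 2, (∀ y, y ≠ e 1 → s y = t y) →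
      star (d s) * d t = star (phase φ (s (e 0)) (s (e 1)) * phase φ (s (e 1)) (s (e 2)))
        * (phase φ (t (e 0)) (t (e 1)) * phase φ (t (e 1)) (t (e 2)))) (A : QMat) :
    embedOp e (qubitQCA φ U A)
      = (Matrix.diagonal d)ᴴ * onSite (e 1) (Uᴴ * A * U) * Matrix.diagonal d := by
  ext s t
  rw [Matrix.diagonal_conjTranspose, Matrix.mul_diagonal, Matrix.diagonal_mul, embedOp]
  by_cases h : ∀ y, y ≠ e 1 → s y = t y
  · rw [if_pos fun y hy => h y fun h1 => hy ⟨1, h1.symm⟩, qubitQCA_apply]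
    have h2 : onSite 1 (Uᴴ * A * U) (s ∘ e) (t ∘ e) = (Uᴴ * A * U) (s (e 1)) (t (e 1)) := by
      rw [onSite, if_pos]
      · rfl
      · intro i hi
        exact h _ fun h' => hi (he h')
    have h3 : onSite (e 1) (Uᴴ * A * U) s t = (Uᴴ * A * U) (s (e 1)) (t (e 1)) := by
      rw [onSite, if_pos h]
    rw [h2, h3, Pi.star_apply, mul_right_comm (star (d s)), hd s t h]
    simp only [Function.comp]
    ring
  · have h3 : onSite (e 1) (Uᴴ * A * U) s t = 0 := by rw [onSite, if_neg h]
    rw [h3, mul_zero, zero_mul]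
    split_ifs with h1
    · rw [qubitQCA_apply, onSite, if_neg, mul_zero, zero_mul]
      intro h4
      refine h fun y hy => ?_
      by_cases hr : y ∈ Set.range e
      · obtain ⟨i, rfl⟩ := hr
        exact h4 i fun hi => hy (by rw [hi])
      · exact h1 y hr
    · rfl

theorem ZMod.neighbours_injective {n : ℕ} (hn : 3 ≤ n) (x : ZMod n) :
    Function.Injective ![x - 1, x, x + 1] := by
  have h1 : (1 : ZMod n) ≠ 0 := by
    have := (ZMod.natCast_eq_zero_iff 1 n).not.2
      (by intro h; have := Nat.le_of_dvd one_pos h; omega)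
    simpa using this
  have h2 : (2 : ZMod n) ≠ 0 := by
    have := (ZMod.natCast_eq_zero_iff 2 n).not.2
      (by intro h; have := Nat.le_of_dvd two_pos h; omega)
    simpa using this
  have h3 : x - 1 ≠ x + 1 := fun h => h2 (by linear_combination h.symm)
  have h4 : x - 1 ≠ x := fun h => h1 (by linear_combination h.symm)
  have h5 : x ≠ x + 1 := fun h => h1 (by linear_combination h.symm)
  intro i j h
  fin_cases i <;> fin_cases j
  exacts [rfl, absurd h h4, absurd h h3, absurd h h4.symm, rfl, absurd h h5, absurd h h3.symm,
    absurd h h5.symm, rfl]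

theorem star_ringPhase_mul_of_eq_off (φ : ℝ) {n : ℕ} [NeZero n] (hn : 3 ≤ n) (x : ZMod n)
    (s t : ZMod n → Fin 2) (h : ∀ y, y ≠ x → s y = t y) :
    star (ringPhase φ n s) * ringPhase φ n t
      = star (phase φ (s (x - 1)) (s x) * phase φ (s x) (s (x + 1)))
        * (phase φ (t (x - 1)) (t x) * phase φ (t x) (t (x + 1))) := by
  have hne : x - 1 ≠ x := fun h' => by
    have := ZMod.neighbours_injective hn x (a₁ := 0) (a₂ := 1) (by simpa using h')
    simp at this
  simp only [ringPhase, star_prod, ← Finset.prod_mul_distrib]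
  rw [Fintype.prod_eq_mul (x - 1) x hne]
  · simp only [sub_add_cancel, star_mul']
    ring
  · rintro y ⟨h1, h2⟩
    rw [h y h2, h (y + 1) fun h' => h1 (by rw [← h']; ring), star_phase_mul]

/-- Conjugation by the step unitary implements the local rule. -/
theorem ringStep_conj_onSite (φ : ℝ) {U : QMat} (hU : Uᴴ * U = 1) {n : ℕ} [NeZero n] (hn : 3 ≤ n)
    (x : ZMod n) (A : QMat) :
    (ringStep φ U n)ᴴ * onSite x A * ringStep φ U n
      = embedOp ![x - 1, x, x + 1] (qubitQCA φ U A) := by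
  rw [embedOp_qubitQCA (ZMod.neighbours_injective hn x) φ U (ringPhase φ n)
    (fun s t h => star_ringPhase_mul_of_eq_off φ hn x s t h)]
  have : (tensorOp fun _ : ZMod n => U)ᴴ * onSite x A * tensorOp (fun _ => U)
      = onSite x (Uᴴ * A * U) := by
    rw [tensorOp_conjTranspose, tensorOp_mul_onSite, tensorOp_mul, onSite_eq_tensorOp]
    congr 1
    funext y
    by_cases hy : y = x
    · subst hy; simp
    · simp [hy, hU]
  change _ = _ * onSite x (Uᴴ * A * U) * _
  rw [ringStep, Matrix.conjTranspose_mul, ← this]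
  simp only [Matrix.mul_assoc]

/-- The wrapped evolution as an automorphism. -/
def ringEvolution (φ : ℝ) (U : QMat) (hU : Uᴴ * U = 1) (n : ℕ) [NeZero n] :
    QOp (ZMod n) ≃⋆ₐ[ℂ] QOp (ZMod n) :=
  Unitary.conjStarAlgAut ℂ (QOp (ZMod n)) (star ⟨ringStep φ U n,
    Unitary.mem_iff.2 ⟨ringStep_mem_unitary φ hU n,
      mul_eq_one_comm.1 (ringStep_mem_unitary φ hU n)⟩⟩)

theorem ringEvolution_apply (φ : ℝ) (U : QMat) (hU : Uᴴ * U = 1) (n : ℕ) [NeZero n]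
    (A : QOp (ZMod n)) :
    ringEvolution φ U hU n A = (ringStep φ U n)ᴴ * A * ringStep φ U n :=
  Unitary.conjStarAlgAut_star_apply _ _

theorem isWrapped_ringEvolution (φ : ℝ) (U : QMat) (hU : Uᴴ * U = 1) {n : ℕ} [NeZero n]
    (hn : 3 ≤ n) : IsWrapped (qubitQCA φ U) n (ringEvolution φ U hU n) := fun x A => by
  rw [ringEvolution_apply, ringStep_conj_onSite φ hU hn]

theorem IsWrapped.unique {R : CellRule} {n : ℕ} [NeZero n]
    {Φ Ψ : QOp (ZMod n) ≃⋆ₐ[ℂ] QOp (ZMod n)} (hΦ : IsWrapped R n Φ) (hΨ : IsWrapped R n Ψ)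
    (A : QOp (ZMod n)) : Φ A = Ψ A := by
  have := algHom_ext_onSite (Φ.toAlgEquiv : QOp (ZMod n) →ₐ[ℂ] QOp (ZMod n))
    (Ψ.toAlgEquiv : QOp (ZMod n) →ₐ[ℂ] QOp (ZMod n)) fun x A => (hΦ x A).trans (hΨ x A).symm
  exact DFunLike.congr_fun this A

theorem IsWrapped.eq_conj {φ : ℝ} {U : QMat} (hU : Uᴴ * U = 1) {n : ℕ} [NeZero n] (hn : 3 ≤ n)
    {Φ : QOp (ZMod n) ≃⋆ₐ[ℂ] QOp (ZMod n)} (hΦ : IsWrapped (qubitQCA φ U) n Φ)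
    (A : QOp (ZMod n)) : Φ A = (ringStep φ U n)ᴴ * A * ringStep φ U n := by
  rw [hΦ.unique (isWrapped_ringEvolution φ U hU hn), ringEvolution_apply]

theorem embedOp_id (B : QOp (Fin 3)) : embedOp (![0, 1, 2] : Fin 3 → Fin 3) B = B := by
  have h : (![0, 1, 2] : Fin 3 → Fin 3) = id := by
    funext i; fin_cases i <;> rfl
  ext s t
  simp [h, embedOp]

theorem isQCA_qubitQCA (φ : ℝ) {U : QMat} (hU : Uᴴ * U = 1) : IsQCA (qubitQCA φ U) := by
  -- On the ring of five cells the neighbourhoods of 1, 2, 3 are exactly the three windows in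
  -- `IsQCA`. The images are images of commuting operators under one automorphism.
  have hc : ∀ (x y : ZMod 5) (A B : QMat), x ≠ y →
      Commute (embedOp ![x - 1, x, x + 1] (qubitQCA φ U A))
        (embedOp ![y - 1, y, y + 1] (qubitQCA φ U B)) := by
    intro x y A B hxy
    rw [← ringStep_conj_onSite φ hU (by norm_num), ← ringStep_conj_onSite φ hU (by norm_num),
      ← ringEvolution_apply φ U hU, ← ringEvolution_apply φ U hU]
    exact (onSite_commute hxy A B).map (ringEvolution φ U hU 5)
  refine ⟨⟨(ringEvolution φ U hU 3 : QOp (ZMod 3) →⋆ₐ[ℂ] QOp (ZMod 3)).comp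
    { toFun := fun A => onSite (1 : ZMod 3) A
      map_one' := onSite_one _
      map_mul' := fun A B => (onSite_mul _ A B).symm
      map_zero' := by simpa using onSite_smul (1 : ZMod 3) 0 0
      map_add' := onSite_add _
      commutes' := fun c => by
        rw [Algebra.algebraMap_eq_smul_one, Algebra.algebraMap_eq_smul_one, onSite_smul, onSite_one]
      map_star' := fun A => (onSite_conjTranspose _ A).symm }, fun A => ?_⟩, fun A B => ?_,
    fun A B => ?_⟩
  · exact (isWrapped_ringEvolution φ U hU (le_refl 3) 1 A).trans (embedOp_id _)
  · exact hc 1 2 A B (by decide)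
  · exact hc 1 3 A B (by decide)

/-! ### The local gates -/

/-- The exponential of a multiple of an involution. -/
theorem exp_smul_of_mul_self_eq_one {N : QMat} (hN : N * N = 1) (z : ℂ) :
    NormedSpace.exp (z • N) = Complex.cosh z • (1 : QMat) + Complex.sinh z • N := by
  -- Functional calculus for N: a pair lists the values at the eigenvalues 1 and -1, with spectral
  -- projections (1 ± N)/2. The exponential of a pair is taken coordinatewise.
  let f : ℂ × ℂ →+* QMat :=
    { toFun := fun a => ((a.1 + a.2) / 2) • (1 : QMat) + ((a.1 - a.2) / 2) • N
      map_one' := by simp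
      map_zero' := by simp
      map_add' := fun a b => by
        simp only [Prod.fst_add, Prod.snd_add]
        module
      map_mul' := fun a b => by
        simp only [Prod.fst_mul, Prod.snd_mul, mul_add, add_mul, smul_mul_smul_comm, mul_one,
          one_mul, hN]
        module }
  let _ : NormedRing QMat := Matrix.linftyOpNormedRing
  let _ : NormedAlgebra ℚ QMat := Matrix.linftyOpNormedAlgebra
  have hf : Continuous f := by
    change Continuous fun a : ℂ × ℂ => ((a.1 + a.2) / 2) • (1 : QMat) + ((a.1 - a.2) / 2) • N
    fun_prop
  have h := NormedSpace.map_exp f hf (z, -z)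
  have h1 : f (z, -z) = z • N := by
    change ((z + -z) / 2) • (1 : QMat) + ((z - -z) / 2) • N = _
    module
  have h2 : f (NormedSpace.exp (z, -z))
      = ((Complex.exp z + Complex.exp (-z)) / 2) • (1 : QMat)
        + ((Complex.exp z - Complex.exp (-z)) / 2) • N := by
    change (((NormedSpace.exp (z, -z)).1 + (NormedSpace.exp (z, -z)).2) / 2) • (1 : QMat)
      + (((NormedSpace.exp (z, -z)).1 - (NormedSpace.exp (z, -z)).2) / 2) • N = _
    rw [Prod.fst_exp, Prod.snd_exp, Complex.exp_eq_exp_ℂ]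
  rw [← h1, Complex.cosh, Complex.sinh]
  exact h.symm.trans h2

theorem sum_sq_eq_one {n : EuclideanSpace ℝ (Fin 3)} (hn : ‖n‖ = 1) :
    n 0 ^ 2 + n 1 ^ 2 + n 2 ^ 2 = 1 := by
  have := EuclideanSpace.norm_sq_eq n
  rw [hn, Fin.sum_univ_three] at this
  simpa using this.symm

theorem pauliVec_eq (n : EuclideanSpace ℝ (Fin 3)) :
    pauliVec n = !![(n 2 : ℂ), n 0 - Complex.I * n 1; n 0 + Complex.I * n 1, -(n 2 : ℂ)] := by
  ext i j
  fin_cases i <;> fin_cases j <;> simp [pauliVec] <;> ring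

theorem pauliVec_mul_self {n : EuclideanSpace ℝ (Fin 3)} (hn : ‖n‖ = 1) :
    pauliVec n * pauliVec n = 1 := by
  have h : (n 0 : ℂ) ^ 2 + (n 1 : ℂ) ^ 2 + (n 2 : ℂ) ^ 2 = 1 := by
    simpa using congrArg Complex.ofReal (sum_sq_eq_one hn)
  rw [pauliVec_eq]
  ext i j
  fin_cases i <;> fin_cases j <;> simp [Matrix.mul_apply, Fin.sum_univ_two]
  · linear_combination h - (n 1 : ℂ) ^ 2 * Complex.I_sq
  · ring
  · ring
  · linear_combination h - (n 1 : ℂ) ^ 2 * Complex.I_sq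

theorem rotGate_eq {n : EuclideanSpace ℝ (Fin 3)} (hn : ‖n‖ = 1) (θ : ℝ) :
    rotGate n θ = !![Real.cos θ - Complex.I * Real.sin θ * n 2,
        -Complex.I * Real.sin θ * (n 0 - Complex.I * n 1);
      -Complex.I * Real.sin θ * (n 0 + Complex.I * n 1),
        Real.cos θ + Complex.I * Real.sin θ * n 2] := by
  rw [rotGate, exp_smul_of_mul_self_eq_one (pauliVec_mul_self hn), pauliVec_eq]
  have h1 : Complex.cosh (-Complex.I * θ) = Real.cos θ := by
    rw [neg_mul, Complex.cosh_neg, mul_comm, Complex.cosh_mul_I, Complex.ofReal_cos]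
  have h2 : Complex.sinh (-Complex.I * θ) = -Complex.I * Real.sin θ := by
    rw [neg_mul, Complex.sinh_neg, mul_comm, Complex.sinh_mul_I, Complex.ofReal_sin]; ring
  rw [h1, h2]
  ext i j
  fin_cases i <;> fin_cases j <;> simp; ring

theorem rotGate_conjTranspose_mul {n : EuclideanSpace ℝ (Fin 3)} (hn : ‖n‖ = 1) (θ : ℝ) :
    (rotGate n θ)ᴴ * rotGate n θ = 1 := by
  have h : (n 0 : ℂ) ^ 2 + (n 1 : ℂ) ^ 2 + (n 2 : ℂ) ^ 2 = 1 := by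
    simpa using congrArg Complex.ofReal (sum_sq_eq_one hn)
  have h' : (Real.cos θ : ℂ) ^ 2 + (Real.sin θ : ℂ) ^ 2 = 1 := by
    exact_mod_cast Real.cos_sq_add_sin_sq θ
  have hI := Complex.I_sq
  rw [rotGate_eq hn]
  generalize (Real.cos θ) = c at *
  generalize (Real.sin θ) = s at *
  ext i j
  fin_cases i <;> fin_cases j <;>
    simp [Matrix.mul_apply, Fin.sum_univ_two, Matrix.conjTranspose_apply]
  · linear_combination h' + (s : ℂ) ^ 2 * h - ((s : ℂ) ^ 2 * (n 2 : ℂ) ^ 2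
      + (s : ℂ) ^ 2 * (n 0 : ℂ) ^ 2 + (s : ℂ) ^ 2 * (n 1 : ℂ) ^ 2 * (1 - Complex.I ^ 2)) * hI
  · ring_nf
  · ring_nf
  · linear_combination h' + (s : ℂ) ^ 2 * h - ((s : ℂ) ^ 2 * (n 2 : ℂ) ^ 2
      + (s : ℂ) ^ 2 * (n 0 : ℂ) ^ 2 + (s : ℂ) ^ 2 * (n 1 : ℂ) ^ 2 * (1 - Complex.I ^ 2)) * hI

theorem norm_single_two : ‖(EuclideanSpace.single 2 1 : EuclideanSpace ℝ (Fin 3))‖ = 1 := by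
  simp

theorem rotGate_of_diagonal {n : EuclideanSpace ℝ (Fin 3)} (hn : ‖n‖ = 1) (h0 : n 0 = 0)
    (h1 : n 1 = 0) (θ : ℝ) :
    rotGate n θ = Matrix.diagonal
      ![Complex.exp (-(Complex.I * ((n 2 * θ : ℝ) : ℂ))),
        Complex.exp (Complex.I * ((n 2 * θ : ℝ) : ℂ))] := by
  have h2 : n 2 = 1 ∨ n 2 = -1 := by
    have := sum_sq_eq_one hn
    rw [h0, h1] at this
    simpa using this
  have e1 : Complex.exp (Complex.I * ((n 2 * θ : ℝ) : ℂ))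
      = Real.cos θ + Complex.I * Real.sin θ * n 2 := by
    rw [mul_comm, Complex.exp_mul_I, ← Complex.ofReal_cos, ← Complex.ofReal_sin]
    rcases h2 with h2 | h2 <;> simp [h2] <;> ring
  have e2 : Complex.exp (-(Complex.I * ((n 2 * θ : ℝ) : ℂ)))
      = Real.cos θ - Complex.I * Real.sin θ * n 2 := by
    rw [← mul_neg, mul_comm, ← Complex.ofReal_neg, Complex.exp_mul_I, ← Complex.ofReal_cos,
      ← Complex.ofReal_sin]
    rcases h2 with h2 | h2 <;> simp [h2] <;> ring
  rw [rotGate_eq hn, e1, e2, h0, h1]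
  ext i j
  fin_cases i <;> fin_cases j <;> simp

theorem zGate_eq (θ : ℝ) :
    zGate θ = Matrix.diagonal ![Complex.exp (-(Complex.I * θ)), Complex.exp (Complex.I * θ)] := by
  rw [zGate, rotGate_of_diagonal norm_single_two (by simp) (by simp)]
  simp

theorem zGate_conjTranspose_mul (θ : ℝ) : (zGate θ)ᴴ * zGate θ = 1 :=
  rotGate_conjTranspose_mul norm_single_two θ

/-! ### Regular wrappings -/

/-- On rings of 2 or 4 cells, 4 becomes 0. The neighbourhoods of 0 and 4, which meet only in 2, are
then identified, and -2 is a new overlap. -/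
theorem three_le_of_isRegularNbhd {f : ℕ} [NeZero f]
    (h : IsRegularNbhd (Set.Icc (-2) 2) (2 * f)) : 3 ≤ f := by
  by_contra hf
  have hf' : f = 1 ∨ f = 2 := by have := NeZero.ne f; omega
  have h4 : ((4 : ℤ) : ZMod (2 * f)) = 0 := by
    rw [ZMod.intCast_zmod_eq_zero_iff_dvd]
    rcases hf' with rfl | rfl <;> norm_num
  have := h 0 4 ⟨2, ⟨2, by simp⟩, ⟨-2, by simp⟩⟩
  have h2 : (-2 : ℤ) ∈ ((0 + ·) '' Set.Icc (-2 : ℤ) 2) ∩ ((4 + ·) '' Set.Icc (-2 : ℤ) 2) := by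
    rw [← this]
    refine ⟨⟨⟨-2, by simp, by simp⟩, ⟨-2, by simp, by simp only [h4, zero_add]⟩⟩,
      Or.inl ⟨-2, by simp⟩⟩
  obtain ⟨_, ⟨w, hw, hw'⟩⟩ := h2
  simp only [Set.mem_Icc] at hw
  simp only at hw'
  omega

/-- Meeting neighbourhoods have centres at distance at most 4, and two offsets differ by at most 4.
A coincidence modulo 10 therefore compares integers at distance at most 8, so it is an equality. -/
theorem isRegularNbhd_ten : IsRegularNbhd (Set.Icc (-2) 2) (2 * 5) := by
  intro x y hxy
  obtain ⟨z, ⟨a, ha, rfl⟩, ⟨b, hb, hab⟩⟩ := hxy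
  have cast : ∀ u v w : ℤ, (u : ZMod (2 * 5)) + (v : ZMod (2 * 5)) = (w : ZMod (2 * 5)) →
      ∃ m, w = u + v + 10 * m := by
    intro u v w h
    rw [← Int.cast_add, ZMod.intCast_eq_intCast_iff_dvd_sub] at h
    obtain ⟨m, hm⟩ := h
    exact ⟨m, by push_cast at hm; linarith⟩
  simp only [Set.mem_Icc] at ha hb hab
  ext z
  simp only [Set.mem_inter_iff, Set.mem_ofPred_eq, Set.mem_union, Set.mem_image, Set.mem_Icc]
  constructor
  · rintro ⟨⟨⟨u, hu, hu'⟩, ⟨v, hv, hv'⟩⟩, h⟩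
    obtain ⟨m, hm⟩ := cast _ _ _ hu'
    obtain ⟨k, hk⟩ := cast _ _ _ hv'
    rcases h with ⟨w, hw, rfl⟩ | ⟨w, hw, rfl⟩
    · exact ⟨⟨w, hw, rfl⟩, ⟨v, hv, by omega⟩⟩
    · exact ⟨⟨u, hu, by omega⟩, ⟨w, hw, rfl⟩⟩
  · rintro ⟨⟨u, hu, rfl⟩, ⟨v, hv, h⟩⟩
    refine ⟨⟨⟨u, hu, by push_cast; rfl⟩, ⟨v, hv, by rw [← h]; push_cast; rfl⟩⟩, Or.inl ⟨u, hu, rfl⟩⟩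

/-! ### The lattice of tiles -/

section Tiles

variable (f : ℕ) [NeZero f]

/-- The `i`-th cell of the tile `x`. -/
def tileSite (p : ZMod f × Fin 2) : ZMod (2 * f) := ((2 * p.1.val + (p.2 : ℕ) : ℕ) : ZMod (2 * f))

theorem tileSite_injective : Function.Injective (tileSite f) := by
  rintro ⟨x, i⟩ ⟨y, j⟩ h
  have hx := ZMod.val_lt x
  have hy := ZMod.val_lt y
  have hi := i.isLt
  have hj := j.isLt
  have h' := congrArg ZMod.val h
  simp only [tileSite] at h'
  rw [ZMod.val_natCast_of_lt (by omega), ZMod.val_natCast_of_lt (by omega)] at h'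
  have h1 : x = y := ZMod.val_injective f (by omega)
  have h2 : i = j := Fin.ext (by omega)
  rw [h1, h2]

/-- The cells of the fine ring, numbered by a tile and a position in the tile. -/
def tileSiteEquiv : ZMod f × Fin 2 ≃ ZMod (2 * f) :=
  Equiv.ofBijective (tileSite f)
    ((Fintype.bijective_iff_injective_and_card _).2 ⟨tileSite_injective f, by
      simp [ZMod.card, mul_comm]⟩)

/-- A configuration of the fine ring as a configuration of tiles. -/
def tileEquiv : (ZMod (2 * f) → Fin 2) ≃ (ZMod f → Fin 2 × Fin 2) :=
  ((tileSiteEquiv f).symm.arrowCongr (Equiv.refl _)).trans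
    ((Equiv.curry _ _ _).trans (Equiv.piCongrRight fun _ => finTwoArrowEquiv (Fin 2)))

theorem tileEquiv_apply (s : ZMod (2 * f) → Fin 2) (x : ZMod f) :
    tileEquiv f s x
      = (s ((2 * x.val : ℕ) : ZMod (2 * f)), s ((2 * x.val + 1 : ℕ) : ZMod (2 * f))) :=
  rfl

theorem prod_ring_eq_prod_tiles (F : ZMod (2 * f) → ℂ) :
    ∏ y, F y = ∏ x : ZMod f, (F ((2 * x.val : ℕ) : ZMod (2 * f))
      * F ((2 * x.val + 1 : ℕ) : ZMod (2 * f))) := by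
  rw [← (tileSiteEquiv f).prod_comp, Fintype.prod_prod_type]
  simp only [Fin.prod_univ_two]
  rfl

theorem tileSite_succ (x : ZMod f) :
    ((2 * x.val + 1 : ℕ) : ZMod (2 * f)) + 1 = ((2 * (x + 1).val : ℕ) : ZMod (2 * f)) := by
  have h : (x + 1).val = (x.val + 1) % f := by
    rw [ZMod.val_add, ZMod.val_one_eq_one_mod, Nat.add_mod_mod]
  rw [h, ← Nat.mul_mod_mul_left, ZMod.natCast_mod]
  push_cast
  ring

variable {f}

theorem prod_bonds_eq_prod_tiles (w : Fin 2 → Fin 2 → ℂ) (s : ZMod (2 * f) → Fin 2) :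
    ∏ y, w (s y) (s (y + 1)) = ∏ x : ZMod f, (w (tileEquiv f s x).1 (tileEquiv f s x).2
      * w (tileEquiv f s x).2 (tileEquiv f s (x + 1)).1) := by
  rw [prod_ring_eq_prod_tiles]
  simp only [tileEquiv_apply, tileSite_succ]
  push_cast
  rfl

end Tiles

/-- The map `∑ₖ |k⟩⟨ψₖ|` of one tile. -/
def frameMat (ψ : TileFrame) : Matrix (Fin 2) (Fin 2 × Fin 2) ℂ := fun k p => star (ψ k p)

theorem frameMat_mul_conjTranspose {ψ : TileFrame} {P} (h : IsFrameOf ψ P) :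
    frameMat ψ * (frameMat ψ)ᴴ = 1 := by
  ext k l
  have := h.1 k l
  rw [Matrix.one_apply, ← this]
  simp [frameMat, Matrix.mul_apply, Matrix.conjTranspose_apply, dotProduct]

theorem frameMat_conjTranspose_mul {ψ : TileFrame} {P} (h : IsFrameOf ψ P) :
    (frameMat ψ)ᴴ * frameMat ψ = P := by
  rw [← h.2]
  ext p q
  simp [frameMat, Matrix.mul_apply, Matrix.conjTranspose_apply, Matrix.vecMulVec_apply,
    Matrix.sum_apply]

/-- `⨂ₓ ∑ₖ |k⟩⟨ψₖ|` on the lattice of tiles. -/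
def tileJ (ψ : TileFrame) (f : ℕ) [NeZero f] :
    Matrix (ZMod f → Fin 2) (ZMod f → Fin 2 × Fin 2) ℂ := tensorOp fun _ => frameMat ψ

theorem coarseJ_eq (ψ : TileFrame) (f : ℕ) [NeZero f] :
    coarseJ ψ f = (tileJ ψ f).submatrix id (tileEquiv f) := rfl

theorem tileJ_mul_conjTranspose {ψ : TileFrame} {P} (h : IsFrameOf ψ P) (f : ℕ) [NeZero f] :
    tileJ ψ f * (tileJ ψ f)ᴴ = 1 := by
  rw [tileJ, tensorOp_conjTranspose, tensorOp_mul]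
  simp only [frameMat_mul_conjTranspose h, tensorOp_one]

/-- The phase collected by a configuration of tiles from all the bonds. -/
def tilePhase (φ : ℝ) (f : ℕ) [NeZero f] (s : ZMod f → Fin 2 × Fin 2) : ℂ :=
  ∏ x, (phase φ (s x).1 (s x).2 * phase φ (s x).2 (s (x + 1)).1)

/-- The unitary implementing one step, on the lattice of tiles. -/
def tileStep (φ : ℝ) (U : QMat) (f : ℕ) [NeZero f] :
    Matrix (ZMod f → Fin 2 × Fin 2) (ZMod f → Fin 2 × Fin 2) ℂ :=
  tensorOp (fun _ => U ⊗ₖ U) * Matrix.diagonal (tilePhase φ f)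

theorem ringStep_eq_submatrix (φ : ℝ) (U : QMat) (f : ℕ) [NeZero f] :
    ringStep φ U (2 * f) = (tileStep φ U f).submatrix (tileEquiv f) (tileEquiv f) := by
  rw [ringStep, tileStep, ← Matrix.submatrix_mul_equiv _ _ _ (tileEquiv f)]
  congr 1
  · ext s t
    simp only [tensorOp, Matrix.submatrix_apply, Matrix.kroneckerMap_apply, tileEquiv_apply]
    exact prod_ring_eq_prod_tiles f _
  · rw [Matrix.submatrix_diagonal_equiv]
    congr 1
    funext s
    exact prod_bonds_eq_prod_tiles _ s

theorem tileStep_conjTranspose_mul (φ : ℝ) {U : QMat} (hU : Uᴴ * U = 1) (f : ℕ) [NeZero f] :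
    (tileStep φ U f)ᴴ * tileStep φ U f = 1 := by
  have h := ringStep_mem_unitary φ hU (2 * f)
  rw [ringStep_eq_submatrix, Matrix.conjTranspose_submatrix, Matrix.submatrix_mul_equiv] at h
  have h' := congrArg (fun M => M.submatrix (tileEquiv f).symm (tileEquiv f).symm) h
  simpa using h'

/-- Two steps of the fine evolution on coarse-grained operators, on the lattice of tiles. -/
theorem conj_coarseV_eq_iff (φ : ℝ) (U : QMat) (ψ : TileFrame) (f : ℕ) [NeZero f]
    (A B : QOp (ZMod f)) :
    (ringStep φ U (2 * f))ᴴ * ((ringStep φ U (2 * f))ᴴ * coarseV ψ f A * ringStep φ U (2 * f))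
        * ringStep φ U (2 * f) = coarseV ψ f B ↔
      (tileStep φ U f)ᴴ * ((tileStep φ U f)ᴴ * ((tileJ ψ f)ᴴ * A * tileJ ψ f) * tileStep φ U f)
        * tileStep φ U f = (tileJ ψ f)ᴴ * B * tileJ ψ f := by
  have hV : ∀ A : QOp (ZMod f), coarseV ψ f A
      = ((tileJ ψ f)ᴴ * A * tileJ ψ f).submatrix (tileEquiv f) (tileEquiv f) := by
    intro A
    rw [coarseV, coarseJ_eq, Matrix.conjTranspose_submatrix]
    rfl
  rw [hV, hV, ringStep_eq_submatrix, Matrix.conjTranspose_submatrix]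
  simp only [Matrix.submatrix_mul_equiv]
  constructor
  · intro h
    have h' := congrArg (fun M => M.submatrix (tileEquiv f).symm (tileEquiv f).symm) h
    simpa using h'
  · intro h
    rw [h]

/-! ### Renormalisation through computational bases -/

theorem tensorOp_diagonal {ι α : Type} [Fintype ι] [DecidableEq ι] [DecidableEq α] (d : ι → α → ℂ) :
    tensorOp (fun i => Matrix.diagonal (d i))
      = Matrix.diagonal fun s : ι → α => ∏ i, d i (s i) := by
  ext s t
  by_cases h : s = t
  · subst h; simp [tensorOp]
  · obtain ⟨i, hi⟩ := Function.ne_iff.1 h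
    rw [Matrix.diagonal_apply_ne _ h]
    exact Finset.prod_eq_zero (Finset.mem_univ i) (Matrix.diagonal_apply_ne _ hi)

/-- Two steps are, up to a global phase, diagonal with the phase `ω` on every bond. -/
def IsBondDiagonal (φ : ℝ) (U : QMat) (ω : Fin 2 → Fin 2 → ℝ) : Prop :=
  ∀ (n : ℕ) [NeZero n], ∃ c : ℂ, star c * c = 1 ∧ ringStep φ U n * ringStep φ U n
    = c • Matrix.diagonal fun s => ∏ y, Complex.exp (Complex.I * (ω (s y) (s (y + 1)) : ℂ))

/-- The exponent of the gate `exp (-i θ σ_z)` on `|a⟩`. -/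
def zAngle (θ : ℝ) (a : Fin 2) : ℝ := -θ * (1 - 2 * (a : ℕ))

theorem zGate_eq_diagonal (θ : ℝ) :
    zGate θ = Matrix.diagonal fun a => Complex.exp (Complex.I * (zAngle θ a : ℂ)) := by
  rw [zGate_eq]
  congr 1
  funext a
  fin_cases a
  · simp [zAngle]
  · simp [zAngle]; norm_num

theorem phase_eq (φ : ℝ) (a b : Fin 2) :
    phase φ a b = Complex.exp (Complex.I * ((φ * (a : ℕ) * (b : ℕ) : ℝ) : ℂ)) := by
  rw [phase]; push_cast; ring_nf

theorem ringStep_diagonal (φ : ℝ) (θ : ℝ) (n : ℕ) [NeZero n] :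
    ringStep φ (zGate θ) n = Matrix.diagonal fun s => ∏ x, Complex.exp (Complex.I *
      ((zAngle θ (s x) + φ * (s x : ℕ) * (s (x + 1) : ℕ) : ℝ) : ℂ)) := by
  rw [ringStep, zGate_eq_diagonal, tensorOp_diagonal, Matrix.diagonal_mul_diagonal]
  congr 1
  funext s
  rw [ringPhase, ← Finset.prod_mul_distrib]
  refine Finset.prod_congr rfl fun x _ => ?_
  rw [phase_eq, ← Complex.exp_add]
  push_cast
  ring_nf

theorem isBondDiagonal_zGate (φ θ : ℝ) : IsBondDiagonal φ (zGate θ)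
    fun a b => 2 * (zAngle θ a + φ * (a : ℕ) * (b : ℕ)) := fun n _ => by
  refine ⟨1, by simp, ?_⟩
  rw [ringStep_diagonal, Matrix.diagonal_mul_diagonal, one_smul]
  congr 1
  funext s
  rw [← Finset.prod_mul_distrib]
  refine Finset.prod_congr rfl fun x _ => ?_
  rw [← Complex.exp_add]
  push_cast
  ring_nf

/-- An anti-diagonal gate in every cell connects a configuration only to its bitwise complement. -/
theorem tensorOp_mul_diagonal_of_antidiagonal {U : QMat} (h0 : U 0 0 = 0) (h1 : U 1 1 = 0)
    {ι : Type} [Fintype ι] [DecidableEq ι] (d : (ι → Fin 2) → ℂ) :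
    tensorOp (fun _ : ι => U) * Matrix.diagonal d
      = Matrix.diagonal (fun s => d fun x => 1 - s x) * tensorOp fun _ => U := by
  ext s t
  rw [Matrix.mul_diagonal, Matrix.diagonal_mul]
  by_cases h : tensorOp (fun _ : ι => U) s t = 0
  · simp [h]
  · have ht : t = fun x => 1 - s x := by
      funext x
      have hx : U (s x) (t x) ≠ 0 := Finset.prod_ne_zero_iff.1 h x (Finset.mem_univ x)
      generalize s x = a at *
      generalize t x = b at *
      fin_cases a <;> fin_cases b <;> simp_all
    rw [ht, mul_comm]

/-- Two steps read the bond phases once on a configuration and once on its complement, and U² is a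
scalar. This gives the exponent φ(ab + (1-a)(1-b)). -/
theorem isBondDiagonal_of_antidiagonal (φ : ℝ) {U : QMat} (hU : Uᴴ * U = 1) (h0 : U 0 0 = 0)
    (h1 : U 1 1 = 0) : IsBondDiagonal φ U
      fun a b => φ * ((a : ℕ) * (b : ℕ) + (1 - (a : ℕ)) * (1 - (b : ℕ))) := fun n _ => by
  have hUU : U * U = (U 0 1 * U 1 0) • (1 : QMat) := by
    ext i j
    fin_cases i <;> fin_cases j <;> simp [Matrix.mul_apply, Fin.sum_univ_two, h0, h1, mul_comm]
  have ha : star (U 0 1) * U 0 1 = 1 := by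
    simpa [Matrix.mul_apply, Fin.sum_univ_two, h0, h1] using congrFun₂ hU 1 1
  have hb : star (U 1 0) * U 1 0 = 1 := by
    simpa [Matrix.mul_apply, Fin.sum_univ_two, h0, h1] using congrFun₂ hU 0 0
  refine ⟨∏ _x : ZMod n, (U 0 1 * U 1 0), ?_, ?_⟩
  · rw [star_prod, ← Finset.prod_mul_distrib]
    refine Finset.prod_eq_one fun x _ => ?_
    rw [star_mul']
    linear_combination star (U 1 0) * U 1 0 * ha + hb
  · have hsq : tensorOp (fun _ : ZMod n => U) * tensorOp (fun _ => U)
        = (∏ _x : ZMod n, (U 0 1 * U 1 0)) • (1 : QOp (ZMod n)) := by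
      rw [tensorOp_mul, ← tensorOp_one]
      ext s t
      simp only [tensorOp, hUU, Matrix.smul_apply, smul_eq_mul, Finset.prod_mul_distrib]
    rw [ringStep, tensorOp_mul_diagonal_of_antidiagonal h0 h1, Matrix.mul_assoc,
      ← tensorOp_mul_diagonal_of_antidiagonal h0 h1, ← Matrix.mul_assoc _ _ (Matrix.diagonal _),
      hsq, Matrix.smul_mul, Matrix.one_mul, Matrix.mul_smul, Matrix.diagonal_mul_diagonal]
    congr 2
    funext s
    rw [ringPhase, ringPhase, ← Finset.prod_mul_distrib]
    refine Finset.prod_congr rfl fun x _ => ?_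
    rw [phase_eq, phase_eq, ← Complex.exp_add]
    congr 1
    generalize s x = a
    generalize s (x + 1) = b
    fin_cases a <;> fin_cases b <;> simp

/-- Bond-diagonal steps are renormalised through the computational basis vectors `code 0`,
`code 1` when the bond phases agree up to the global phase `κ` and the gauge `ρ`. -/
theorem isRenormalisation_of_code {φ : ℝ} {U : QMat} (hU : Uᴴ * U = 1)
    {ω : Fin 2 → Fin 2 → ℝ} (hω : IsBondDiagonal φ U ω) {φ' θ' : ℝ} {P} {ψ : TileFrame}
    (hψ : IsFrameOf ψ P) (code : Fin 2 → Fin 2 × Fin 2) (hcode : ∀ k, ψ k = Pi.single (code k) 1)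
    (κ ρ : ℝ) (h : ∀ a b : Fin 2,
      ω (code a).1 (code a).2 + ω (code a).2 (code b).1 + ρ * (b : ℕ)
        = κ + zAngle θ' a + φ' * (a : ℕ) * (b : ℕ) + ρ * (a : ℕ)) :
    IsRenormalisation (qubitQCA φ U) (qubitQCA φ' (zGate θ')) P ψ := by
  refine ⟨isQCA_qubitQCA φ hU, isQCA_qubitQCA φ' (zGate_conjTranspose_mul θ'), hψ,
    fun f _ hf => ?_⟩
  have hf3 := three_le_of_isRegularNbhd hf
  refine ⟨ringEvolution φ U hU (2 * f),
    ringEvolution φ' (zGate θ') (zGate_conjTranspose_mul θ') f,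
    isWrapped_ringEvolution φ U hU (by omega),
    isWrapped_ringEvolution φ' (zGate θ') (zGate_conjTranspose_mul θ') hf3, fun A => ?_⟩
  obtain ⟨c, hc, hG⟩ := hω (2 * f)
  set G := ringStep φ U (2 * f)
  set H := ringStep φ' (zGate θ') f with hH
  set J := coarseJ ψ f with hJ
  -- It suffices to intertwine the unitaries up to a scalar of modulus one, which cancels in the
  -- conjugation.
  have key : J * (G * G) = (c * ∏ _x : ZMod f, Complex.exp (Complex.I * (κ : ℂ))) • (H * J) := by
    rw [hG, hH, ringStep_diagonal, Matrix.mul_smul]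
    ext k s
    rw [Matrix.smul_apply, Matrix.smul_apply, Matrix.mul_diagonal, Matrix.diagonal_mul,
      smul_eq_mul, smul_eq_mul]
    by_cases hks : J k s = 0
    · simp [hks]
    have hs : ∀ x, tileEquiv f s x = code (k x) := by
      intro x
      have hx : star (ψ (k x) (tileEquiv f s x)) ≠ 0 :=
        Finset.prod_ne_zero_iff.1 hks x (Finset.mem_univ x)
      rw [hcode, Pi.single_apply] at hx
      by_contra hne
      simp [hne] at hx
    have hprod : ∏ y, Complex.exp (Complex.I * (ω (s y) (s (y + 1)) : ℂ))
        = (∏ _x : ZMod f, Complex.exp (Complex.I * (κ : ℂ))) * ∏ x, Complex.exp (Complex.I *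
          ((zAngle θ' (k x) + φ' * (k x : ℕ) * (k (x + 1) : ℕ) : ℝ) : ℂ)) := by
      rw [prod_bonds_eq_prod_tiles fun a b => Complex.exp (Complex.I * (ω a b : ℂ))]
      have hne : ∏ x, Complex.exp (Complex.I * ((ρ * (k x : ℕ) : ℝ) : ℂ)) ≠ 0 :=
        Finset.prod_ne_zero_iff.2 fun x _ => Complex.exp_ne_zero _
      -- The gauge terms of neighbouring tiles cancel because translation permutes the ring.
      have hshift : ∏ x, Complex.exp (Complex.I * ((ρ * (k (x + 1) : ℕ) : ℝ) : ℂ))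
          = ∏ x, Complex.exp (Complex.I * ((ρ * (k x : ℕ) : ℝ) : ℂ)) :=
        Equiv.prod_comp (Equiv.addRight (1 : ZMod f))
          fun x => Complex.exp (Complex.I * ((ρ * (k x : ℕ) : ℝ) : ℂ))
      refine mul_right_cancel₀ hne ?_
      conv_lhs => rw [← hshift]
      simp only [← Finset.prod_mul_distrib]
      refine Finset.prod_congr rfl fun x _ => ?_
      simp only [hs, ← Complex.exp_add, ← mul_add, ← Complex.ofReal_add]
      rw [h (k x) (k (x + 1))]
      congr 3
      ring
    rw [hprod]
    ring
  have hunit : star (c * ∏ _x : ZMod f, Complex.exp (Complex.I * (κ : ℂ)))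
      * (c * ∏ _x : ZMod f, Complex.exp (Complex.I * (κ : ℂ))) = 1 := by
    have : star (Complex.exp (Complex.I * (κ : ℂ))) * Complex.exp (Complex.I * (κ : ℂ)) = 1 := by
      rw [Complex.star_def, ← Complex.exp_conj, ← Complex.exp_add]
      simp
    rw [star_mul', mul_mul_mul_comm, hc, one_mul, star_prod, ← Finset.prod_mul_distrib]
    exact Finset.prod_eq_one fun x _ => this
  rw [ringEvolution_apply, ringEvolution_apply, ringEvolution_apply, coarseV, coarseV]
  calc Gᴴ * (Gᴴ * (Jᴴ * A * J) * G) * G = (J * (G * G))ᴴ * A * (J * (G * G)) := by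
        simp only [Matrix.conjTranspose_mul, Matrix.mul_assoc]
    _ = Jᴴ * (Hᴴ * A * H) * J := by
        rw [key, Matrix.conjTranspose_smul, Matrix.smul_mul, Matrix.smul_mul, Matrix.mul_smul,
          smul_smul, hunit, one_smul, Matrix.conjTranspose_mul]
        simp only [Matrix.mul_assoc]

theorem isFrameOf_of_code (code : Fin 2 → Fin 2 × Fin 2) (hcode : code 0 ≠ code 1) :
    IsFrameOf (fun k => Pi.single (code k) 1)
      (∑ k, Matrix.single (code k) (code k) (1 : ℂ)) := by
  constructor
  · intro k l
    fin_cases k <;> fin_cases l <;> simp [hcode, hcode.symm]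
  · refine Finset.sum_congr rfl fun k _ => ?_
    ext p q
    simp only [Matrix.vecMulVec_apply, Pi.star_apply, Pi.single_apply, Matrix.single_apply]
    by_cases h1 : p = code k <;> by_cases h2 : q = code k <;>
      simp [h1, h2, eq_comm (a := code k)]

theorem proj1_kronecker_proj1 (a b : Fin 2) :
    proj1 a ⊗ₖ proj1 b = Matrix.single (a, b) (a, b) 1 := by
  simp [proj1, Matrix.single_kronecker_single]

theorem proj1_zero_add_one : proj1 0 + proj1 1 = 1 := by
  ext i j
  fin_cases i <;> fin_cases j <;> simp [proj1]

theorem isFrameOf_ket (a b c d : Fin 2) (h : (a, b) ≠ (c, d)) :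
    IsFrameOf ![ket a b, ket c d] (proj1 a ⊗ₖ proj1 b + proj1 c ⊗ₖ proj1 d) := by
  have := isFrameOf_of_code ![(a, b), (c, d)] (by simpa using h)
  convert this using 1
  · funext k; fin_cases k <;> rfl
  · simp [proj1_kronecker_proj1, Fin.sum_univ_two]

/-- The four conditions are linear in κ, ρ, θ', φ' and have exactly one solution: the first two give
κ - θ' and ρ, the third κ + θ', the last φ'. The constants supplied for each flow are these
solutions. -/
theorem isRenormalisation_of_kets {φ : ℝ} {U : QMat} (hU : Uᴴ * U = 1)
    {ω : Fin 2 → Fin 2 → ℝ} (hω : IsBondDiagonal φ U ω) {φ' θ' : ℝ} {P} (a b c d : Fin 2)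
    (hne : (a, b) ≠ (c, d)) (hP : P = proj1 a ⊗ₖ proj1 b + proj1 c ⊗ₖ proj1 d) (κ ρ : ℝ)
    (h00 : ω a b + ω b a = κ - θ')
    (h01 : ω a b + ω b c + ρ = κ - θ')
    (h10 : ω c d + ω d a = κ + θ' + ρ)
    (h11 : ω c d + ω d c = κ + θ' + φ') :
    IsRenormalisation (qubitQCA φ U) (qubitQCA φ' (zGate θ')) P ![ket a b, ket c d] := by
  rw [hP]
  refine isRenormalisation_of_code hU hω (isFrameOf_ket a b c d hne) ![(a, b), (c, d)] ?_ κ ρ ?_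
  · intro k; fin_cases k <;> rfl
  · intro k l
    fin_cases k <;> fin_cases l <;> simp [zAngle] <;> linarith

theorem isRenormalisation_of_flowDiag {φ ϑ φ' θ' : ℝ} {P ψ} (h : FlowDiag φ ϑ P ψ φ' θ') :
    IsRenormalisation (qubitQCA φ (zGate ϑ)) (qubitQCA φ' (zGate θ')) P ψ := by
  have hU := zGate_conjTranspose_mul ϑ
  have hω := isBondDiagonal_zGate φ ϑ
  have hP1 : ∀ c : Fin 2, (1 : QMat) ⊗ₖ proj1 c = proj1 0 ⊗ₖ proj1 c + proj1 1 ⊗ₖ proj1 c := by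
    intro c; rw [← proj1_zero_add_one, Matrix.add_kronecker]
  have hP2 : ∀ c : Fin 2, proj1 c ⊗ₖ (1 : QMat) = proj1 c ⊗ₖ proj1 0 + proj1 c ⊗ₖ proj1 1 := by
    intro c; rw [← proj1_zero_add_one, Matrix.kronecker_add]
  cases h with
  | q1 =>
    exact isRenormalisation_of_kets hU hω 0 0 1 1 (by decide) rfl φ 0 (by simp [zAngle]; ring)
      (by simp [zAngle]; ring) (by simp [zAngle]; ring) (by simp [zAngle]; ring)
  | q1flip =>
    exact isRenormalisation_of_kets hU hω 1 1 0 0 (by decide) (add_comm _ _) φ (2 * φ)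
      (by simp [zAngle]; ring) (by simp [zAngle]; ring) (by simp [zAngle]; ring)
      (by simp [zAngle]; ring)
  | q2 =>
    exact isRenormalisation_of_kets hU hω 0 1 1 0 (by decide) rfl φ (-2 * φ)
      (by simp [zAngle]; ring) (by simp [zAngle]; ring) (by simp [zAngle]; ring)
      (by simp [zAngle]; ring)
  | q2flip =>
    exact isRenormalisation_of_kets hU hω 1 0 0 1 (by decide) (add_comm _ _) φ 0
      (by simp [zAngle]; ring) (by simp [zAngle]; ring) (by simp [zAngle]; ring)
      (by simp [zAngle]; ring)
  | right c =>
    exact isRenormalisation_of_kets hU hω 0 c 1 c (by simp) (hP1 c)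
      (2 * (c : ℕ) * φ - 2 * ϑ * (1 - 2 * (c : ℕ))) (-2 * (c : ℕ) * φ)
      (by simp [zAngle]; ring) (by simp [zAngle]; ring) (by simp [zAngle]; ring)
      (by simp [zAngle]; ring)
  | rightflip c =>
    exact isRenormalisation_of_kets hU hω 1 c 0 c (by simp)
      ((hP1 c).trans (add_comm _ _))
      (2 * (c : ℕ) * φ - 2 * ϑ * (1 - 2 * (c : ℕ))) (2 * (c : ℕ) * φ)
      (by simp [zAngle]; ring) (by simp [zAngle]; ring) (by simp [zAngle]; ring)
      (by simp [zAngle]; ring)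
  | left c =>
    exact isRenormalisation_of_kets hU hω c 0 c 1 (by simp) (hP2 c)
      (2 * (c : ℕ) * φ - 2 * ϑ * (1 - 2 * (c : ℕ))) 0
      (by simp [zAngle]; ring) (by simp [zAngle]; ring) (by simp [zAngle]; ring)
      (by simp [zAngle]; ring)
  | leftflip c =>
    exact isRenormalisation_of_kets hU hω c 1 c 0 (by simp)
      ((hP2 c).trans (add_comm _ _))
      (2 * (c : ℕ) * φ - 2 * ϑ * (1 - 2 * (c : ℕ))) 0
      (by simp [zAngle]; ring) (by simp [zAngle]; ring) (by simp [zAngle]; ring)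
      (by simp [zAngle]; ring)

theorem isRenormalisation_of_flowAnti {φ φ' θ' : ℝ} {U : QMat} (hU : Uᴴ * U = 1) (h0 : U 0 0 = 0)
    (h1 : U 1 1 = 0) {P ψ} (h : FlowAnti φ P ψ φ' θ') :
    IsRenormalisation (qubitQCA φ U) (qubitQCA φ' (zGate θ')) P ψ := by
  have hω := isBondDiagonal_of_antidiagonal φ hU h0 h1
  have hP1 : ∀ c : Fin 2, (1 : QMat) ⊗ₖ proj1 c = proj1 0 ⊗ₖ proj1 c + proj1 1 ⊗ₖ proj1 c := by
    intro c; rw [← proj1_zero_add_one, Matrix.add_kronecker]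
  have hP2 : ∀ c : Fin 2, proj1 c ⊗ₖ (1 : QMat) = proj1 c ⊗ₖ proj1 0 + proj1 c ⊗ₖ proj1 1 := by
    intro c; rw [← proj1_zero_add_one, Matrix.kronecker_add]
  cases h with
  | q1 =>
    exact isRenormalisation_of_kets hU hω 0 0 1 1 (by decide) rfl φ φ (by simp)
      (by simp) (by simp) (by simp; ring)
  | q1flip =>
    exact isRenormalisation_of_kets hU hω 1 1 0 0 (by decide) (add_comm _ _) φ φ
      (by simp) (by simp) (by simp) (by simp; ring)
  | q2 =>
    exact isRenormalisation_of_kets hU hω 0 1 1 0 (by decide) rfl φ (-φ)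
      (by simp) (by simp) (by simp) (by simp; ring)
  | q2flip =>
    exact isRenormalisation_of_kets hU hω 1 0 0 1 (by decide) (add_comm _ _) φ (-φ)
      (by simp) (by simp) (by simp) (by simp; ring)
  | right c =>
    exact isRenormalisation_of_kets hU hω 0 c 1 c (by simp) (hP1 c)
      φ ((1 - 2 * (c : ℕ)) * φ)
      (by simp; ring) (by simp; ring) (by simp; ring) (by simp; ring)
  | rightflip c =>
    exact isRenormalisation_of_kets hU hω 1 c 0 c (by simp)
      ((hP1 c).trans (add_comm _ _)) φ ((2 * (c : ℕ) - 1) * φ)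
      (by simp; ring) (by simp; ring) (by simp; ring) (by simp; ring)
  | left c =>
    exact isRenormalisation_of_kets hU hω c 0 c 1 (by simp) (hP2 c) φ 0
      (by simp; ring) (by simp; ring) (by simp; ring) (by simp; ring)
  | leftflip c =>
    exact isRenormalisation_of_kets hU hω c 1 c 0 (by simp)
      ((hP2 c).trans (add_comm _ _)) φ 0
      (by simp; ring) (by simp; ring) (by simp; ring) (by simp; ring)

/-! ### Renormalisations determine the coarse-grained rule -/

section Embed

variable {K L : Type} [Fintype K] [Fintype L] [DecidableEq L] {e : K → L}

theorem embedOp_injective (he : Function.Injective e) :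
    Function.Injective (embedOp e : QOp K → QOp L) := by
  intro B B' h
  ext s t
  have := congrFun₂ h (Function.extend e s fun _ => 0) (Function.extend e t fun _ => 0)
  have hc : ∀ u : K → Fin 2, (Function.extend e u fun _ => 0) ∘ e = u :=
    fun u => funext fun i => he.extend_apply _ _ _
  simp only [embedOp, hc] at this
  rw [if_pos, if_pos] at this
  · exact this
  all_goals
    intro y hy
    have hy' : ¬∃ i, e i = y := hy
    rw [Function.extend_apply' _ _ _ hy', Function.extend_apply' _ _ _ hy']

/-- `embedOp e` as a linear map. -/
def embedLin (e : K → L) : QOp K →ₗ[ℂ] QOp L where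
  toFun := embedOp e
  map_add' A B := by
    ext s t
    simp only [embedOp, Matrix.add_apply]
    split_ifs <;> simp
  map_smul' c A := by
    ext s t
    simp only [embedOp, Matrix.smul_apply, RingHom.id_apply]
    split_ifs <;> simp

theorem embedOp_tensorOp (he : Function.Injective e) (M : K → QMat) :
    embedOp e (tensorOp M) = tensorOp (Function.extend e M fun _ => 1) := by
  have hext : ∀ i, Function.extend e M (fun _ => 1) (e i) = M i := fun i => he.extend_apply _ _ _
  ext s t
  simp only [embedOp]
  split_ifs with h
  · simp only [tensorOp]
    refine Finset.prod_of_injOn e he.injOn (by simp) ?_ ?_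
    · intro y _ hy
      have hy' : ¬∃ i, e i = y := by simpa using hy
      rw [Function.extend_apply' _ _ _ hy', h y hy', Matrix.one_apply_eq]
    · intro i _
      rw [hext]
      rfl
  · push Not at h
    obtain ⟨y, hy, hne⟩ := h
    have hy' : ¬∃ i, e i = y := hy
    rw [tensorOp, Finset.prod_eq_zero (Finset.mem_univ y)]
    rw [Function.extend_apply' _ _ _ hy', Matrix.one_apply_ne hne]

/-- By linearity it is enough to take B a matrix unit, hence a product operator; on the cells
outside the range of `e` the factor is W W† = 1. -/
theorem tensorOp_conj_embedOp [DecidableEq K] (he : Function.Injective e) {W : QMat}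
    (hW : W * Wᴴ = 1)
    (B : QOp K) :
    tensorOp (fun _ => W) * embedOp e B * (tensorOp fun _ => W)ᴴ
      = embedOp e (tensorOp (fun _ => W) * B * (tensorOp fun _ => W)ᴴ) := by
  let f : QOp K →ₗ[ℂ] QOp L := LinearMap.mulLeft ℂ (tensorOp fun _ => W) ∘ₗ
    LinearMap.mulRight ℂ (tensorOp fun _ => W)ᴴ ∘ₗ embedLin e
  let g : QOp K →ₗ[ℂ] QOp L := embedLin e ∘ₗ LinearMap.mulLeft ℂ (tensorOp fun _ => W) ∘ₗ
    LinearMap.mulRight ℂ (tensorOp fun _ => W)ᴴ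
  have hfg : f B = g B := by
    rw [Matrix.matrix_eq_sum_single B]
    simp only [map_sum]
    refine Finset.sum_congr rfl fun s _ => Finset.sum_congr rfl fun t _ => ?_
    have e1 : Matrix.single s t (B s t) = B s t • (Matrix.single s t 1 : QOp K) := by simp
    rw [e1, map_smul, map_smul, single_eq_tensorOp]
    congr 1
    change tensorOp (fun _ => W) * (embedOp e _ * _) = embedOp e (tensorOp (fun _ => W) * (_ * _))
    rw [embedOp_tensorOp he, tensorOp_conjTranspose, tensorOp_conjTranspose, tensorOp_mul,
      tensorOp_mul, tensorOp_mul, tensorOp_mul, embedOp_tensorOp he]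
    congr 1
    funext y
    by_cases hy : ∃ i, e i = y
    · obtain ⟨i, rfl⟩ := hy
      rw [he.extend_apply, he.extend_apply]
    · rw [Function.extend_apply' _ _ _ hy, Function.extend_apply' _ _ _ hy, Matrix.one_mul, hW]
  calc _ = f B := Matrix.mul_assoc _ _ _
    _ = g B := hfg
    _ = _ := congrArg (embedOp e) (Matrix.mul_assoc _ _ _).symm

end Embed

/-- All necessary conditions are extracted from this one ring: a tile, its two neighbours, and two
spectator tiles. -/
theorem IsRenormalisation.tile_eq {φ : ℝ} {U : QMat} (hU : Uᴴ * U = 1) {S : CellRule} {P}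
    {ψ : TileFrame} (h : IsRenormalisation (qubitQCA φ U) S P ψ) :
    ∃ Sw : QOp (ZMod 5) ≃⋆ₐ[ℂ] QOp (ZMod 5), IsWrapped S 5 Sw ∧ ∀ A,
      (tileStep φ U 5)ᴴ * ((tileStep φ U 5)ᴴ * ((tileJ ψ 5)ᴴ * A * tileJ ψ 5) * tileStep φ U 5)
        * tileStep φ U 5 = (tileJ ψ 5)ᴴ * Sw A * tileJ ψ 5 := by
  obtain ⟨-, -, -, h⟩ := h
  obtain ⟨Tw, Sw, hT, hS, h⟩ := h 5 isRegularNbhd_ten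
  refine ⟨Sw, hS, fun A => (conj_coarseV_eq_iff φ U ψ 5 A (Sw A)).1 ?_⟩
  rw [← h A, hT.eq_conj hU (by norm_num), hT.eq_conj hU (by norm_num)]

theorem eq_of_tileJ_conj_eq {ψ : TileFrame} {P} (hψ : IsFrameOf ψ P) {f : ℕ} [NeZero f]
    {A B : QOp (ZMod f)} (h : (tileJ ψ f)ᴴ * A * tileJ ψ f = (tileJ ψ f)ᴴ * B * tileJ ψ f) :
    A = B := by
  have key : ∀ A : QOp (ZMod f),
      tileJ ψ f * ((tileJ ψ f)ᴴ * A * tileJ ψ f) * (tileJ ψ f)ᴴ = A := by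
    intro A
    calc _ = (tileJ ψ f * (tileJ ψ f)ᴴ) * A * (tileJ ψ f * (tileJ ψ f)ᴴ) := by
          simp only [Matrix.mul_assoc]
      _ = A := by rw [tileJ_mul_conjTranspose hψ, Matrix.one_mul, Matrix.mul_one]
  rw [← key A, h, key B]

/-- Two renormalisations through the same projection differ by a change of basis in the
coarse-grained cells. -/
theorem IsRenormalisation.isLocallyEquivalent {φ : ℝ} {U : QMat} (hU : Uᴴ * U = 1)
    {S : CellRule} {P} {ψ ψ₀ : TileFrame} {φ' θ' : ℝ}
    (h : IsRenormalisation (qubitQCA φ U) S P ψ)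
    (h₀ : IsRenormalisation (qubitQCA φ U) (qubitQCA φ' (zGate θ')) P ψ₀) :
    IsLocallyEquivalent ψ S ψ₀ φ' θ' := by
  have hψ := h.2.2.1
  have hψ₀ := h₀.2.2.1
  obtain ⟨Sw, hS, hSw⟩ := h.tile_eq hU
  obtain ⟨Sw₀, hS₀, hSw₀⟩ := h₀.tile_eq hU
  set j := frameMat ψ with hj
  set j₀ := frameMat ψ₀ with hj₀
  -- Both frames span the range of P, so j†j = j₀†j₀ = P. Hence W is unitary and j = W j₀.
  set W : QMat := j * j₀ᴴ with hW
  have h1 : j * jᴴ = 1 := frameMat_mul_conjTranspose hψ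
  have h10 : j₀ * j₀ᴴ = 1 := frameMat_mul_conjTranspose hψ₀
  have h2 : jᴴ * j = j₀ᴴ * j₀ :=
    (frameMat_conjTranspose_mul hψ).trans (frameMat_conjTranspose_mul hψ₀).symm
  have hWj : j = W * j₀ := by
    rw [hW, Matrix.mul_assoc, ← h2, ← Matrix.mul_assoc, h1, Matrix.one_mul]
  have hWW : W * Wᴴ = 1 := by
    rw [hW, Matrix.conjTranspose_mul, Matrix.conjTranspose_conjTranspose, Matrix.mul_assoc,
      ← Matrix.mul_assoc j₀ᴴ, ← h2, Matrix.mul_assoc, h1, Matrix.mul_one, h1]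
  have hWW' : Wᴴ * W = 1 := mul_eq_one_comm.1 hWW
  refine ⟨W, Matrix.mem_unitaryGroup_iff.2 hWW, fun k => ?_, ?_⟩
  · funext p
    have := congrArg star (congrFun₂ hWj k p)
    simpa [hj, hj₀, frameMat, Matrix.mul_apply] using this
  · let Wt : QOp (ZMod 5) := tensorOp fun _ => W
    have hWt : Wt = tensorOp fun _ => W := rfl
    have hJ : tileJ ψ 5 = Wt * tileJ ψ₀ 5 := by
      rw [hWt, tileJ, tileJ, tensorOp_mul, ← hj, ← hj₀, ← hWj]
    have hWt1 : Wtᴴ * Wt = 1 := by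
      rw [hWt, tensorOp_conjTranspose, tensorOp_mul]
      simp only [hWW', tensorOp_one]
    have hSeq : ∀ A, Sw A = Wt * Sw₀ (Wtᴴ * A * Wt) * Wtᴴ := by
      intro A
      apply eq_of_tileJ_conj_eq hψ
      rw [← hSw]
      have e1 : (tileJ ψ 5)ᴴ * A * tileJ ψ 5 = (tileJ ψ₀ 5)ᴴ * (Wtᴴ * A * Wt) * tileJ ψ₀ 5 := by
        rw [hJ, Matrix.conjTranspose_mul]
        simp only [Matrix.mul_assoc]
      have e2 : tileJ ψ₀ 5 = Wtᴴ * tileJ ψ 5 := by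
        rw [hJ, ← Matrix.mul_assoc, hWt1, Matrix.one_mul]
      rw [e1, hSw₀]
      conv_lhs => rw [e2, Matrix.conjTranspose_mul, Matrix.conjTranspose_conjTranspose]
      simp only [Matrix.mul_assoc]
    funext A
    have hinj : Function.Injective ![(1 : ZMod 5) - 1, 1, 1 + 1] :=
      ZMod.neighbours_injective (by norm_num) 1
    apply embedOp_injective hinj
    rw [← hS 1 A, hSeq, show Wtᴴ * onSite (1 : ZMod 5) A * Wt = onSite 1 (Wᴴ * A * W) from ?_, hS₀]
    · exact tensorOp_conj_embedOp hinj hWW _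
    · rw [hWt, tensorOp_conjTranspose, tensorOp_mul_onSite, tensorOp_mul, onSite_eq_tensorOp]
      congr 1
      funext y
      by_cases hy : y = 1
      · subst hy; simp
      · simp [hy, hWW']

/-! ### The action on one tile -/

/-- The operator `Q` acting on the tile `x`. -/
def onTile {f : ℕ} [NeZero f] (x : ZMod f) (Q : Matrix (Fin 2 × Fin 2) (Fin 2 × Fin 2) ℂ) :
    Matrix (ZMod f → Fin 2 × Fin 2) (ZMod f → Fin 2 × Fin 2) ℂ :=
  tensorOp (Function.update (fun _ => 1) x Q)

theorem conjTranspose_tileJ_mul_onSite {ψ : TileFrame} {P} (hψ : IsFrameOf ψ P) {f : ℕ} [NeZero f]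
    (x : ZMod f) (A : QMat) :
    (tileJ ψ f)ᴴ * onSite x A
      = onTile x ((frameMat ψ)ᴴ * A * frameMat ψ) * (tileJ ψ f)ᴴ := by
  rw [tileJ, tensorOp_conjTranspose, onSite_eq_tensorOp, onTile, tensorOp_mul, tensorOp_mul]
  congr 1
  funext y
  by_cases hy : y = x
  · subst hy
    simp [Matrix.mul_assoc, frameMat_mul_conjTranspose hψ]
  · simp [hy]

/-- Multiplying the renormalisation identity by G² on the left and J† on the right turns it into an
intertwining relation. Its case A = 1 says that the range of G²J† stays in the range of J†J, which
removes the projections on the other tiles. -/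
theorem onTile_mul_step_sq {φ : ℝ} {U : QMat} (hU : Uᴴ * U = 1) {P} {ψ : TileFrame}
    (hψ : IsFrameOf ψ P) {Sw : QOp (ZMod 5) ≃⋆ₐ[ℂ] QOp (ZMod 5)}
    (hSw : ∀ A, (tileStep φ U 5)ᴴ * ((tileStep φ U 5)ᴴ * ((tileJ ψ 5)ᴴ * A * tileJ ψ 5)
      * tileStep φ U 5) * tileStep φ U 5 = (tileJ ψ 5)ᴴ * Sw A * tileJ ψ 5)
    (x : ZMod 5) (A : QMat) :
    onTile x ((frameMat ψ)ᴴ * A * frameMat ψ) * (tileStep φ U 5 * tileStep φ U 5 * (tileJ ψ 5)ᴴ)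
      = tileStep φ U 5 * tileStep φ U 5 * (tileJ ψ 5)ᴴ * Sw (onSite x A) := by
  have hG : tileStep φ U 5 * (tileStep φ U 5)ᴴ = 1 :=
    mul_eq_one_comm.1 (tileStep_conjTranspose_mul φ hU 5)
  have hJ := tileJ_mul_conjTranspose hψ 5
  set G := tileStep φ U 5
  set J := tileJ ψ 5
  have key : ∀ A, Jᴴ * A * J * (G * G * Jᴴ) = G * G * Jᴴ * Sw A := by
    intro A
    calc Jᴴ * A * J * (G * G * Jᴴ)
        = G * ((G * Gᴴ) * Gᴴ * (Jᴴ * A * J) * G) * G * Jᴴ := by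
          rw [hG, Matrix.one_mul]
          simp only [← Matrix.mul_assoc]
          rw [hG, Matrix.one_mul]
      _ = G * (G * (Gᴴ * (Gᴴ * (Jᴴ * A * J) * G) * G)) * Jᴴ := by
          simp only [Matrix.mul_assoc]
      _ = G * G * Jᴴ * Sw A * (J * Jᴴ) := by
          rw [hSw]
          simp only [Matrix.mul_assoc]
      _ = _ := by rw [hJ, Matrix.mul_one]
  have h1 := key 1
  rw [map_one, Matrix.mul_one, Matrix.mul_one] at h1
  calc _ = onTile x ((frameMat ψ)ᴴ * A * frameMat ψ) * (Jᴴ * J * (G * G * Jᴴ)) := by rw [h1]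
    _ = (onTile x ((frameMat ψ)ᴴ * A * frameMat ψ) * Jᴴ) * J * (G * G * Jᴴ) := by
        simp only [Matrix.mul_assoc]
    _ = _ := by rw [← conjTranspose_tileJ_mul_onSite hψ, key]

/-! ### Invariance of one tile under the two-step light cone -/

/-- Two steps on one tile, seen from the tile when the adjacent cells end in the states `j`, `l`;
`α`, `β` are the weights that the neighbouring tiles give to the states of the two cells. -/
def tileCone (φ : ℝ) (U : QMat) (j l : Fin 2) (α β : Fin 2 → ℂ) :
    Matrix (Fin 2 × Fin 2) (Fin 2 × Fin 2) ℂ :=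
  (U ⊗ₖ U) * (Matrix.diagonal (fun p => phase φ j p.1 * phase φ p.1 p.2 * phase φ p.2 l)
    * ((U ⊗ₖ U) * Matrix.diagonal fun p => α p.1 * phase φ p.1 p.2 * β p.2))

/-- The weights that a neighbouring tile gives to the states `x` of the adjacent cell, its inner
cell starting with the amplitudes `lam` and ending in the state `j`. -/
def leftWeight (φ : ℝ) (U : QMat) (j : Fin 2) (lam : Fin 2 → ℂ) (x : Fin 2) : ℂ :=
  ∑ i, U j i * lam i * phase φ i x

/-- The restriction of `C_φ χ` to the right cell, the left one being `q`. -/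
def rightSlice (φ : ℝ) (χ : Fin 2 × Fin 2 → ℂ) (q i : Fin 2) : ℂ := phase φ q i * χ (q, i)

/-- The restriction of `C_φ χ` to the left cell, the right one being `q`. -/
def leftSlice (φ : ℝ) (χ : Fin 2 × Fin 2 → ℂ) (q i : Fin 2) : ℂ := phase φ i q * χ (i, q)

/-- The vectors obtained from `η` in two steps, with neighbouring tiles in the range spanned by
`ψ`, are fixed by `Q`. -/
def IsConeInvariant (φ : ℝ) (U : QMat) (ψ : TileFrame)
    (Q : Matrix (Fin 2 × Fin 2) (Fin 2 × Fin 2) ℂ) (η : Fin 2 × Fin 2 → ℂ) : Prop :=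
  ∀ a c q r j l : Fin 2,
    Q *ᵥ (tileCone φ U j l (leftWeight φ U j (rightSlice φ (ψ a) q))
        (leftWeight φ U l (leftSlice φ (ψ c) r)) *ᵥ η)
      = tileCone φ U j l (leftWeight φ U j (rightSlice φ (ψ a) q))
        (leftWeight φ U l (leftSlice φ (ψ c) r)) *ᵥ η

theorem norm_phase (φ : ℝ) (a b : Fin 2) : ‖phase φ a b‖ = 1 := by
  rw [phase_eq, mul_comm, Complex.norm_exp_ofReal_mul_I]

theorem star_mul_self_of_norm_eq_one {z : ℂ} (h : ‖z‖ = 1) : star z * z = 1 := by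
  rw [Complex.star_def, Complex.conj_mul', h]
  simp

theorem conjTranspose_mul_self_mul {α : Type} [Fintype α] [DecidableEq α] {A B : Matrix α α ℂ}
    (hA : Aᴴ * A = 1) (hB : Bᴴ * B = 1) : (A * B)ᴴ * (A * B) = 1 := by
  rw [Matrix.conjTranspose_mul, Matrix.mul_assoc, ← Matrix.mul_assoc Aᴴ, hA, Matrix.one_mul, hB]

/-! ### Removing from two steps all that lies outside the light cone of one tile. -/

section Peel

variable {ι α : Type} [Fintype ι] [DecidableEq ι] [Fintype α]

theorem diagonal_commute_tensorOp [DecidableEq α] {d : (ι → α) → ℂ} {M : ι → Matrix α α ℂ}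
    (h : ∀ s t : ι → α, (∀ i, M i (s i) (t i) ≠ 0) → d s = d t) :
    Commute (Matrix.diagonal d) (tensorOp M) := by
  rw [commute_iff_eq]
  ext s t
  rw [Matrix.diagonal_mul, Matrix.mul_diagonal]
  by_cases hs : tensorOp M s t = 0
  · simp [hs]
  · rw [h s t fun i => Finset.prod_ne_zero_iff.1 hs i (Finset.mem_univ i), mul_comm]

theorem tensorOp_commute {M N : ι → Matrix α α ℂ} (h : ∀ i, Commute (M i) (N i)) :
    Commute (tensorOp M) (tensorOp N) := by
  rw [commute_iff_eq, tensorOp_mul, tensorOp_mul]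
  congr 1
  funext i
  exact h i

theorem tensorOp_conjTranspose_mul_self [DecidableEq α] {M : ι → Matrix α α ℂ}
    (h : ∀ i, (M i)ᴴ * M i = 1) :
    (tensorOp M)ᴴ * tensorOp M = 1 := by
  rw [tensorOp_conjTranspose, tensorOp_mul]
  simp only [h, tensorOp_one]

end Peel

theorem kronecker_conjTranspose_mul_self {A B : QMat} (hA : Aᴴ * A = 1) (hB : Bᴴ * B = 1) :
    (A ⊗ₖ B)ᴴ * (A ⊗ₖ B) = 1 := by
  rw [Matrix.conjTranspose_kronecker, ← Matrix.mul_kronecker_mul, hA, hB, Matrix.one_kronecker_one]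

theorem ne_zero_of_one_kronecker {U : QMat} {p q : Fin 2 × Fin 2}
    (h : ((1 : QMat) ⊗ₖ U) p q ≠ 0) : p.1 = q.1 := by
  by_contra hne
  exact h (by rw [Matrix.kroneckerMap_apply, Matrix.one_apply_ne hne, zero_mul])

theorem ne_zero_of_kronecker_one {U : QMat} {p q : Fin 2 × Fin 2}
    (h : (U ⊗ₖ (1 : QMat)) p q ≠ 0) : p.2 = q.2 := by
  by_contra hne
  exact h (by rw [Matrix.kroneckerMap_apply, Matrix.one_apply_ne hne, mul_zero])

theorem eq_of_one_ne_zero {p q : Fin 2 × Fin 2}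
    (h : (1 : Matrix (Fin 2 × Fin 2) (Fin 2 × Fin 2) ℂ) p q ≠ 0) : p = q := by
  by_contra hne
  exact h (Matrix.one_apply_ne hne)

theorem sum_one_kronecker_mul (U : QMat) (q j : Fin 2) (F : Fin 2 × Fin 2 → ℂ) :
    ∑ a, ((1 : QMat) ⊗ₖ U) (q, j) a * F a = ∑ i, U j i * F (q, i) := by
  rw [Fintype.sum_prod_type, Finset.sum_eq_single q]
  · simp [Matrix.kroneckerMap_apply]
  · intro x _ hx
    simp [Matrix.kroneckerMap_apply, Matrix.one_apply_ne hx.symm]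
  · simp

theorem sum_kronecker_one_mul (U : QMat) (j q : Fin 2) (F : Fin 2 × Fin 2 → ℂ) :
    ∑ a, (U ⊗ₖ (1 : QMat)) (j, q) a * F a = ∑ i, U j i * F (i, q) := by
  rw [Fintype.sum_prod_type_right, Finset.sum_eq_single q]
  · simp [Matrix.kroneckerMap_apply]
  · intro x _ hx
    simp [Matrix.kroneckerMap_apply, Matrix.one_apply_ne hx.symm]
  · simp

/-- The phase of the bonds that meet the tile `1`. -/
def innerPhase (φ : ℝ) (s : ZMod 5 → Fin 2 × Fin 2) : ℂ :=
  phase φ (s 0).2 (s 1).1 * phase φ (s 1).1 (s 1).2 * phase φ (s 1).2 (s 2).1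

/-- The phase of the bonds inside the tiles `0`, `1`, `2`. -/
def middlePhase (φ : ℝ) (s : ZMod 5 → Fin 2 × Fin 2) : ℂ :=
  phase φ (s 0).1 (s 0).2 * innerPhase φ s * phase φ (s 2).1 (s 2).2

/-- The phase of the remaining bonds. -/
def outerPhase (φ : ℝ) (s : ZMod 5 → Fin 2 × Fin 2) : ℂ :=
  phase φ (s 2).2 (s 3).1 * phase φ (s 3).1 (s 3).2 * phase φ (s 3).2 (s 4).1
    * phase φ (s 4).1 (s 4).2 * phase φ (s 4).2 (s 0).1

theorem tilePhase_five (φ : ℝ) (s : ZMod 5 → Fin 2 × Fin 2) :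
    tilePhase φ 5 s = outerPhase φ s * middlePhase φ s := by
  let F : ZMod 5 → ℂ := fun x => phase φ (s x).1 (s x).2 * phase φ (s x).2 (s (x + 1)).1
  have h : tilePhase φ 5 s = F 0 * F 1 * F 2 * F 3 * F 4 := Fin.prod_univ_five F
  have h0 : (0 : ZMod 5) + 1 = 1 := by decide
  have h1 : (1 : ZMod 5) + 1 = 2 := by decide
  have h2 : (2 : ZMod 5) + 1 = 3 := by decide
  have h3 : (3 : ZMod 5) + 1 = 4 := by decide
  have h4 : (4 : ZMod 5) + 1 = 0 := by decide
  rw [h, outerPhase, middlePhase, innerPhase]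
  simp only [F, h0, h1, h2, h3, h4]
  ring

/-- The local gates on the cells of the tiles `0`, `1`, `2` that are next to or in the tile `1`. -/
def coneGates (U : QMat) :
    Matrix (ZMod 5 → Fin 2 × Fin 2) (ZMod 5 → Fin 2 × Fin 2) ℂ :=
  onTile 0 (1 ⊗ₖ U) * (onTile 1 (U ⊗ₖ U) * onTile 2 (U ⊗ₖ 1))

theorem coneGates_eq (U : QMat) : coneGates U = tensorOp (Function.update (Function.update
    (Function.update (fun _ => 1) 0 (1 ⊗ₖ U)) 1 (U ⊗ₖ U)) 2 (U ⊗ₖ 1)) := by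
  rw [coneGates, onTile, onTile, onTile, tensorOp_mul, tensorOp_mul]
  congr 1
  funext y
  by_cases h0 : y = 0
  · subst h0; simp [show (0 : ZMod 5) ≠ 1 by decide, show (0 : ZMod 5) ≠ 2 by decide]
  by_cases h1 : y = 1
  · subst h1; simp [h0, show (1 : ZMod 5) ≠ 2 by decide]
  by_cases h2 : y = 2
  · subst h2; simp [h0, show (2 : ZMod 5) ≠ 1 by decide]
  simp [h0, h1, h2]

/-- The part of two steps that acts on the tile `1`. -/
def coneStep (φ : ℝ) (U : QMat) :
    Matrix (ZMod 5 → Fin 2 × Fin 2) (ZMod 5 → Fin 2 × Fin 2) ℂ :=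
  onTile 1 (U ⊗ₖ U) * (Matrix.diagonal (innerPhase φ)
    * (coneGates U * Matrix.diagonal (middlePhase φ)))

/-- Gates and phases outside the two-step light cone of tile 1 can be moved to the left, since they
share no cell with the factors they cross or are diagonal together with them. The collected factor K
does not act on tile 1. -/
theorem tileStep_sq_eq (φ : ℝ) {U : QMat} (hU : Uᴴ * U = 1) :
    ∃ K, Kᴴ * K = 1 ∧ (∀ Q, Commute K (onTile 1 Q)) ∧
      tileStep φ U 5 * tileStep φ U 5 = K * coneStep φ U := by
  let UU := U ⊗ₖ U
  have hUU : UUᴴ * UU = 1 := kronecker_conjTranspose_mul_self hU hU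
  -- `r₁` and `e₁` are the discarded parts of the left factor G of G²; `r₂` and `outerPhase` are
  -- those of the right factor.
  let r₁ : ZMod 5 → Matrix (Fin 2 × Fin 2) (Fin 2 × Fin 2) ℂ := Function.update (fun _ => UU) 1 1
  let r₂ : ZMod 5 → Matrix (Fin 2 × Fin 2) (Fin 2 × Fin 2) ℂ := Function.update (Function.update
    (Function.update (fun _ => UU) 0 (U ⊗ₖ 1)) 1 1) 2 (1 ⊗ₖ U)
  let e₁ : (ZMod 5 → Fin 2 × Fin 2) → ℂ := fun s =>
    outerPhase φ s * (phase φ (s 0).1 (s 0).2 * phase φ (s 2).1 (s 2).2)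
  have h01 : (0 : ZMod 5) ≠ 1 := by decide
  have h02 : (0 : ZMod 5) ≠ 2 := by decide
  have h12 : (1 : ZMod 5) ≠ 2 := by decide
  have h31 : (3 : ZMod 5) ≠ 1 := by decide
  have h41 : (4 : ZMod 5) ≠ 1 := by decide
  have r₂0 : r₂ 0 = U ⊗ₖ 1 := by simp [r₂, h01, h02]
  have r₂1 : r₂ 1 = 1 := by simp [r₂, h12]
  have r₂2 : r₂ 2 = 1 ⊗ₖ U := by simp [r₂]
  have hgate₁ : tensorOp (fun _ : ZMod 5 => UU) = tensorOp r₁ * onTile 1 UU := by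
    rw [onTile, tensorOp_mul]
    congr 1
    funext y
    by_cases h1 : y = 1
    · subst h1; simp [r₁]
    · simp [r₁, h1]
  have hgate₂ : tensorOp (fun _ : ZMod 5 => UU) = tensorOp r₂ * coneGates U := by
    rw [coneGates_eq, tensorOp_mul]
    congr 1
    funext y
    by_cases h0 : y = 0
    · subst h0
      rw [r₂0]
      simp [h01, h02, ← Matrix.mul_kronecker_mul, UU]
    by_cases h1 : y = 1
    · subst h1
      rw [r₂1]
      simp [h12, UU]
    by_cases h2 : y = 2
    · subst h2
      rw [r₂2]
      simp [← Matrix.mul_kronecker_mul, UU]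
    simp [r₂, h0, h1, h2]
  have hX₁ : Matrix.diagonal (tilePhase φ 5)
      = Matrix.diagonal e₁ * Matrix.diagonal (innerPhase φ) := by
    rw [Matrix.diagonal_mul_diagonal]
    congr 1
    funext s
    rw [tilePhase_five, middlePhase]
    ring
  have hX₂ : Matrix.diagonal (tilePhase φ 5)
      = Matrix.diagonal (outerPhase φ) * Matrix.diagonal (middlePhase φ) := by
    rw [Matrix.diagonal_mul_diagonal]
    congr 1
    funext s
    rw [tilePhase_five]
  have hoff : ∀ (Q : Matrix (Fin 2 × Fin 2) (Fin 2 × Fin 2) ℂ) (s t : ZMod 5 → Fin 2 × Fin 2),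
      (∀ i, Function.update (fun _ => (1 : Matrix (Fin 2 × Fin 2) (Fin 2 × Fin 2) ℂ)) 1 Q i
        (s i) (t i) ≠ 0) → ∀ y, y ≠ 1 → s y = t y := by
    intro Q s t h y hy
    have := h y
    rw [Function.update_of_ne hy] at this
    exact eq_of_one_ne_zero this
  have cR₁ : ∀ Q, Commute (tensorOp r₁) (onTile 1 Q) := fun Q => tensorOp_commute fun y => by
    by_cases h1 : y = 1
    · subst h1; simp [r₁]
    · simp [h1]
  have cE₁ : ∀ Q, Commute (Matrix.diagonal e₁) (onTile 1 Q) := fun Q =>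
    diagonal_commute_tensorOp fun s t h => by
      have h' := hoff Q s t h
      simp only [e₁, outerPhase, h' 0 h01, h' 2 h12.symm, h' 3 h31, h' 4 h41]
  have cR₂ : ∀ Q, Commute (tensorOp r₂) (onTile 1 Q) := fun Q => tensorOp_commute fun y => by
    by_cases h1 : y = 1
    · subst h1; rw [r₂1]; simp
    · simp [h1]
  have cE₂ : ∀ Q, Commute (Matrix.diagonal (outerPhase φ)) (onTile 1 Q) := fun Q =>
    diagonal_commute_tensorOp fun s t h => by
      have h' := hoff Q s t h
      simp only [outerPhase, h' 0 h01, h' 2 h12.symm, h' 3 h31, h' 4 h41]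
  have cR₂X : Commute (tensorOp r₂) (Matrix.diagonal (innerPhase φ)) :=
    (diagonal_commute_tensorOp fun s t h => by
      have h0 := h 0
      have h1 := h 1
      have h2 := h 2
      rw [r₂0] at h0
      rw [r₂1] at h1
      rw [r₂2] at h2
      simp only [innerPhase, ne_zero_of_kronecker_one h0, eq_of_one_ne_zero h1,
        ne_zero_of_one_kronecker h2]).symm
  have cE₂C : Commute (Matrix.diagonal (outerPhase φ)) (coneGates U) := by
    rw [coneGates_eq]
    refine diagonal_commute_tensorOp fun s t h => ?_
    have h0 := h 0
    have h2 := h 2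
    have h3 := h 3
    have h4 := h 4
    simp only [h01, h02, show (3 : ZMod 5) ≠ 0 by decide, show (4 : ZMod 5) ≠ 0 by decide,
      h31, h41, show (3 : ZMod 5) ≠ 2 by decide, show (4 : ZMod 5) ≠ 2 by decide, ne_eq,
      not_false_eq_true, Function.update_of_ne, Function.update_self] at h0 h2 h3 h4
    simp only [outerPhase, ne_zero_of_one_kronecker h0, ne_zero_of_kronecker_one h2,
      eq_of_one_ne_zero h3, eq_of_one_ne_zero h4]
  have cE₂X : Commute (Matrix.diagonal (outerPhase φ)) (Matrix.diagonal (innerPhase φ)) := by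
    rw [commute_iff_eq, Matrix.diagonal_mul_diagonal, Matrix.diagonal_mul_diagonal]
    congr 1
    funext s
    ring
  refine ⟨tensorOp r₁ * (Matrix.diagonal e₁ * (tensorOp r₂ * Matrix.diagonal (outerPhase φ))),
    ?_, fun Q => (cR₁ Q).mul_left ((cE₁ Q).mul_left ((cR₂ Q).mul_left (cE₂ Q))), ?_⟩
  · have u₁ : (tensorOp r₁)ᴴ * tensorOp r₁ = 1 := tensorOp_conjTranspose_mul_self fun y => by
      by_cases h1 : y = 1
      · subst h1; simp [r₁]
      · simp [r₁, h1, hUU]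
    have u₂ : (Matrix.diagonal e₁)ᴴ * Matrix.diagonal e₁ = 1 :=
      diagonal_conjTranspose_mul_self fun s => by
        exact star_mul_self_of_norm_eq_one (by simp [e₁, outerPhase, norm_phase])
    have u₃ : (tensorOp r₂)ᴴ * tensorOp r₂ = 1 := tensorOp_conjTranspose_mul_self fun y => by
      by_cases h0 : y = 0
      · subst h0; rw [r₂0]; exact kronecker_conjTranspose_mul_self hU (by simp)
      by_cases h1 : y = 1
      · subst h1; rw [r₂1]; simp
      by_cases h2 : y = 2
      · subst h2; rw [r₂2]; exact kronecker_conjTranspose_mul_self (by simp) hU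
      simp [r₂, h0, h1, h2, hUU]
    have u₄ : (Matrix.diagonal (outerPhase φ))ᴴ * Matrix.diagonal (outerPhase φ) = 1 :=
      diagonal_conjTranspose_mul_self fun s =>
        star_mul_self_of_norm_eq_one (by simp [outerPhase, norm_phase])
    exact conjTranspose_mul_self_mul u₁ (conjTranspose_mul_self_mul u₂
      (conjTranspose_mul_self_mul u₃ u₄))
  · rw [tileStep, coneStep]
    change tensorOp (fun _ => UU) * Matrix.diagonal (tilePhase φ 5)
      * (tensorOp (fun _ => UU) * Matrix.diagonal (tilePhase φ 5)) = _
    conv_lhs =>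
      congr
      · rw [hgate₁, hX₁]
      · rw [hgate₂, hX₂]
    simp only [Matrix.mul_assoc]
    rw [cE₂C.symm.left_comm, cR₂X.symm.left_comm, cE₂X.symm.left_comm, (cE₁ UU).symm.left_comm,
      (cR₂ UU).symm.left_comm, (cE₂ UU).symm.left_comm]

theorem onTile_mul_apply {f : ℕ} [NeZero f] {γ : Type} (x : ZMod f)
    (Q : Matrix (Fin 2 × Fin 2) (Fin 2 × Fin 2) ℂ) (M : Matrix (ZMod f → Fin 2 × Fin 2) γ ℂ)
    (s : ZMod f → Fin 2 × Fin 2) (k : γ) :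
    (onTile x Q * M) s k = ∑ p, Q (s x) p * M (Function.update s x p) k :=
  tensorOp_update_mul_apply x Q M s k

/-- The outer cells q, r of the neighbouring tiles are touched only by phases, and their adjacent
cells end in j, l. Summing over the initial states of the adjacent cells gives one weight on each
side of the tile. -/
theorem coneStep_mul_apply (φ : ℝ) (U : QMat) (ψ : TileFrame) (k : ZMod 5 → Fin 2)
    (s : ZMod 5 → Fin 2 × Fin 2) (q r j l : Fin 2) (h0 : s 0 = (q, j)) (h2 : s 2 = (l, r)) :
    (coneStep φ U * (tileJ ψ 5)ᴴ) s k = ψ (k 3) (s 3) * ψ (k 4) (s 4) *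
      (tileCone φ U j l (leftWeight φ U j (rightSlice φ (ψ (k 0)) q))
        (leftWeight φ U l (leftSlice φ (ψ (k 2)) r)) *ᵥ ψ (k 1)) (s 1) := by
  have h01 : (0 : ZMod 5) ≠ 1 := by decide
  have h02 : (0 : ZMod 5) ≠ 2 := by decide
  have h12 : (1 : ZMod 5) ≠ 2 := by decide
  have h30 : (3 : ZMod 5) ≠ 0 := by decide
  have h31 : (3 : ZMod 5) ≠ 1 := by decide
  have h32 : (3 : ZMod 5) ≠ 2 := by decide
  have h40 : (4 : ZMod 5) ≠ 0 := by decide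
  have h41 : (4 : ZMod 5) ≠ 1 := by decide
  have h42 : (4 : ZMod 5) ≠ 2 := by decide
  have hJ : ∀ t, (tileJ ψ 5)ᴴ t k = ψ (k 0) (t 0) * ψ (k 1) (t 1) * ψ (k 2) (t 2)
      * ψ (k 3) (t 3) * ψ (k 4) (t 4) := by
    intro t
    rw [tileJ, tensorOp_conjTranspose]
    refine (Fin.prod_univ_five fun x : ZMod 5 => (frameMat ψ)ᴴ (t x) (k x)).trans ?_
    simp [frameMat, Matrix.conjTranspose_apply]
    rfl
  rw [coneStep, coneGates]
  simp only [Matrix.mul_assoc, onTile_mul_apply, Matrix.diagonal_mul, hJ, tileCone,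
    ← Matrix.mulVec_mulVec]
  simp only [Matrix.mulVec, dotProduct, innerPhase, middlePhase, Function.update_self, ne_eq, h01,
    h02, h12, h30, h31, h32, h40, h41, h42, h01.symm, h02.symm, h12.symm, not_false_eq_true,
    Function.update_of_ne, h0, h2]
  rw [Finset.mul_sum]
  refine Finset.sum_congr rfl fun p _ => ?_
  simp only [sum_one_kronecker_mul, sum_kronecker_one_mul, Matrix.diagonal_apply]
  simp only [ite_mul, zero_mul, Finset.sum_ite_eq, Finset.mem_univ, if_true, leftWeight,
    leftSlice, rightSlice, Fin.sum_univ_two]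
  simp only [Fintype.sum_prod_type, Fin.sum_univ_two, phase_zero_left,
    phase_zero_right]
  ring

/-- The factor K of `tileStep_sq_eq` is injective and commutes with operators on tile 1, so it
cancels from the fixed-point relation. -/
theorem isConeInvariant_of_columns {φ : ℝ} {U : QMat} (hU : Uᴴ * U = 1) {P} {ψ : TileFrame}
    (hψ : IsFrameOf ψ P) {Q : Matrix (Fin 2 × Fin 2) (Fin 2 × Fin 2) ℂ} {b : Fin 2}
    (h : ∀ k : ZMod 5 → Fin 2, k 1 = b → ∀ s,
      (onTile (1 : ZMod 5) Q * (tileStep φ U 5 * tileStep φ U 5 * (tileJ ψ 5)ᴴ)) s k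
        = (tileStep φ U 5 * tileStep φ U 5 * (tileJ ψ 5)ᴴ) s k) :
    IsConeInvariant φ U ψ Q (ψ b) := by
  obtain ⟨K, hK, hKQ, hG⟩ := tileStep_sq_eq φ hU
  set M := coneStep φ U * (tileJ ψ 5)ᴴ with hM
  have hD : onTile (1 : ZMod 5) Q * (tileStep φ U 5 * tileStep φ U 5 * (tileJ ψ 5)ᴴ)
      - tileStep φ U 5 * tileStep φ U 5 * (tileJ ψ 5)ᴴ = K * (onTile (1 : ZMod 5) Q * M - M) := by
    rw [hG, Matrix.mul_sub, ← Matrix.mul_assoc K (onTile (1 : ZMod 5) Q), (hKQ Q).eq, hM]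
    simp only [Matrix.mul_assoc]
  have hcol : ∀ k : ZMod 5 → Fin 2, k 1 = b → ∀ s, (onTile (1 : ZMod 5) Q * M) s k = M s k := by
    intro k hk s
    have h1 : onTile (1 : ZMod 5) Q * M - M = Kᴴ * (K * (onTile (1 : ZMod 5) Q * M - M)) := by
      rw [← Matrix.mul_assoc Kᴴ K, hK, Matrix.one_mul]
    rw [← sub_eq_zero, ← Matrix.sub_apply, h1, ← hD, Matrix.mul_apply]
    refine Finset.sum_eq_zero fun t _ => ?_
    rw [Matrix.sub_apply, h k hk t, sub_self, mul_zero]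
  -- Tiles 3 and 4 are spectators: put in this state, they contribute a non-zero constant.
  obtain ⟨p₀, hp₀⟩ : ∃ p, ψ 0 p ≠ 0 := by
    by_contra! h0
    have := hψ.1 0 0
    simp [dotProduct, h0] at this
  intro a c q r j l
  have h01 : (0 : ZMod 5) ≠ 1 := by decide
  have h02 : (0 : ZMod 5) ≠ 2 := by decide
  have h12 : (1 : ZMod 5) ≠ 2 := by decide
  have h30 : (3 : ZMod 5) ≠ 0 := by decide
  have h31 : (3 : ZMod 5) ≠ 1 := by decide
  have h32 : (3 : ZMod 5) ≠ 2 := by decide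
  have h40 : (4 : ZMod 5) ≠ 0 := by decide
  have h41 : (4 : ZMod 5) ≠ 1 := by decide
  have h42 : (4 : ZMod 5) ≠ 2 := by decide
  let k : ZMod 5 → Fin 2 :=
    Function.update (Function.update (Function.update (fun _ => 0) 0 a) 1 b) 2 c
  let s : Fin 2 × Fin 2 → ZMod 5 → Fin 2 × Fin 2 := fun p =>
    Function.update (Function.update (Function.update (fun _ => p₀) 0 (q, j)) 2 (l, r)) 1 p
  have k0 : k 0 = a := by simp [k, h01, h02]
  have k1 : k 1 = b := by simp [k, h12]
  have k2 : k 2 = c := by simp [k]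
  have k3 : k 3 = 0 := by simp [k, h30, h31, h32]
  have k4 : k 4 = 0 := by simp [k, h40, h41, h42]
  have s0 : ∀ p, s p 0 = (q, j) := fun p => by simp [s, h01, h02]
  have s1 : ∀ p, s p 1 = p := fun p => by simp [s]
  have s2 : ∀ p, s p 2 = (l, r) := fun p => by simp [s, h12.symm]
  have s3 : ∀ p, s p 3 = p₀ := fun p => by simp [s, h30, h31, h32]
  have s4 : ∀ p, s p 4 = p₀ := fun p => by simp [s, h40, h41, h42]
  have hs : ∀ p p', Function.update (s p) 1 p' = s p' := fun p p' => by simp [s]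
  funext p
  have key := hcol k k1 (s p)
  rw [onTile_mul_apply] at key
  simp only [hs, s1, hM, coneStep_mul_apply φ U ψ k _ q r j l (s0 _) (s2 _), s3, s4, k0, k1, k2,
    k3, k4] at key
  refine mul_left_cancel₀ (mul_ne_zero hp₀ hp₀) (Eq.trans ?_ key)
  rw [Matrix.mulVec, dotProduct, Finset.mul_sum]
  exact Finset.sum_congr rfl fun x _ => by ring

/-- The projection of a renormalisation is invariant under the two-step light cone. -/
theorem IsRenormalisation.isConeInvariant {φ : ℝ} {U : QMat} (hU : Uᴴ * U = 1) {S : CellRule} {P}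
    {ψ : TileFrame} (h : IsRenormalisation (qubitQCA φ U) S P ψ) (b : Fin 2) :
    IsConeInvariant φ U ψ P (ψ b) := by
  obtain ⟨Sw, -, hSw⟩ := h.tile_eq hU
  have hψ := h.2.2.1
  refine isConeInvariant_of_columns hU hψ fun k _ s => ?_
  have := onTile_mul_step_sq hU hψ hSw 1 1
  rw [Matrix.mul_one, frameMat_conjTranspose_mul hψ, onSite_one, map_one, Matrix.mul_one] at this
  rw [this]

/-- A self-renormalisation maps the state `U|0⟩` of the coarse-grained cell to `|0⟩`. -/
theorem IsRenormalisation.isConeInvariant_self {φ : ℝ} {U : QMat} (hU : Uᴴ * U = 1) {P}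
    {ψ : TileFrame} (h : IsRenormalisation (qubitQCA φ U) (qubitQCA φ U) P ψ) :
    IsConeInvariant φ U ψ ((frameMat ψ)ᴴ * (U * proj1 0 * Uᴴ) * frameMat ψ) (ψ 0) := by
  obtain ⟨Sw, hS, hSw⟩ := h.tile_eq hU
  have hψ := h.2.2.1
  have hU' : U * Uᴴ = 1 := mul_eq_one_comm.1 hU
  refine isConeInvariant_of_columns hU hψ fun k hk s => ?_
  -- The gate is undone and the diagonal projection commutes with the phases, so no neighbour is
  -- involved.
  have hS1 : Sw (onSite 1 (U * proj1 0 * Uᴴ)) = onSite 1 (proj1 0) := by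
    rw [hS.eq_conj hU (by norm_num), ringStep_conj_onSite φ hU (by norm_num),
      embedOp_qubitQCA (ZMod.neighbours_injective (by norm_num) 1) φ U (ringPhase φ 5)
        (fun s t h => star_ringPhase_mul_of_eq_off φ (by norm_num) 1 s t h)]
    change _ * onSite 1 _ * _ = _
    have e : Uᴴ * (U * proj1 0 * Uᴴ) * U = proj1 0 := by
      calc _ = (Uᴴ * U) * proj1 0 * (Uᴴ * U) := by simp only [Matrix.mul_assoc]
        _ = _ := by rw [hU, Matrix.one_mul, Matrix.mul_one]
    have e2 : onSite (1 : ZMod 5) (proj1 0)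
        = Matrix.diagonal fun s => if s 1 = 0 then 1 else 0 := by
      have : proj1 0 = Matrix.diagonal fun a => if a = 0 then 1 else 0 := by
        ext i j; fin_cases i <;> fin_cases j <;> simp [proj1]
      ext s t
      rw [onSite, Matrix.diagonal_apply, this, Matrix.diagonal_apply]
      by_cases hst : s = t
      · simp [hst]
      · rw [if_neg hst]
        split_ifs with h1 h2 <;> try rfl
        exact absurd (funext fun y => if hy : y = 1 then hy ▸ h2 else h1 y hy) hst
    rw [e, e2, Matrix.diagonal_conjTranspose, Matrix.diagonal_mul_diagonal,
      Matrix.diagonal_mul_diagonal]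
    congr 1
    funext s
    rw [mul_right_comm, Pi.star_apply, star_ringPhase_mul, one_mul]
  rw [onTile_mul_step_sq hU hψ hSw, hS1, Matrix.mul_apply, Finset.sum_eq_single k]
  · simp [onSite, hk, proj1]
  · intro t _ ht
    have : onSite (1 : ZMod 5) (proj1 0) t k = 0 := by
      rw [onSite]
      split_ifs with h1
      · have h2 : t 1 ≠ k 1 := fun h2 =>
          ht (funext fun y => if hy : y = 1 then hy ▸ h2 else h1 y hy)
        rw [proj1, Matrix.single_apply_of_ne]
        rintro ⟨h3, h4⟩
        exact h2 (h3.symm.trans h4)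
      · rfl
    rw [this, mul_zero]
  · simp

/-! ### Invariant projections -/

/-- A matrix that maps the range of a projection to itself and is invertible does so backwards. -/
theorem invariant_inv {α : Type} [Fintype α] [DecidableEq α] {P N N' : Matrix α α ℂ}
    (hP : P * P = P) (hN : P * N * P = N * P) (h : N' * N = 1) : P * N' * P = N' * P := by
  -- Compressions to the range are completed by 1 - P to square matrices, for which a one-sided
  -- inverse is two-sided.
  have h1 : (P * N' * P + (1 - P)) * (P * N * P + (1 - P)) = 1 := by
    have e1 : P * N' * P * (P * N * P) = P := by
      calc _ = P * N' * (P * P * N * P) := by simp only [Matrix.mul_assoc]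
        _ = P * ((N' * N) * P) := by rw [hP, hN]; simp only [Matrix.mul_assoc]
        _ = P := by rw [h, Matrix.one_mul, hP]
    have e2 : P * N' * P * (1 - P) = 0 := by
      rw [Matrix.mul_sub, Matrix.mul_one, Matrix.mul_assoc _ P P, hP, sub_self]
    have e3 : (1 - P) * (P * N * P) = 0 := by
      rw [Matrix.mul_assoc P, ← Matrix.mul_assoc, Matrix.sub_mul, Matrix.one_mul, hP, sub_self,
        Matrix.zero_mul]
    have e4 : (1 - P) * (1 - P) = 1 - P := (show IsIdempotentElem P from hP).one_sub
    rw [Matrix.add_mul, Matrix.mul_add, Matrix.mul_add, e1, e2, e3, e4]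
    abel
  have h2 := mul_eq_one_comm.1 h1
  have h3 : N * (P * N' * P) = P := by
    have e1 : P * N * P * (1 - P) = 0 := by
      rw [Matrix.mul_sub, Matrix.mul_one, Matrix.mul_assoc _ P P, hP, sub_self]
    have e2 : (1 - P) * (P * N' * P) = 0 := by
      rw [Matrix.mul_assoc P, ← Matrix.mul_assoc, Matrix.sub_mul, Matrix.one_mul, hP, sub_self,
        Matrix.zero_mul]
    have e3 : (1 - P) * (1 - P) = 1 - P := (show IsIdempotentElem P from hP).one_sub
    rw [Matrix.add_mul, Matrix.mul_add, Matrix.mul_add, e1, e2, e3, add_zero, zero_add,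
      ← eq_sub_iff_add_eq, sub_sub_cancel, hN] at h2
    calc N * (P * N' * P) = N * (P * P * N' * P) := by rw [hP]
      _ = N * P * (P * N' * P) := by simp only [Matrix.mul_assoc]
      _ = P := h2
  calc P * N' * P = (N' * N) * (P * N' * P) := by rw [h, Matrix.one_mul]
    _ = N' * P := by rw [Matrix.mul_assoc, h3]

open scoped ComplexOrder in
/-- A projection whose range is invariant under a unitary matrix commutes with it. -/
theorem commute_of_invariant {α : Type} [Fintype α] [DecidableEq α] {P R : Matrix α α ℂ}
    (hP : P * P = P) (hP' : Pᴴ = P) (hR : Rᴴ * R = 1) (h : P * R * P = R * P) : P * R = R * P := by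
  -- With X = PR(1-P), the trace of X†X equals that of R†PR - P, which is zero since R is unitary.
  have h0 : P * R * (1 - P) = 0 := by
    rw [← Matrix.trace_conjTranspose_mul_self_eq_zero_iff]
    have e : (P * R * (1 - P))ᴴ * (P * R * (1 - P)) = (1 - P) * (Rᴴ * P * R * (1 - P)) := by
      rw [Matrix.conjTranspose_mul, Matrix.conjTranspose_mul, Matrix.conjTranspose_sub,
        Matrix.conjTranspose_one, hP']
      calc _ = (1 - P) * (Rᴴ * (P * P) * R * (1 - P)) := by simp only [Matrix.mul_assoc]
        _ = _ := by rw [hP]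
    have e2 : Rᴴ * P * R * (1 - P) * (1 - P) = Rᴴ * P * R - P := by
      have e4 : (1 - P) * (1 - P) = 1 - P := (show IsIdempotentElem P from hP).one_sub
      rw [Matrix.mul_assoc _ (1 - P), e4, Matrix.mul_sub, Matrix.mul_one]
      congr 1
      calc _ = Rᴴ * (P * R * P) := by simp only [Matrix.mul_assoc]
        _ = P := by rw [h, ← Matrix.mul_assoc, hR, Matrix.one_mul]
    rw [e, Matrix.trace_mul_comm, e2, Matrix.trace_sub, Matrix.trace_mul_comm, ← Matrix.mul_assoc,
      mul_eq_one_comm.1 hR, Matrix.one_mul, sub_self]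
  rw [Matrix.mul_sub, Matrix.mul_one, sub_eq_zero] at h0
  rw [h0, h]

/-! ### Consequences of being an orthonormal frame of a projection. -/

section Frames

variable {ψ : TileFrame} {P : Matrix (Fin 2 × Fin 2) (Fin 2 × Fin 2) ℂ} (hψ : IsFrameOf ψ P)
include hψ

theorem IsFrameOf.mul_self : P * P = P := by
  rw [← frameMat_conjTranspose_mul hψ, Matrix.mul_assoc, ← Matrix.mul_assoc (frameMat ψ),
    frameMat_mul_conjTranspose hψ, Matrix.one_mul]

theorem IsFrameOf.conjTranspose_eq : Pᴴ = P := by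
  rw [← frameMat_conjTranspose_mul hψ, Matrix.conjTranspose_mul,
    Matrix.conjTranspose_conjTranspose]

theorem IsFrameOf.trace_eq : P.trace = 2 := by
  rw [← frameMat_conjTranspose_mul hψ, Matrix.trace_mul_comm, frameMat_mul_conjTranspose hψ]
  simp

theorem IsFrameOf.mulVec_eq (b : Fin 2) : P *ᵥ ψ b = ψ b := by
  have h : P * (frameMat ψ)ᴴ = (frameMat ψ)ᴴ := by
    rw [← frameMat_conjTranspose_mul hψ, Matrix.mul_assoc, frameMat_mul_conjTranspose hψ,
      Matrix.mul_one]
  funext p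
  have := congrFun₂ h p b
  simpa [frameMat, Matrix.mul_apply, Matrix.mulVec, dotProduct] using this

theorem IsFrameOf.invariant {N : Matrix (Fin 2 × Fin 2) (Fin 2 × Fin 2) ℂ}
    (h : ∀ b, P *ᵥ (N *ᵥ ψ b) = N *ᵥ ψ b) : P * N * P = N * P := by
  have h1 : P * N * (frameMat ψ)ᴴ = N * (frameMat ψ)ᴴ := by
    ext p b
    have := congrFun (h b) p
    rw [Matrix.mulVec_mulVec] at this
    simpa [frameMat, Matrix.mul_apply, Matrix.mulVec, dotProduct] using this
  have hP := frameMat_conjTranspose_mul hψ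
  calc P * N * P = P * N * (frameMat ψ)ᴴ * frameMat ψ := by rw [← hP]; simp only [Matrix.mul_assoc]
    _ = N * P := by rw [h1, ← hP, Matrix.mul_assoc]

theorem IsFrameOf.ne_zero (b : Fin 2) : ∃ p, ψ b p ≠ 0 := by
  by_contra! h0
  have := hψ.1 b b
  simp [dotProduct, h0] at this

end Frames

/-- The left cells of the tiles `C_φ ψ` have no common linear relation. -/
def LeftFull (φ : ℝ) (ψ : TileFrame) : Prop :=
  ∀ α : Fin 2 → ℂ, (∀ c r, ∑ k, α k * leftSlice φ (ψ c) r k = 0) → α = 0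

/-- The right cells of the tiles `C_φ ψ` have no common linear relation. -/
def RightFull (φ : ℝ) (ψ : TileFrame) : Prop :=
  ∀ α : Fin 2 → ℂ, (∀ c q, ∑ k, α k * rightSlice φ (ψ c) q k = 0) → α = 0

/-- A relation α on the left cells and a relation β on the right cells together confine C_φψ₀ and
C_φψ₁ to the line of a single product vector, against orthonormality. -/
theorem leftFull_or_rightFull (φ : ℝ) {ψ : TileFrame} {P} (hψ : IsFrameOf ψ P) :
    LeftFull φ ψ ∨ RightFull φ ψ := by
  by_contra! h
  obtain ⟨h1, h2⟩ := h
  unfold LeftFull at h1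
  unfold RightFull at h2
  push Not at h1 h2
  obtain ⟨α, hα, hα0⟩ := h1
  obtain ⟨β, hβ, hβ0⟩ := h2
  obtain ⟨i, hi⟩ := Function.ne_iff.1 hα0
  obtain ⟨k, hk⟩ := Function.ne_iff.1 hβ0
  simp only [Pi.zero_apply] at hi hk
  have hsum : ∀ (F : Fin 2 → ℂ) (i : Fin 2), ∑ x, F x = F i + F (1 - i) := by
    intro F i
    fin_cases i
    · simp [Fin.sum_univ_two]
    · simp [Fin.sum_univ_two, add_comm]
  have hcases : ∀ x y : Fin 2, x = y ∨ x = 1 - y := by decide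
  have hne : ∀ y : Fin 2, 1 - y ≠ y := by decide
  let w : Fin 2 → ℂ := fun x => if x = i then -α (1 - i) / α i else 1
  let v : Fin 2 → ℂ := fun x => if x = k then -β (1 - k) / β k else 1
  have hl : ∀ c x y, phase φ x y * ψ c (x, y) = w x * (phase φ (1 - i) y * ψ c (1 - i, y)) := by
    intro c x y
    have := hα c y
    rw [hsum _ i] at this
    simp only [leftSlice] at this
    rcases hcases x i with rfl | rfl
    · simp only [w, if_true]
      field_simp
      linear_combination this
    · simp [w, hne]
  have hr : ∀ c x y, phase φ x y * ψ c (x, y) = v y * (phase φ x (1 - k) * ψ c (x, 1 - k)) := by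
    intro c x y
    have := hβ c x
    rw [hsum _ k] at this
    simp only [rightSlice] at this
    rcases hcases y k with rfl | rfl
    · simp only [v, if_true]
      field_simp
      linear_combination this
    · simp [v, hne]
  let ω : Fin 2 × Fin 2 → ℂ := fun p => (phase φ p.1 p.2)⁻¹ * (w p.1 * v p.2)
  have hω : ∀ c p, ψ c p = (phase φ (1 - i) (1 - k) * ψ c (1 - i, 1 - k)) * ω p := by
    rintro c ⟨x, y⟩
    have h1 := hl c x y
    rw [hr c (1 - i) y] at h1
    have h0 := phase_ne_zero φ x y
    simp only [ω]
    field_simp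
    linear_combination h1
  have hdot : ∀ c d, star (ψ c) ⬝ᵥ ψ d = star (phase φ (1 - i) (1 - k) * ψ c (1 - i, 1 - k))
      * (phase φ (1 - i) (1 - k) * ψ d (1 - i, 1 - k)) * (star ω ⬝ᵥ ω) := by
    intro c d
    simp only [dotProduct, Finset.mul_sum, Pi.star_apply]
    refine Finset.sum_congr rfl fun p _ => ?_
    rw [hω c p, hω d p]
    simp only [star_mul']
    ring
  have h00 := hψ.1 0 0
  have h11 := hψ.1 1 1
  have h01 := hψ.1 0 1
  rw [hdot] at h00 h11 h01
  simp only [if_true, Fin.isValue, zero_ne_one, if_false] at h00 h11 h01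
  rcases mul_eq_zero.1 h01 with h | h
  · rcases mul_eq_zero.1 h with h | h
    · rw [h] at h00; simp at h00
    · rw [h] at h11; simp at h11
  · rw [h] at h00; simp at h00

/-! ### The two-step map seen from one tile -/

/-- The matrix `Z^k`, `Z = diag (1, e^{iφ})`. -/
def phaseGate (φ : ℝ) (k : Fin 2) : QMat := Matrix.diagonal fun x => phase φ k x

/-- The action of the right neighbour on the right cell. -/
def edgeGate (φ : ℝ) (U : QMat) (l k : Fin 2) : QMat := Uᴴ * phaseGate φ l * U * phaseGate φ k

/-- The part of `tileCone` that does not depend on the right neighbour. -/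
def coneCore (φ : ℝ) (U : QMat) (j : Fin 2) : Matrix (Fin 2 × Fin 2) (Fin 2 × Fin 2) ℂ :=
  (U ⊗ₖ U) * (Matrix.diagonal (fun p => phase φ j p.1 * phase φ p.1 p.2) * (U ⊗ₖ U))

theorem coneCore_conjTranspose_mul (φ : ℝ) {U : QMat} (hU : Uᴴ * U = 1) (j : Fin 2) :
    (coneCore φ U j)ᴴ * coneCore φ U j = 1 :=
  conjTranspose_mul_self_mul (kronecker_conjTranspose_mul_self hU hU)
    (conjTranspose_mul_self_mul
      (diagonal_conjTranspose_mul_self fun _ => star_mul_self_of_norm_eq_one (by simp [norm_phase]))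
      (kronecker_conjTranspose_mul_self hU hU))

theorem phaseGate_conjTranspose_mul (φ : ℝ) (k : Fin 2) :
    (phaseGate φ k)ᴴ * phaseGate φ k = 1 :=
  diagonal_conjTranspose_mul_self fun _ => star_phase_mul _ _ _

theorem edgeGate_conjTranspose_mul (φ : ℝ) {U : QMat} (hU : Uᴴ * U = 1) (l k : Fin 2) :
    (edgeGate φ U l k)ᴴ * edgeGate φ U l k = 1 :=
  conjTranspose_mul_self_mul (conjTranspose_mul_self_mul (conjTranspose_mul_self_mul
    (by rw [Matrix.conjTranspose_conjTranspose, mul_eq_one_comm.1 hU])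
    (phaseGate_conjTranspose_mul φ l)) hU) (phaseGate_conjTranspose_mul φ k)

/-- If the adjacent right cell goes from k to l, it acts on the tile by Z^k before and Z^l after the
first gate. Pulling Z^l back through U collects the whole dependence on l and k in `edgeGate`. -/
theorem tileCone_single (φ : ℝ) {U : QMat} (hU : Uᴴ * U = 1) (j l k : Fin 2) (α : Fin 2 → ℂ) :
    tileCone φ U j l α (fun x => U l k * phase φ k x)
      = U l k • (coneCore φ U j * ((1 ⊗ₖ edgeGate φ U l k)
        * Matrix.diagonal fun p => α p.1 * phase φ p.1 p.2)) := by
  have hU' : U * Uᴴ = 1 := mul_eq_one_comm.1 hU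
  have e1 : (Matrix.diagonal fun p : Fin 2 × Fin 2 =>
        phase φ j p.1 * phase φ p.1 p.2 * phase φ p.2 l)
      = Matrix.diagonal (fun p => phase φ j p.1 * phase φ p.1 p.2) * (1 ⊗ₖ phaseGate φ l) := by
    rw [phaseGate, ← Matrix.diagonal_one, Matrix.diagonal_kronecker_diagonal,
      Matrix.diagonal_mul_diagonal]
    congr 1
    funext p
    rw [one_mul, phase_comm φ p.2 l]
  have e2 : (Matrix.diagonal fun p : Fin 2 × Fin 2 =>
        α p.1 * phase φ p.1 p.2 * (U l k * phase φ k p.2))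
      = U l k • ((1 ⊗ₖ phaseGate φ k) * Matrix.diagonal (fun p => α p.1 * phase φ p.1 p.2)) := by
    rw [phaseGate, ← Matrix.diagonal_one, Matrix.diagonal_kronecker_diagonal,
      Matrix.diagonal_mul_diagonal, ← Matrix.diagonal_smul]
    congr 1
    funext p
    simp only [Pi.smul_apply, smul_eq_mul]
    ring
  have e3 : ((1 : QMat) ⊗ₖ phaseGate φ l) * (U ⊗ₖ U)
      = (U ⊗ₖ U) * (1 ⊗ₖ (Uᴴ * phaseGate φ l * U)) := by
    rw [← Matrix.mul_kronecker_mul, ← Matrix.mul_kronecker_mul, Matrix.one_mul, Matrix.mul_one,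
      ← Matrix.mul_assoc, ← Matrix.mul_assoc, hU', Matrix.one_mul]
  have e4 : (1 : QMat) ⊗ₖ edgeGate φ U l k
      = (1 ⊗ₖ (Uᴴ * phaseGate φ l * U)) * (1 ⊗ₖ phaseGate φ k) := by
    rw [← Matrix.mul_kronecker_mul, Matrix.one_mul, edgeGate]
  rw [tileCone, coneCore, e1, e2, e4]
  simp only [Matrix.mul_smul, Matrix.mul_assoc]
  rw [← Matrix.mul_assoc (1 ⊗ₖ phaseGate φ l) (U ⊗ₖ U), e3]
  simp only [Matrix.mul_assoc]

theorem tileCone_apply (φ : ℝ) (U : QMat) (j l : Fin 2) (α β : Fin 2 → ℂ) (p q : Fin 2 × Fin 2) :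
    tileCone φ U j l α β p q = tileCone φ U j l α 1 p q * β q.2 := by
  simp only [tileCone, ← Matrix.mul_assoc, Matrix.mul_diagonal, Pi.one_apply, mul_one]
  ring

theorem tileCone_leftWeight (φ : ℝ) (U : QMat) (j l : Fin 2) (α lam : Fin 2 → ℂ) :
    tileCone φ U j l α (leftWeight φ U l lam)
      = ∑ k, lam k • tileCone φ U j l α (fun x => U l k * phase φ k x) := by
  ext p q
  rw [tileCone_apply, Matrix.sum_apply, leftWeight, Finset.mul_sum]
  refine Finset.sum_congr rfl fun k _ => ?_
  rw [Matrix.smul_apply, tileCone_apply φ U j l α fun x => U l k * phase φ k x, smul_eq_mul]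
  ring

/-- When the left cells are full, the right neighbour can be put in a computational state. -/
theorem IsConeInvariant.of_leftFull {φ : ℝ} {U : QMat} {ψ : TileFrame} {Q} {η : Fin 2 × Fin 2 → ℂ}
    (h : IsConeInvariant φ U ψ Q η) (hL : LeftFull φ ψ) (a q j l k : Fin 2) :
    Q *ᵥ (tileCone φ U j l (leftWeight φ U j (rightSlice φ (ψ a) q))
        (fun x => U l k * phase φ k x) *ᵥ η)
      = tileCone φ U j l (leftWeight φ U j (rightSlice φ (ψ a) q))
        (fun x => U l k * phase φ k x) *ᵥ η := by
  set v : Fin 2 → Fin 2 × Fin 2 → ℂ := fun k =>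
    tileCone φ U j l (leftWeight φ U j (rightSlice φ (ψ a) q)) (fun x => U l k * phase φ k x) *ᵥ η
    with hv
  have hw : ∀ lam, tileCone φ U j l (leftWeight φ U j (rightSlice φ (ψ a) q))
      (leftWeight φ U l lam) *ᵥ η = ∑ k, lam k • v k := by
    intro lam
    rw [tileCone_leftWeight, Matrix.sum_mulVec]
    simp only [Matrix.smul_mulVec, hv]
  change Q *ᵥ v k = v k
  funext p
  -- The p-th components of the defects Qv_k - v_k form a linear relation among the left slices,
  -- which fullness makes trivial.
  have := hL (fun k => (Q *ᵥ v k) p - v k p) fun c r => by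
    have h1 := congrFun (h a c q r j l) p
    rw [hw, Matrix.mulVec_sum] at h1
    simp only [Matrix.mulVec_smul, Finset.sum_apply, Pi.smul_apply, smul_eq_mul] at h1
    rw [← sub_eq_zero, ← Finset.sum_sub_distrib] at h1
    rw [← h1]
    exact Finset.sum_congr rfl fun x _ => by ring
  exact sub_eq_zero.1 (congrFun this k)

/-- The commutation relations of an invariant projection. -/
theorem IsFrameOf.commute_edgeGate {φ : ℝ} {U : QMat} (hU : Uᴴ * U = 1) {ψ : TileFrame} {P}
    (hψ : IsFrameOf ψ P) (h : ∀ b, IsConeInvariant φ U ψ P (ψ b)) (hL : LeftFull φ ψ)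
    {a q j : Fin 2} (hα : ∀ x, leftWeight φ U j (rightSlice φ (ψ a) q) x ≠ 0)
    {l k l' k' : Fin 2} (hlk : U l k ≠ 0) (hlk' : U l' k' ≠ 0) :
    let R : Matrix (Fin 2 × Fin 2) (Fin 2 × Fin 2) ℂ :=
      (Matrix.diagonal fun p => phase φ p.1 p.2)ᴴ * ((1 ⊗ₖ ((edgeGate φ U l k)ᴴ
        * edgeGate φ U l' k')) * Matrix.diagonal fun p => phase φ p.1 p.2)
    P * R = R * P := by
  intro R
  set α := leftWeight φ U j (rightSlice φ (ψ a) q) with hαdef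
  set M := coneCore φ U j with hM
  have hMM : Mᴴ * M = 1 := coneCore_conjTranspose_mul φ hU j
  set κ := edgeGate φ U l k
  set κ' := edgeGate φ U l' k'
  have hκ : κᴴ * κ = 1 := edgeGate_conjTranspose_mul φ hU l k
  have hκ' : κ'ᴴ * κ' = 1 := edgeGate_conjTranspose_mul φ hU l' k'
  have hκ2 : κ * κᴴ = 1 := mul_eq_one_comm.1 hκ
  set B : Matrix (Fin 2 × Fin 2) (Fin 2 × Fin 2) ℂ :=
    Matrix.diagonal fun p => α p.1 * phase φ p.1 p.2 with hB
  set B' : Matrix (Fin 2 × Fin 2) (Fin 2 × Fin 2) ℂ :=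
    Matrix.diagonal fun p => (α p.1 * phase φ p.1 p.2)⁻¹ with hB'
  have hBB : B' * B = 1 := by
    rw [hB, hB', Matrix.diagonal_mul_diagonal, ← Matrix.diagonal_one]
    congr 1
    funext p
    exact inv_mul_cancel₀ (mul_ne_zero (hα _) (phase_ne_zero _ _ _))
  -- Each such map preserves the range of P and is invertible, because α vanishes nowhere. So the
  -- quotient of two of them also preserves the range.
  have inv : ∀ l k, U l k ≠ 0 → P * (M * ((1 ⊗ₖ edgeGate φ U l k) * B)) * P
      = M * ((1 ⊗ₖ edgeGate φ U l k) * B) * P := by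
    intro l k hlk
    have h1 := hψ.invariant fun b => (h b).of_leftFull hL a q j l k
    rw [tileCone_single φ hU, Matrix.mul_smul, Matrix.smul_mul, Matrix.smul_mul] at h1
    exact smul_right_injective _ hlk h1
  have hone : ((1 : QMat) ⊗ₖ κᴴ) * (1 ⊗ₖ κ) = 1 := by
    rw [← Matrix.mul_kronecker_mul, hκ, Matrix.one_mul, Matrix.one_kronecker_one]
  have hinv := invariant_inv hψ.mul_self (inv l k hlk) (N' := B' * ((1 ⊗ₖ κᴴ) * Mᴴ)) (by
    calc _ = B' * ((1 ⊗ₖ κᴴ) * (Mᴴ * M) * (1 ⊗ₖ κ)) * B := by simp only [Matrix.mul_assoc]; rfl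
      _ = 1 := by rw [hMM, Matrix.mul_one, hone, Matrix.mul_one, hBB])
  -- The core M cancels, and α cancels because it depends only on the left cell, where the quotient
  -- is the identity. What is left is unitary.
  have hR : B' * ((1 ⊗ₖ κᴴ) * Mᴴ) * (M * ((1 ⊗ₖ κ') * B)) = R := by
    calc _ = B' * (((1 ⊗ₖ κᴴ) * (Mᴴ * M) * (1 ⊗ₖ κ')) * B) := by simp only [Matrix.mul_assoc]
      _ = B' * ((1 ⊗ₖ (κᴴ * κ')) * B) := by
          rw [hMM, Matrix.mul_one, ← Matrix.mul_kronecker_mul, Matrix.one_mul]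
      _ = R := by
          ext p p'
          simp only [R, hB, hB', Matrix.diagonal_conjTranspose, Matrix.diagonal_mul,
            Matrix.mul_diagonal, Matrix.kroneckerMap_apply, Pi.star_apply]
          by_cases hp : p.1 = p'.1
          · have h1 := hα p'.1
            have h2 := star_phase_mul φ p'.1 p.2
            have h3 := phase_ne_zero φ p'.1 p.2
            have h4 : star (phase φ p'.1 p.2) = (phase φ p'.1 p.2)⁻¹ := eq_inv_of_mul_eq_one_left h2
            rw [hp, h4]
            field_simp
            exact mul_comm _ _
          · simp [Matrix.one_apply_ne hp]
  refine commute_of_invariant hψ.mul_self hψ.conjTranspose_eq ?_ ?_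
  · have hd : (Matrix.diagonal fun p : Fin 2 × Fin 2 => phase φ p.1 p.2)ᴴ
        * Matrix.diagonal (fun p : Fin 2 × Fin 2 => phase φ p.1 p.2) = 1 :=
      diagonal_conjTranspose_mul_self fun _ => star_phase_mul _ _ _
    refine conjTranspose_mul_self_mul ?_ (conjTranspose_mul_self_mul
      (kronecker_conjTranspose_mul_self (by simp) (conjTranspose_mul_self_mul ?_ hκ')) hd)
    · rw [Matrix.conjTranspose_conjTranspose, mul_eq_one_comm.1 hd]
    · rw [Matrix.conjTranspose_conjTranspose, hκ2]
  · rw [← hR]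
    set N' := B' * ((1 ⊗ₖ κᴴ) * Mᴴ)
    have h2 := inv l' k' hlk'
    set N := M * ((1 ⊗ₖ edgeGate φ U l' k') * B)
    calc P * (N' * N) * P = P * N' * (N * P) := by simp only [Matrix.mul_assoc]
      _ = P * N' * (P * N * P) := by rw [h2]
      _ = (P * N' * P) * (N * P) := by simp only [Matrix.mul_assoc]
      _ = N' * (P * N * P) := by rw [hinv]; simp only [Matrix.mul_assoc]
      _ = N' * N * P := by rw [h2, Matrix.mul_assoc N' N P]

/-! ### Classification of the invariant projections -/

theorem fin_two_eq : ∀ r : Fin 2, r = 0 ∨ r = 1 := by decide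

theorem phaseGate_zero (φ : ℝ) : phaseGate φ 0 = 1 := by
  simp [phaseGate]

theorem edgeGate_zero_zero (φ : ℝ) {U : QMat} (hU : Uᴴ * U = 1) : edgeGate φ U 0 0 = 1 := by
  simp [edgeGate, phaseGate_zero, hU]

theorem edgeGate_zero_one (φ : ℝ) {U : QMat} (hU : Uᴴ * U = 1) :
    edgeGate φ U 0 1 = phaseGate φ 1 := by
  simp [edgeGate, phaseGate_zero, hU]

theorem edgeGate_one_apply (φ : ℝ) (U : QMat) (k x y : Fin 2) :
    edgeGate φ U 1 k x y
      = (star (U 0 x) * U 0 y + phase φ 1 1 * star (U 1 x) * U 1 y) * phase φ k y := by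
  rw [edgeGate, phaseGate, phaseGate, Matrix.mul_diagonal, Matrix.mul_apply]
  simp only [Matrix.mul_diagonal, Fin.sum_univ_two, Matrix.conjTranspose_apply, phase_zero_right,
    mul_one]
  ring

theorem unitary_columns {U : QMat} (hU : Uᴴ * U = 1) (x y : Fin 2) :
    star (U 0 x) * U 0 y + star (U 1 x) * U 1 y = if x = y then 1 else 0 := by
  have := congrFun₂ hU x y
  simpa [Matrix.mul_apply, Fin.sum_univ_two, Matrix.conjTranspose_apply,
    Matrix.one_apply] using this

theorem edgeGate_one_zero_ne_zero {φ : ℝ} (hφ : phase φ 1 1 ≠ 1) {U : QMat} (hU : Uᴴ * U = 1)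
    (hgen : ∀ i j, U i j ≠ 0) {x y : Fin 2} (hxy : x ≠ y) : edgeGate φ U 1 0 x y ≠ 0 := by
  have h := unitary_columns hU x y
  rw [if_neg hxy] at h
  have e : edgeGate φ U 1 0 x y = (1 - phase φ 1 1) * (star (U 0 x) * U 0 y) := by
    rw [edgeGate_one_apply, phase_zero_left]
    linear_combination phase φ 1 1 * h
  rw [e]
  exact mul_ne_zero (sub_ne_zero.2 hφ.symm) (mul_ne_zero (star_ne_zero.2 (hgen _ _)) (hgen _ _))

/-- A matrix commuting with a non-scalar diagonal matrix of the right cell. -/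
theorem apply_eq_zero_of_commute {φ : ℝ} {P : Matrix (Fin 2 × Fin 2) (Fin 2 × Fin 2) ℂ} {m : QMat}
    (hP : P * ((Matrix.diagonal fun p => phase φ p.1 p.2)ᴴ * ((1 ⊗ₖ m)
        * Matrix.diagonal fun p => phase φ p.1 p.2))
      = ((Matrix.diagonal fun p => phase φ p.1 p.2)ᴴ * ((1 ⊗ₖ m)
        * Matrix.diagonal fun p => phase φ p.1 p.2)) * P)
    (h01 : m 0 1 = 0) (h10 : m 1 0 = 0) (hm : m 0 0 ≠ m 1 1) {p q : Fin 2 × Fin 2}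
    (hpq : p.2 ≠ q.2) : P p q = 0 := by
  have hR : (Matrix.diagonal fun p : Fin 2 × Fin 2 => phase φ p.1 p.2)ᴴ * ((1 ⊗ₖ m)
      * Matrix.diagonal fun p => phase φ p.1 p.2) = Matrix.diagonal fun p => m p.2 p.2 := by
    have hm' : m = Matrix.diagonal fun x => m x x := by
      ext i j
      fin_cases i <;> fin_cases j <;> simp [h01, h10]
    rw [hm', ← Matrix.diagonal_one, Matrix.diagonal_kronecker_diagonal,
      Matrix.diagonal_conjTranspose, Matrix.diagonal_mul_diagonal, Matrix.diagonal_mul_diagonal]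
    congr 1
    funext p
    simp only [Pi.star_apply, one_mul, Matrix.diagonal_apply_eq]
    linear_combination m p.2 p.2 * star_phase_mul φ p.1 p.2
  rw [hR] at hP
  have h := congrFun₂ hP p q
  rw [Matrix.mul_diagonal, Matrix.diagonal_mul] at h
  have hne : m p.2 p.2 ≠ m q.2 q.2 := by
    rcases p with ⟨a, b⟩
    rcases q with ⟨c, d⟩
    fin_cases b <;> fin_cases d <;> simp_all
    exact fun h => hm h.symm
  have : (m p.2 p.2 - m q.2 q.2) * P p q = 0 := by linear_combination -h
  exact (mul_eq_zero.1 this).resolve_left (sub_ne_zero.2 hne)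

/-- Some weight of the left neighbour vanishes nowhere, unless `e^{iφ}` is real. -/
theorem exists_leftWeight_ne_zero {φ : ℝ} (hφ : phase φ 1 1 ^ 2 ≠ 1) {U : QMat} (hU : Uᴴ * U = 1)
    {lam : Fin 2 → ℂ} (hlam : lam ≠ 0) : ∃ j, ∀ x, leftWeight φ U j lam x ≠ 0 := by
  by_contra! h
  have hz := star_phase_mul φ 1 1
  set z := phase φ 1 1 with hzdef
  have hw0 : ∀ j, leftWeight φ U j lam 0 = U j 0 * lam 0 + U j 1 * lam 1 := fun j => by
    simp [leftWeight, Fin.sum_univ_two]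
  have hw1 : ∀ j, leftWeight φ U j lam 1 = U j 0 * lam 0 + z * (U j 1 * lam 1) := fun j => by
    simp [leftWeight, Fin.sum_univ_two, ← hzdef]; ring
  -- If each j had a vanishing weight, summing these products over j and using that U is unitary
  -- would give |λ₀|² + e^{iφ}|λ₁|² = 0. This forces λ = 0 when e^{iφ} is not real.
  have hprod : ∀ j, star (leftWeight φ U j lam 0) * leftWeight φ U j lam 1 = 0 := by
    intro j
    obtain ⟨x, hx⟩ := h j
    fin_cases x
    · simp only [Fin.zero_eta] at hx; rw [hx]; simp
    · simp only [Fin.mk_one] at hx; rw [hx]; simp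
  have h0 := hprod 0
  have h1 := hprod 1
  rw [hw0, hw1] at h0 h1
  simp only [star_add, star_mul'] at h0 h1
  have c00 := unitary_columns hU 0 0
  have c01 := unitary_columns hU 0 1
  have c10 := unitary_columns hU 1 0
  have c11 := unitary_columns hU 1 1
  simp only [if_true, Fin.isValue, zero_ne_one, one_ne_zero, if_false] at c00 c01 c10 c11
  have e1 : star (lam 0) * lam 0 + z * (star (lam 1) * lam 1) = 0 := by
    linear_combination h0 + h1 - star (lam 0) * lam 0 * c00 - z * star (lam 0) * lam 1 * c01
      - star (lam 1) * lam 0 * c10 - z * star (lam 1) * lam 1 * c11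
  have e2 : star (lam 0) * lam 0 + star z * (star (lam 1) * lam 1) = 0 := by
    have := congrArg star e1
    simp only [star_add, star_mul', star_star, star_zero] at this
    linear_combination this
  have e3 : (z ^ 2 - 1) * (star (lam 1) * lam 1) = 0 := by
    linear_combination z * e1 - z * e2 + star (lam 1) * lam 1 * hz
  have hl1 : lam 1 = 0 := by
    simpa using (mul_eq_zero.1 e3).resolve_left (sub_ne_zero.2 hφ)
  have hl0 : lam 0 = 0 := by
    rw [hl1] at e1
    simpa using e1
  exact hlam (funext fun x => by fin_cases x <;> assumption)

theorem rightSlice_ne_zero {φ : ℝ} {ψ : TileFrame} {P} (hψ : IsFrameOf ψ P) :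
    ∃ q i, rightSlice φ (ψ 0) q i ≠ 0 := by
  obtain ⟨p, hp⟩ := hψ.ne_zero 0
  exact ⟨p.1, p.2, mul_ne_zero (phase_ne_zero _ _ _) hp⟩

/-- No projection is invariant when all the entries of `U` are non-zero. -/
theorem not_isConeInvariant_of_generic {φ : ℝ} (hφ : phase φ 1 1 ^ 2 ≠ 1) {U : QMat}
    (hU : Uᴴ * U = 1) (hgen : ∀ i j, U i j ≠ 0) {ψ : TileFrame} {P} (hψ : IsFrameOf ψ P)
    (h : ∀ b, IsConeInvariant φ U ψ P (ψ b)) (hL : LeftFull φ ψ) : False := by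
  have hφ1 : phase φ 1 1 ≠ 1 := fun h1 => hφ (by rw [h1, one_pow])
  obtain ⟨q, i, hqi⟩ := rightSlice_ne_zero (φ := φ) hψ
  obtain ⟨j, hj⟩ := exists_leftWeight_ne_zero hφ hU
    (lam := rightSlice φ (ψ 0) q) fun h0 => hqi (congrFun h0 i)
  -- The two quotients are Z and U†ZU on the right cell: Z separates the values of this cell, and
  -- U†ZU has non-zero off-diagonal entries.
  have c1 := hψ.commute_edgeGate hU h hL hj (hgen 0 0) (hgen 0 1)
  have c2 := hψ.commute_edgeGate hU h hL hj (hgen 0 0) (hgen 1 0)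
  simp only [edgeGate_zero_zero φ hU, edgeGate_zero_one φ hU, Matrix.conjTranspose_one,
    Matrix.one_mul] at c1 c2
  have hz : ∀ {p q : Fin 2 × Fin 2}, p.2 ≠ q.2 → P p q = 0 := fun hpq =>
    apply_eq_zero_of_commute c1 (by simp [phaseGate]) (by simp [phaseGate])
      (by simpa [phaseGate] using hφ1.symm) hpq
  set K := edgeGate φ U 1 0 with hK
  have hK01 : K 0 1 ≠ 0 := edgeGate_one_zero_ne_zero hφ1 hU hgen (by decide)
  -- The two diagonal blocks of C_φ P C_φ† coincide, so this operator is p ⊗ 1.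
  have hblock : ∀ a c, phase φ a 1 * P (a, 1) (c, 1) = P (a, 0) (c, 0) * phase φ c 1 := by
    intro a c
    have h1 := congrFun₂ c2 (a, 0) (c, 1)
    rw [Matrix.mul_apply, Matrix.mul_apply] at h1
    simp only [Fintype.sum_prod_type, Matrix.diagonal_conjTranspose, Matrix.diagonal_mul,
      Matrix.mul_diagonal, Matrix.kroneckerMap_apply, Pi.star_apply, Fin.sum_univ_two,
      phase_zero_right, star_one, one_mul, mul_one] at h1
    rw [hz (p := (a, 0)) (q := (0, 1)) (by simp), hz (p := (a, 0)) (q := (1, 1)) (by simp),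
      hz (p := (0, 0)) (q := (c, 1)) (by simp), hz (p := (1, 0)) (q := (c, 1)) (by simp)] at h1
    refine mul_left_cancel₀ hK01 ?_
    rcases fin_two_eq a with rfl | rfl <;> rcases fin_two_eq c with rfl | rfl <;>
      simp [-mul_eq_mul_left_iff] at h1 ⊢ <;> linear_combination -h1
  -- P fixes ψ_b, so p fixes every left slice; fullness gives p = 1, and P would have trace 4.
  have hp : ∀ a, (fun c => P (a, 0) (c, 0) - if a = c then 1 else 0) = 0 := by
    intro a
    apply hL
    intro b r
    have h1 := congrFun (hψ.mulVec_eq b) (a, r)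
    rw [Matrix.mulVec, dotProduct, Fintype.sum_prod_type] at h1
    simp only [Fin.sum_univ_two] at h1 ⊢
    simp only [leftSlice]
    rcases fin_two_eq r with rfl | rfl
    · rw [hz (p := (a, 0)) (q := (0, 1)) (by simp), hz (p := (a, 0)) (q := (1, 1)) (by simp)] at h1
      rcases fin_two_eq a with rfl | rfl <;> simp at h1 ⊢ <;> linear_combination h1
    · rw [hz (p := (a, 1)) (q := (0, 0)) (by simp), hz (p := (a, 1)) (q := (1, 0)) (by simp)] at h1
      have b0 := hblock a 0
      have b1 := hblock a 1
      rcases fin_two_eq a with rfl | rfl <;> simp at h1 b0 b1 ⊢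
      · linear_combination h1 - ψ b (0, 1) * b0 - ψ b (1, 1) * b1
      · linear_combination phase φ 1 1 * h1 - ψ b (0, 1) * b0 - ψ b (1, 1) * b1
  have ht := hψ.trace_eq
  rw [Matrix.trace, Fintype.sum_prod_type] at ht
  simp only [Fin.sum_univ_two, Matrix.diag_apply] at ht
  have p0 := congrFun (hp 0) 0
  have p1 := congrFun (hp 1) 1
  have b0 := hblock 0 0
  have b1 := hblock 1 1
  simp at p0 p1 b0 b1
  have b1' : P (1, 1) (1, 1) = P (1, 0) (1, 0) :=
    mul_left_cancel₀ (phase_ne_zero φ 1 1) (b1.trans (mul_comm _ _))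
  rw [b0, b1', sub_eq_zero.1 p0, sub_eq_zero.1 p1] at ht
  norm_num at ht

/-- All the entries on the diagonal, or all those off the diagonal, vanish. -/
def IsMonomial (U : QMat) : Prop := (U 0 1 = 0 ∧ U 1 0 = 0) ∨ (U 0 0 = 0 ∧ U 1 1 = 0)

theorem isMonomial_or_generic {U : QMat} (hU : Uᴴ * U = 1) :
    IsMonomial U ∨ ∀ i j, U i j ≠ 0 := by
  have hU' : Uᴴᴴ * Uᴴ = 1 := by
    rw [Matrix.conjTranspose_conjTranspose, mul_eq_one_comm.1 hU]
  have c00 := unitary_columns hU 0 0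
  have c01 := unitary_columns hU 0 1
  have c11 := unitary_columns hU 1 1
  have r01 := unitary_columns hU' 0 1
  simp only [if_true, Fin.isValue, zero_ne_one, if_false, Matrix.conjTranspose_apply, star_star]
    at c00 c01 c11 r01
  by_cases h00 : U 0 0 = 0
  · left; right
    refine ⟨h00, ?_⟩
    rw [h00] at c00 c01
    have : U 1 0 ≠ 0 := fun h => by simp [h] at c00
    simpa [this] using c01
  by_cases h11 : U 1 1 = 0
  · rw [h11] at c01 c11
    have : U 0 1 ≠ 0 := fun h => by simp [h] at c11
    simp [this] at c01
    exact absurd c01 h00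
  by_cases h01 : U 0 1 = 0
  · left; left
    refine ⟨h01, ?_⟩
    rw [h01] at c01
    simpa [h11] using c01
  by_cases h10 : U 1 0 = 0
  · rw [h10] at c01
    simp [h00] at c01
    exact absurd c01 h01
  right
  intro i j
  fin_cases i <;> fin_cases j <;> assumption

/-- For a monomial gate the invariant projections are diagonal in the right cell. -/
theorem apply_eq_zero_of_monomial {φ : ℝ} (hφ : phase φ 1 1 ^ 2 ≠ 1) {U : QMat}
    (hU : Uᴴ * U = 1) (hmon : IsMonomial U) {ψ : TileFrame} {P} (hψ : IsFrameOf ψ P)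
    (h : ∀ b, IsConeInvariant φ U ψ P (ψ b)) (hL : LeftFull φ ψ) {p q : Fin 2 × Fin 2}
    (hpq : p.2 ≠ q.2) : P p q = 0 := by
  obtain ⟨q', i, hqi⟩ := rightSlice_ne_zero (φ := φ) hψ
  have c00 := unitary_columns hU 0 0
  have c11 := unitary_columns hU 1 1
  simp only [if_true] at c00 c11
  obtain ⟨j, hj⟩ : ∃ j, ∀ x, leftWeight φ U j (rightSlice φ (ψ 0) q') x ≠ 0 := by
    refine exists_leftWeight_ne_zero hφ hU fun h0 => hqi (congrFun h0 i)
  rcases hmon with ⟨h01, h10⟩ | ⟨h00, h11⟩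
  · rw [h10] at c00
    rw [h01] at c11
    have n00 : U 0 0 ≠ 0 := fun h => by simp [h] at c00
    have n11 : U 1 1 ≠ 0 := fun h => by simp [h] at c11
    -- The quotient is diag(1, e^{2iφ}), not a scalar.
    have c := hψ.commute_edgeGate hU h hL hj n00 n11
    simp only [edgeGate_zero_zero φ hU, Matrix.conjTranspose_one, Matrix.one_mul] at c
    refine apply_eq_zero_of_commute c ?_ ?_ ?_ hpq
    · simp [edgeGate_one_apply, h01, h10]
    · simp [edgeGate_one_apply, h01, h10]
    · have e0 : edgeGate φ U 1 1 0 0 = 1 := by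
        rw [edgeGate_one_apply, h10]; simpa using c00
      have e1 : edgeGate φ U 1 1 1 1 = phase φ 1 1 ^ 2 := by
        rw [edgeGate_one_apply, h01]
        simp only [mul_zero, zero_add] at c11 ⊢
        linear_combination phase φ 1 1 ^ 2 * c11
      rw [e0, e1]
      exact hφ.symm
  · rw [h00] at c00
    rw [h11] at c11
    have n10 : U 1 0 ≠ 0 := fun h => by simp [h] at c00
    have n01 : U 0 1 ≠ 0 := fun h => by simp [h] at c11
    -- The quotient is diag(e^{-iφ}, e^{iφ}), not a scalar.
    have c := hψ.commute_edgeGate hU h hL hj n10 n01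
    simp only [edgeGate_zero_one φ hU] at c
    have g00 : edgeGate φ U 1 0 0 0 = phase φ 1 1 := by
      rw [edgeGate_one_apply, h00]
      simp only [mul_zero, zero_add, phase_zero_left] at c00 ⊢
      linear_combination phase φ 1 1 * c00
    have g11 : edgeGate φ U 1 0 1 1 = 1 := by
      rw [edgeGate_one_apply, h11]; simpa using c11
    have g01 : edgeGate φ U 1 0 0 1 = 0 := by simp [edgeGate_one_apply, h00, h11]
    have g10 : edgeGate φ U 1 0 1 0 = 0 := by simp [edgeGate_one_apply, h00, h11]
    refine apply_eq_zero_of_commute c ?_ ?_ ?_ hpq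
    · simp [phaseGate, Matrix.conjTranspose_apply, g10]
    · simp [phaseGate, Matrix.conjTranspose_apply, g01]
    · simp only [phaseGate, Matrix.mul_diagonal, Matrix.conjTranspose_apply, g00, g11,
        phase_zero_right, star_one, mul_one, one_mul]
      intro h'
      apply hφ
      have := star_phase_mul φ 1 1
      rw [h'] at this
      rw [sq, this]

/-! ### Reflection of the lattice -/

/-- The frame of the reflected tile. -/
def mirror (ψ : TileFrame) : TileFrame := fun a p => ψ a p.swap

theorem rightSlice_mirror (φ : ℝ) (ψ : TileFrame) (a : Fin 2) :
    rightSlice φ (mirror ψ a) = leftSlice φ (ψ a) := by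
  funext q i
  simp only [rightSlice, leftSlice, mirror, Prod.swap_prod_mk, phase_comm φ q i]

theorem leftSlice_mirror (φ : ℝ) (ψ : TileFrame) (a : Fin 2) :
    leftSlice φ (mirror ψ a) = rightSlice φ (ψ a) := by
  funext q i
  simp only [rightSlice, leftSlice, mirror, Prod.swap_prod_mk, phase_comm φ i q]

theorem RightFull.mirror {φ : ℝ} {ψ : TileFrame} (h : RightFull φ ψ) :
    LeftFull φ (mirror ψ) := fun α hα => h α fun c q => by
  have := hα c q
  rwa [leftSlice_mirror] at this

theorem kronecker_swap (U V : QMat) : (V ⊗ₖ U) = (U ⊗ₖ V).submatrix Prod.swap Prod.swap := by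
  ext p q
  simp [Matrix.kroneckerMap_apply, mul_comm]

theorem tileCone_swap (φ : ℝ) (U : QMat) (j l : Fin 2) (α β : Fin 2 → ℂ) :
    tileCone φ U l j β α = (tileCone φ U j l α β).submatrix Prod.swap Prod.swap := by
  have hs : (Prod.swap : Fin 2 × Fin 2 → Fin 2 × Fin 2) = Equiv.prodComm (Fin 2) (Fin 2) := rfl
  have e1 : ∀ d : Fin 2 × Fin 2 → ℂ, (Matrix.diagonal d).submatrix Prod.swap Prod.swap
      = Matrix.diagonal (d ∘ Prod.swap) := fun d =>
    Matrix.submatrix_diagonal d Prod.swap Prod.swap_injective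
  rw [tileCone, tileCone, hs, ← Matrix.submatrix_mul_equiv _ _ _ (Equiv.prodComm (Fin 2) (Fin 2)) _,
    ← Matrix.submatrix_mul_equiv _ _ _ (Equiv.prodComm (Fin 2) (Fin 2)) _,
    ← Matrix.submatrix_mul_equiv _ _ _ (Equiv.prodComm (Fin 2) (Fin 2)) _, ← hs, e1, e1,
    ← kronecker_swap]
  congr 2
  · congr 1
    funext p
    simp only [Function.comp, Prod.fst_swap, Prod.snd_swap, phase_comm φ p.2 p.1,
      phase_comm φ l p.1, phase_comm φ p.2 j]
    ring
  · congr 2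
    funext p
    simp only [Function.comp, Prod.fst_swap, Prod.snd_swap, phase_comm φ p.2 p.1]
    ring

theorem submatrix_swap_mulVec (M : Matrix (Fin 2 × Fin 2) (Fin 2 × Fin 2) ℂ)
    (v : Fin 2 × Fin 2 → ℂ) :
    M.submatrix Prod.swap Prod.swap *ᵥ (fun p => v p.swap) = fun p => (M *ᵥ v) p.swap :=
  Matrix.submatrix_mulVec_equiv M (fun p : Fin 2 × Fin 2 => v p.swap) Prod.swap
    (Equiv.prodComm (Fin 2) (Fin 2))

/-- The light cone is symmetric under reflection, with the two neighbours exchanged. This reduces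
arguments under `RightFull` to those under `LeftFull`. -/
theorem IsConeInvariant.mirror {φ : ℝ} {U : QMat} {ψ : TileFrame} {Q} {η : Fin 2 × Fin 2 → ℂ}
    (h : IsConeInvariant φ U ψ Q η) :
    IsConeInvariant φ U (mirror ψ) (Q.submatrix Prod.swap Prod.swap) fun p => η p.swap := by
  intro a c q r j l
  rw [tileCone_swap, submatrix_swap_mulVec, submatrix_swap_mulVec, leftSlice_mirror,
    rightSlice_mirror, h c a r q l j]

theorem IsFrameOf.mirror {ψ : TileFrame} {P} (h : IsFrameOf ψ P) :
    IsFrameOf (mirror ψ) (P.submatrix Prod.swap Prod.swap) := by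
  refine ⟨fun k l => ?_, ?_⟩
  · rw [← h.1 k l, dotProduct, dotProduct]
    exact (Equiv.prodComm (Fin 2) (Fin 2)).sum_comp fun p => star (ψ k) p * ψ l p
  · ext p q
    rw [← h.2]
    simp only [Matrix.sum_apply, Matrix.submatrix_apply]
    rfl

/-! ### The possible projections -/

theorem IsRenormalisation.isMonomial {φ : ℝ} (hφ : phase φ 1 1 ^ 2 ≠ 1) {U : QMat}
    (hU : Uᴴ * U = 1) {S : CellRule} {P} {ψ : TileFrame}
    (h : IsRenormalisation (qubitQCA φ U) S P ψ) : IsMonomial U := by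
  refine (isMonomial_or_generic hU).resolve_right fun hgen => ?_
  have hψ := h.2.2.1
  rcases leftFull_or_rightFull φ hψ with hL | hR
  · exact not_isConeInvariant_of_generic hφ hU hgen hψ (h.isConeInvariant hU) hL
  · exact not_isConeInvariant_of_generic hφ hU hgen hψ.mirror
      (fun b => (h.isConeInvariant hU b).mirror) hR.mirror

/-- A projection below another one of the same trace is equal to it. -/
theorem eq_of_mul_eq_of_trace_eq {α : Type} [Fintype α] [DecidableEq α] {P R : Matrix α α ℂ}
    (hP : P * P = P) (hP' : Pᴴ = P) (hR : R * R = R) (hR' : Rᴴ = R) (hRP : R * P = P)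
    (ht : P.trace = R.trace) : P = R := by
  open scoped ComplexOrder in
  have h : (R - P)ᴴ * (R - P) = R - P := by
    have hPR : P * R = P := by
      have := congrArg Matrix.conjTranspose hRP
      rwa [Matrix.conjTranspose_mul, hR', hP'] at this
    rw [Matrix.conjTranspose_sub, hR', hP', Matrix.sub_mul, Matrix.mul_sub, Matrix.mul_sub, hR, hRP,
      hPR, hP, sub_self, sub_zero]
  have h0 := (Matrix.trace_conjTranspose_mul_self_eq_zero_iff (A := R - P)).1
    (by rw [h, Matrix.trace_sub, ht, sub_self])
  exact (sub_eq_zero.1 h0).symm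

theorem one_kronecker_proj1 (c : Fin 2) :
    (1 : QMat) ⊗ₖ proj1 c = Matrix.diagonal fun p => if p.2 = c then 1 else 0 := by
  have : proj1 c = Matrix.diagonal fun x => if x = c then 1 else 0 := by
    ext i j
    fin_cases c <;> fin_cases i <;> fin_cases j <;> simp [proj1]
  rw [this, ← Matrix.diagonal_one, Matrix.diagonal_kronecker_diagonal]
  simp only [one_mul]

theorem proj1_kronecker_one (c : Fin 2) :
    proj1 c ⊗ₖ (1 : QMat) = Matrix.diagonal fun p => if p.1 = c then 1 else 0 := by
  rw [kronecker_swap, one_kronecker_proj1,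
    Matrix.submatrix_diagonal _ _ Prod.swap_injective]
  rfl

theorem projQ1_eq : projQ1 = Matrix.diagonal fun p => if p.1 = p.2 then 1 else 0 := by
  ext p q
  rcases p with ⟨a, b⟩
  rcases q with ⟨c, d⟩
  fin_cases a <;> fin_cases b <;> fin_cases c <;> fin_cases d <;>
    simp [projQ1, proj1, Matrix.kroneckerMap_apply]

theorem projQ2_eq : projQ2 = Matrix.diagonal fun p => if p.1 = p.2 then 0 else 1 := by
  ext p q
  rcases p with ⟨a, b⟩
  rcases q with ⟨c, d⟩
  fin_cases a <;> fin_cases b <;> fin_cases c <;> fin_cases d <;>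
    simp [projQ2, proj1, Matrix.kroneckerMap_apply]

/-- A projection that is diagonal in the right cell, while the right cells of its range satisfy
a linear relation. -/
theorem IsFrameOf.eq_of_not_rightFull {φ : ℝ} {ψ : TileFrame} {P} (hψ : IsFrameOf ψ P)
    (hd : ∀ p q : Fin 2 × Fin 2, p.2 ≠ q.2 → P p q = 0) (hR : ¬ RightFull φ ψ) :
    ∃ c, P = 1 ⊗ₖ proj1 c := by
  unfold RightFull at hR
  push Not at hR
  obtain ⟨β, hβ, hβ0⟩ := hR
  obtain ⟨i, hi⟩ := Function.ne_iff.1 hβ0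
  have hβP : ∀ q p', ∑ k, β k * (phase φ q k * P (q, k) p') = 0 := by
    intro q p'
    rw [← hψ.2]
    simp only [Matrix.sum_apply, Matrix.vecMulVec_apply]
    have h0 := hβ 0 q
    have h1 := hβ 1 q
    simp only [rightSlice, Fin.sum_univ_two] at h0 h1 ⊢
    linear_combination (star (ψ 0) p') * h0 + (star (ψ 1) p') * h1
  -- As P is block diagonal in the right cell, the relation β on its columns reduces to one term,
  -- and β i ≠ 0. So the right cell is never in the state i.
  have hz : ∀ q p', P (q, i) p' = 0 := by
    intro q p'
    by_cases hp' : i = p'.2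
    · have := hβP q p'
      rw [Finset.sum_eq_single i] at this
      · exact (mul_eq_zero.1 ((mul_eq_zero.1 this).resolve_left hi)).resolve_left
          (phase_ne_zero _ _ _)
      · intro k _ hk
        rw [hd (q, k) p' (by rw [← hp']; exact hk), mul_zero, mul_zero]
      · simp
    · exact hd _ _ hp'
  refine ⟨1 - i, ?_⟩
  rw [one_kronecker_proj1]
  refine eq_of_mul_eq_of_trace_eq hψ.mul_self hψ.conjTranspose_eq ?_ ?_ ?_ ?_
  · rw [Matrix.diagonal_mul_diagonal]
    simp
  · rw [Matrix.diagonal_conjTranspose]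
    congr 1
    funext p
    simp only [Pi.star_apply]
    split_ifs <;> simp
  · ext p q
    rw [Matrix.diagonal_mul]
    split_ifs with h
    · rw [one_mul]
    · have h' : p.2 = i := (by decide : ∀ x y : Fin 2, x ≠ 1 - y → x = y) _ _ h
      have := hz p.1 q
      rw [← h'] at this
      rw [zero_mul]
      exact this.symm
  · rw [hψ.trace_eq, Matrix.trace_diagonal, Fintype.sum_prod_type]
    fin_cases i <;> simp

/-- A diagonal projection of rank two. -/
theorem eq_of_diagonal_projection {P : Matrix (Fin 2 × Fin 2) (Fin 2 × Fin 2) ℂ}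
    (hd : ∀ p q, p ≠ q → P p q = 0) (hP : P * P = P) (ht : P.trace = 2) :
    P = projQ1 ∨ P = projQ2 ∨ (∃ c, P = 1 ⊗ₖ proj1 c) ∨ ∃ c, P = proj1 c ⊗ₖ 1 := by
  obtain ⟨d, rfl⟩ : ∃ d, P = Matrix.diagonal d := ⟨fun p => P p p, by
    ext p q
    by_cases h : p = q
    · simp [h]
    · rw [hd p q h, Matrix.diagonal_apply_ne _ h]⟩
  have h01 : ∀ p, d p = 0 ∨ d p = 1 := by
    intro p
    have h := congrFun₂ hP p p
    rw [Matrix.diagonal_mul_diagonal, Matrix.diagonal_apply_eq, Matrix.diagonal_apply_eq] at h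
    have : d p * (d p - 1) = 0 := by linear_combination h
    exact (mul_eq_zero.1 this).imp_right sub_eq_zero.1
  rw [Matrix.trace_diagonal, Fintype.sum_prod_type] at ht
  simp only [Fin.sum_univ_two] at ht
  have hcongr : ∀ e : Fin 2 × Fin 2 → ℂ, d (0, 0) = e (0, 0) → d (0, 1) = e (0, 1) →
      d (1, 0) = e (1, 0) → d (1, 1) = e (1, 1) → Matrix.diagonal d = Matrix.diagonal e := by
    intro e h1 h2 h3 h4
    congr 1
    funext ⟨a, b⟩
    fin_cases a <;> fin_cases b <;> assumption
  rw [projQ1_eq, projQ2_eq]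
  simp only [one_kronecker_proj1, proj1_kronecker_one]
  rcases h01 (0, 0) with h1 | h1 <;> rcases h01 (0, 1) with h2 | h2 <;>
    rcases h01 (1, 0) with h3 | h3 <;> rcases h01 (1, 1) with h4 | h4 <;>
    rw [h1, h2, h3, h4] at ht <;> norm_num at ht
  · exact Or.inr (Or.inr (Or.inr ⟨1, hcongr _ (by simp [h1]) (by simp [h2]) (by simp [h3])
      (by simp [h4])⟩))
  · exact Or.inr (Or.inr (Or.inl ⟨1, hcongr _ (by simp [h1]) (by simp [h2]) (by simp [h3])
      (by simp [h4])⟩))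
  · exact Or.inr (Or.inl (hcongr _ (by simp [h1]) (by simp [h2]) (by simp [h3]) (by simp [h4])))
  · exact Or.inl (hcongr _ (by simp [h1]) (by simp [h2]) (by simp [h3]) (by simp [h4]))
  · exact Or.inr (Or.inr (Or.inl ⟨0, hcongr _ (by simp [h1]) (by simp [h2]) (by simp [h3])
      (by simp [h4])⟩))
  · exact Or.inr (Or.inr (Or.inr ⟨0, hcongr _ (by simp [h1]) (by simp [h2]) (by simp [h3])
      (by simp [h4])⟩))

/-- Fullness on both sides makes P diagonal. Fullness on one side makes it block diagonal in the
cell of the opposite side, and the linear relation available there freezes that cell in one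
computational state. -/
theorem IsRenormalisation.projection_eq {φ : ℝ} (hφ : phase φ 1 1 ^ 2 ≠ 1) {U : QMat}
    (hU : Uᴴ * U = 1) {S : CellRule} {P} {ψ : TileFrame}
    (h : IsRenormalisation (qubitQCA φ U) S P ψ) :
    P = projQ1 ∨ P = projQ2 ∨ (∃ c, P = 1 ⊗ₖ proj1 c) ∨ ∃ c, P = proj1 c ⊗ₖ 1 := by
  have hmon := h.isMonomial hφ hU
  have hψ := h.2.2.1
  have hl : LeftFull φ ψ → ∀ p q : Fin 2 × Fin 2, p.2 ≠ q.2 → P p q = 0 := fun hL p q hpq =>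
    apply_eq_zero_of_monomial hφ hU hmon hψ (h.isConeInvariant hU) hL hpq
  have hr : RightFull φ ψ → ∀ p q : Fin 2 × Fin 2, p.2 ≠ q.2 →
      P.submatrix Prod.swap Prod.swap p q = 0 := fun hR p q hpq =>
    apply_eq_zero_of_monomial hφ hU hmon hψ.mirror (fun b => (h.isConeInvariant hU b).mirror)
      hR.mirror hpq
  by_cases hL : LeftFull φ ψ
  · by_cases hR : RightFull φ ψ
    · refine eq_of_diagonal_projection (fun p q hpq => ?_) hψ.mul_self hψ.trace_eq
      by_cases h2 : p.2 = q.2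
      · exact hr hR p.swap q.swap fun h1 => hpq (Prod.ext h1 h2)
      · exact hl hL p q h2
    · exact Or.inr (Or.inr (Or.inl (hψ.eq_of_not_rightFull (hl hL) hR)))
  · have hR := (leftFull_or_rightFull φ hψ).resolve_left hL
    have hL' : ¬ RightFull φ (mirror ψ) := fun h' => hL fun α hα => h' α fun c q => by
      rw [rightSlice_mirror]
      exact hα c q
    obtain ⟨c, hc⟩ := hψ.mirror.eq_of_not_rightFull (hr hR) hL'
    refine Or.inr (Or.inr (Or.inr ⟨c, ?_⟩))
    rw [kronecker_swap, ← hc, Matrix.submatrix_submatrix]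
    simp

/-! ### The renormalisations for a generic phase -/

theorem exists_flowDiag (φ ϑ : ℝ) {P : Matrix (Fin 2 × Fin 2) (Fin 2 × Fin 2) ℂ}
    (hP : P = projQ1 ∨ P = projQ2 ∨ (∃ c, P = 1 ⊗ₖ proj1 c) ∨ ∃ c, P = proj1 c ⊗ₖ 1) :
    ∃ ψ₀ φ' θ', FlowDiag φ ϑ P ψ₀ φ' θ' := by
  rcases hP with rfl | rfl | ⟨c, rfl⟩ | ⟨c, rfl⟩
  exacts [⟨_, _, _, .q1⟩, ⟨_, _, _, .q2⟩, ⟨_, _, _, .right c⟩, ⟨_, _, _, .left c⟩]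

theorem exists_flowAnti (φ : ℝ) {P : Matrix (Fin 2 × Fin 2) (Fin 2 × Fin 2) ℂ}
    (hP : P = projQ1 ∨ P = projQ2 ∨ (∃ c, P = 1 ⊗ₖ proj1 c) ∨ ∃ c, P = proj1 c ⊗ₖ 1) :
    ∃ ψ₀ φ' θ', FlowAnti φ P ψ₀ φ' θ' := by
  rcases hP with rfl | rfl | ⟨c, rfl⟩ | ⟨c, rfl⟩
  exacts [⟨_, _, _, .q1⟩, ⟨_, _, _, .q2⟩, ⟨_, _, _, .right c⟩, ⟨_, _, _, .left c⟩]

/-- The rule depends on `φ` only modulo `2π` and on `U` only up to a phase. -/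
theorem qubitQCA_congr {φ φ' : ℝ} (hφ : phase φ 1 1 = phase φ' 1 1) {U U' : QMat} {c : ℂ}
    (hc : star c * c = 1) (hU : U = c • U') : qubitQCA φ U = qubitQCA φ' U' := by
  have hph : ∀ a b, phase φ a b = phase φ' a b := by
    intro a b
    rcases fin_two_eq a with rfl | rfl <;> rcases fin_two_eq b with rfl | rfl <;> simp [hφ]
  have hUA : ∀ A, Uᴴ * A * U = U'ᴴ * A * U' := by
    intro A
    rw [hU, Matrix.conjTranspose_smul, Matrix.smul_mul, Matrix.smul_mul, Matrix.mul_smul, smul_smul,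
      hc, one_smul]
  funext A
  ext s t
  simp only [qubitQCA_apply, hph, hUA]

theorem rotGate_eq_zGate {n : EuclideanSpace ℝ (Fin 3)} (hn : ‖n‖ = 1) (h0 : n 0 = 0)
    (h1 : n 1 = 0) (θ : ℝ) : rotGate n θ = zGate (n 2 * θ) := by
  rw [rotGate_of_diagonal hn h0 h1, zGate_eq]

theorem rotGate_of_sin_eq_zero {n : EuclideanSpace ℝ (Fin 3)} (hn : ‖n‖ = 1) {θ : ℝ}
    (h : Real.sin θ = 0) : rotGate n θ = (Real.cos θ : ℂ) • zGate 0 := by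
  rw [rotGate_eq hn, zGate_eq, h]
  ext i j
  fin_cases i <;> fin_cases j <;> simp

theorem qubitQCA_rotGate_of_sin_eq_zero (φ : ℝ) {n : EuclideanSpace ℝ (Fin 3)} (hn : ‖n‖ = 1)
    {θ : ℝ} (h : Real.sin θ = 0) : qubitQCA φ (rotGate n θ) = qubitQCA φ (zGate 0) := by
  refine qubitQCA_congr rfl ?_ (rotGate_of_sin_eq_zero hn h)
  have := Real.cos_sq_add_sin_sq θ
  rw [h] at this
  rw [Complex.star_def, Complex.conj_ofReal, ← Complex.ofReal_mul, ← sq]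
  exact_mod_cast (by simpa using this)

theorem rotGate_of_cos_eq_zero {n : EuclideanSpace ℝ (Fin 3)} (hn : ‖n‖ = 1) {θ : ℝ}
    (h2 : n 2 = 0) (h : Real.cos θ = 0) : rotGate n θ 0 0 = 0 ∧ rotGate n θ 1 1 = 0 := by
  rw [rotGate_eq hn, h2, h]
  simp

theorem IsMonomial.rotGate_cases {n : EuclideanSpace ℝ (Fin 3)} (hn : ‖n‖ = 1) {θ : ℝ}
    (h : IsMonomial (rotGate n θ)) :
    (n 0 = 0 ∧ n 1 = 0) ∨ Real.sin θ = 0 ∨ (n 2 = 0 ∧ Real.cos θ = 0) := by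
  rw [rotGate_eq hn] at h
  rcases h with ⟨h, -⟩ | ⟨h, -⟩
  · by_cases hs : Real.sin θ = 0
    · exact Or.inr (Or.inl hs)
    · left
      replace h : -Complex.I * Real.sin θ * (n 0 - Complex.I * n 1) = 0 := h
      have h' : (n 0 : ℂ) - Complex.I * n 1 = 0 := (mul_eq_zero.1 h).resolve_left
        (mul_ne_zero (neg_ne_zero.2 Complex.I_ne_zero) (Complex.ofReal_ne_zero.2 hs))
      exact ⟨by simpa using congrArg Complex.re h', by simpa using congrArg Complex.im h'⟩
  · replace h : (Real.cos θ : ℂ) - Complex.I * Real.sin θ * n 2 = 0 := h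
    generalize hc : Real.cos θ = c at h ⊢
    generalize hs : Real.sin θ = s at h ⊢
    have hre : c = 0 := by simpa using congrArg Complex.re h
    have him : s = 0 ∨ n 2 = 0 := by simpa using congrArg Complex.im h
    exact him.elim (fun h => Or.inr (Or.inl h)) fun h => Or.inr (Or.inr ⟨h, hre⟩)

theorem phase_one_one_ne_one {φ : ℝ} (h : ∀ k : ℤ, φ ≠ k * (2 * Real.pi)) : phase φ 1 1 ≠ 1 := by
  intro h1
  rw [phase_one_one, Complex.exp_eq_one_iff] at h1
  obtain ⟨k, hk⟩ := h1
  refine h k ?_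
  have : (φ : ℂ) = ((k * (2 * Real.pi) : ℝ) : ℂ) := by
    refine mul_left_cancel₀ Complex.I_ne_zero (hk.trans ?_)
    push_cast
    ring
  exact_mod_cast this

theorem phase_one_one_pow (φ : ℝ) (m : ℕ) : phase φ 1 1 ^ m = phase (m * φ) 1 1 := by
  rw [phase_one_one, phase_one_one, ← Complex.exp_nat_mul]
  congr 1
  push_cast
  ring

theorem phase_sq_ne_one {φ : ℝ} (h : ∀ k : ℤ, φ ≠ k * Real.pi) : phase φ 1 1 ^ 2 ≠ 1 := by
  rw [phase_one_one_pow]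
  refine phase_one_one_ne_one fun k hk => h k ?_
  push_cast at hk
  linarith

/-- The renormalisations when `e^{2iφ} ≠ 1`. -/
theorem IsRenormalisation.flow_cases {φ θ : ℝ} (hφ : phase φ 1 1 ^ 2 ≠ 1)
    {n : EuclideanSpace ℝ (Fin 3)} (hn : ‖n‖ = 1) {S P ψ}
    (h : IsRenormalisation (qubitQCA φ (rotGate n θ)) S P ψ) :
    (n 0 = 0 ∧ n 1 = 0 ∧ ∃ ψ₀ φ' θ', FlowDiag φ (n 2 * θ) P ψ₀ φ' θ' ∧
      IsLocallyEquivalent ψ S ψ₀ φ' θ') ∨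
    (Real.sin θ = 0 ∧ ∃ ψ₀ φ' θ', FlowDiag φ 0 P ψ₀ φ' θ' ∧
      IsLocallyEquivalent ψ S ψ₀ φ' θ') ∨
    (n 2 = 0 ∧ Real.cos θ = 0 ∧ ∃ ψ₀ φ' θ', FlowAnti φ P ψ₀ φ' θ' ∧
      IsLocallyEquivalent ψ S ψ₀ φ' θ') := by
  have hU := rotGate_conjTranspose_mul hn θ
  have hP := h.projection_eq hφ hU
  rcases (h.isMonomial hφ hU).rotGate_cases hn with ⟨h0, h1⟩ | hs | ⟨h2, hc⟩
  · obtain ⟨ψ₀, φ', θ', hf⟩ := exists_flowDiag φ (n 2 * θ) hP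
    refine Or.inl ⟨h0, h1, ψ₀, φ', θ', hf, h.isLocallyEquivalent hU ?_⟩
    rw [rotGate_eq_zGate hn h0 h1]
    exact isRenormalisation_of_flowDiag hf
  · obtain ⟨ψ₀, φ', θ', hf⟩ := exists_flowDiag φ 0 hP
    refine Or.inr (Or.inl ⟨hs, ψ₀, φ', θ', hf, h.isLocallyEquivalent hU ?_⟩)
    rw [qubitQCA_rotGate_of_sin_eq_zero φ hn hs]
    exact isRenormalisation_of_flowDiag hf
  · obtain ⟨ψ₀, φ', θ', hf⟩ := exists_flowAnti φ hP
    obtain ⟨e0, e1⟩ := rotGate_of_cos_eq_zero hn h2 hc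
    exact Or.inr (Or.inr ⟨h2, hc, ψ₀, φ', θ', hf, h.isLocallyEquivalent hU
      (isRenormalisation_of_flowAnti hU e0 e1 hf)⟩)

/-! ### Self-renormalisations need a monomial gate -/

/-- For fixed x the weights, as a vector in j, are the image of λ under a unitary. Unlike
`exists_leftWeight_ne_zero`, this holds for every φ. -/
theorem exists_leftWeight_apply_ne_zero (φ : ℝ) {U : QMat} (hU : Uᴴ * U = 1) {lam : Fin 2 → ℂ}
    (hlam : ∃ i, lam i ≠ 0) (x : Fin 2) : ∃ j, leftWeight φ U j lam x ≠ 0 := by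
  by_contra! h
  obtain ⟨i, hi⟩ := hlam
  have h0 : U *ᵥ (fun i => lam i * phase φ i x) = 0 := by
    funext j
    rw [Pi.zero_apply, ← h j, leftWeight, Matrix.mulVec, dotProduct]
    exact Finset.sum_congr rfl fun k _ => by ring
  have h1 := congrArg (Uᴴ *ᵥ ·) h0
  simp only [Matrix.mulVec_mulVec, hU, Matrix.one_mulVec, Matrix.mulVec_zero] at h1
  exact mul_ne_zero hi (phase_ne_zero φ i x) (congrFun h1 i)

/-- No rank-one operator fixes the two-step images when all the entries of `U` are non-zero. -/
theorem not_isConeInvariant_of_rank_one {φ : ℝ} (hφ : phase φ 1 1 ≠ 1) {U : QMat}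
    (hU : Uᴴ * U = 1) (hgen : ∀ i j, U i j ≠ 0) {ψ : TileFrame} {P} (hψ : IsFrameOf ψ P)
    {χ ω : Fin 2 × Fin 2 → ℂ} (hL : LeftFull φ ψ)
    (h : IsConeInvariant φ U ψ (Matrix.vecMulVec χ ω) (ψ 0)) : False := by
  obtain ⟨p, hp⟩ := hψ.ne_zero 0
  obtain ⟨j, hj⟩ := exists_leftWeight_apply_ne_zero φ hU (lam := rightSlice φ (ψ 0) p.1)
    ⟨p.2, mul_ne_zero (phase_ne_zero _ _ _) hp⟩ p.1
  set α := leftWeight φ U j (rightSlice φ (ψ 0) p.1) with hα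
  set ζ : Fin 2 × Fin 2 → ℂ :=
    (Matrix.diagonal fun p : Fin 2 × Fin 2 => α p.1 * phase φ p.1 p.2) *ᵥ ψ 0 with hζ
  have hζp : ζ p ≠ 0 := by
    rw [hζ, Matrix.mulVec_diagonal]
    exact mul_ne_zero (mul_ne_zero hj (phase_ne_zero _ _ _)) hp
  set M := coneCore φ U j with hM
  have hMM : Mᴴ * M = 1 := coneCore_conjTranspose_mul φ hU j
  -- A vector fixed by a rank-one operator lies in its range, so all the histories give vectors on
  -- one line. No inverse of the weights is needed, only ζ ≠ 0.
  have hline : ∀ l k, ∃ c : ℂ, ((1 : QMat) ⊗ₖ edgeGate φ U l k) *ᵥ ζ = c • (Mᴴ *ᵥ χ) := by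
    intro l k
    have h1 := h.of_leftFull hL 0 p.1 j l k
    rw [tileCone_single φ hU, Matrix.vecMulVec_mulVec] at h1
    simp only [Matrix.smul_mulVec, ← Matrix.mulVec_mulVec, ← hα, ← hζ, ← hM] at h1
    generalize ω ⬝ᵥ _ = d at h1
    refine ⟨(U l k)⁻¹ * d, ?_⟩
    have h2 := congrArg (fun v => Mᴴ *ᵥ ((U l k)⁻¹ • v)) h1
    simp only [smul_smul, inv_mul_cancel₀ (hgen l k), one_smul, Matrix.mulVec_mulVec] at h2
    rw [← Matrix.mul_assoc, hMM, Matrix.one_mul] at h2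
    rw [← h2, op_smul_eq_smul, smul_smul, Matrix.mulVec_smul]
  have hcol : ∀ l k, ∃ c : ℂ, ((1 : QMat) ⊗ₖ edgeGate φ U l k) *ᵥ ζ = c • ζ := by
    obtain ⟨c₀, h0⟩ := hline 0 0
    rw [edgeGate_zero_zero φ hU, Matrix.one_kronecker_one, Matrix.one_mulVec] at h0
    have hc₀ : c₀ ≠ 0 := fun h' => hζp (by rw [h0, h']; simp)
    intro l k
    obtain ⟨c, hc⟩ := hline l k
    refine ⟨c * c₀⁻¹, ?_⟩
    rw [hc]
    conv_rhs => rw [h0]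
    rw [smul_smul, inv_mul_cancel_right₀ hc₀]
  have happ : ∀ (m : QMat) (x y : Fin 2), (((1 : QMat) ⊗ₖ m) *ᵥ ζ) (x, y)
      = m y 0 * ζ (x, 0) + m y 1 * ζ (x, 1) := by
    intro m x y
    rw [Matrix.mulVec, dotProduct, sum_one_kronecker_mul m x y, Fin.sum_univ_two]
  obtain ⟨d, hd⟩ := hcol 0 1
  obtain ⟨e, he⟩ := hcol 1 0
  rw [edgeGate_zero_one φ hU] at hd
  have hd0 : ∀ x, ζ (x, 0) = d * ζ (x, 0) := fun x => by
    have := congrFun hd (x, 0)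
    rw [happ] at this
    simpa [phaseGate] using this
  have hd1 : ∀ x, phase φ 1 1 * ζ (x, 1) = d * ζ (x, 1) := fun x => by
    have := congrFun hd (x, 1)
    rw [happ] at this
    simpa [phaseGate] using this
  have he' : ∀ x y, edgeGate φ U 1 0 y 0 * ζ (x, 0) + edgeGate φ U 1 0 y 1 * ζ (x, 1)
      = e * ζ (x, y) := fun x y => by
    have := congrFun he (x, y)
    rwa [happ] at this
  -- ζ is an eigenvector of 1 ⊗ Z, so its right cell is in a computational state; such a state is
  -- not an eigenvector of U†ZU, whose off-diagonal entries are non-zero.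
  have hzero : ∀ x y, ζ (x, y) = 0 := by
    by_cases hd' : d = 1
    · have h1 : ∀ x, ζ (x, 1) = 0 := fun x => by
        have : (phase φ 1 1 - 1) * ζ (x, 1) = 0 := by
          linear_combination hd1 x + ζ (x, 1) * hd'
        exact (mul_eq_zero.1 this).resolve_left (sub_ne_zero.2 hφ)
      intro x y
      rcases fin_two_eq y with rfl | rfl
      · have := he' x 1
        rw [h1 x] at this
        simpa [edgeGate_one_zero_ne_zero hφ hU hgen (x := 1) (y := 0) (by decide)] using this
      · exact h1 x
    · have h0 : ∀ x, ζ (x, 0) = 0 := fun x => by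
        have : (d - 1) * ζ (x, 0) = 0 := by linear_combination -hd0 x
        exact (mul_eq_zero.1 this).resolve_left (sub_ne_zero.2 hd')
      intro x y
      rcases fin_two_eq y with rfl | rfl
      · exact h0 x
      · have := he' x 0
        rw [h0 x] at this
        simpa [edgeGate_one_zero_ne_zero hφ hU hgen (x := 0) (y := 1) (by decide)] using this
  exact hζp (hzero p.1 p.2)

theorem exists_vecMulVec_eq (U : QMat) (J : Matrix (Fin 2) (Fin 2 × Fin 2) ℂ) :
    ∃ χ ω, Jᴴ * (U * proj1 0 * Uᴴ) * J = Matrix.vecMulVec χ ω := by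
  refine ⟨Jᴴ *ᵥ fun i => U i 0, (fun i => star (U i 0)) ᵥ* J, ?_⟩
  have : U * proj1 0 * Uᴴ = Matrix.vecMulVec (fun i => U i 0) fun i => star (U i 0) := by
    ext i j
    simp [proj1, Matrix.mul_apply, Matrix.vecMulVec_apply, Fin.sum_univ_two, Matrix.single_apply]
  rw [this, Matrix.mul_vecMulVec, Matrix.vecMulVec_mul]

theorem IsRenormalisation.isMonomial_of_self {φ : ℝ} (hφ : phase φ 1 1 ≠ 1) {U : QMat}
    (hU : Uᴴ * U = 1) {P} {ψ : TileFrame}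
    (h : IsRenormalisation (qubitQCA φ U) (qubitQCA φ U) P ψ) : IsMonomial U := by
  refine (isMonomial_or_generic hU).resolve_right fun hgen => ?_
  have hψ := h.2.2.1
  have hc := h.isConeInvariant_self hU
  obtain ⟨χ, ω, he⟩ := exists_vecMulVec_eq U (frameMat ψ)
  rw [he] at hc
  rcases leftFull_or_rightFull φ hψ with hL | hR
  · exact not_isConeInvariant_of_rank_one hφ hU hgen hψ hL hc
  · exact not_isConeInvariant_of_rank_one hφ hU hgen hψ.mirror hR.mirror
      (χ := fun p => χ p.swap) (ω := fun p => ω p.swap) hc.mirror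

/-! ### Self-renormalisations -/

theorem qubitQCA_apply_cell (φ : ℝ) (U A : QMat) (a c b b' : Fin 2) :
    qubitQCA φ U A ![a, b, c] ![a, b', c]
      = star (phase φ a b * phase φ b c) * (Uᴴ * A * U) b b' * (phase φ a b' * phase φ b' c) := by
  rw [qubitQCA_apply, onSite, if_pos]
  · rfl
  · intro y hy
    fin_cases y
    exacts [rfl, absurd rfl hy, rfl]

theorem onSite_apply_cell (A : QMat) (a c b b' : Fin 2) :
    onSite (1 : Fin 3) A ![a, b, c] ![a, b', c] = A b b' := by
  rw [onSite, if_pos]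
  · rfl
  · intro y hy
    fin_cases y
    exacts [rfl, absurd rfl hy, rfl]

theorem conj_conj_cancel {U : QMat} (hU : Uᴴ * U = 1) (A : QMat) :
    Uᴴ * (U * A * Uᴴ) * U = A := by
  calc _ = (Uᴴ * U) * A * (Uᴴ * U) := by simp only [Matrix.mul_assoc]
    _ = A := by rw [hU, Matrix.one_mul, Matrix.mul_one]

theorem conj_apply_of_diagonal {V : QMat} (h01 : V 0 1 = 0) (h10 : V 1 0 = 0) (A : QMat)
    (i j : Fin 2) : (Vᴴ * A * V) i j = star (V i i) * A i j * V j j := by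
  rcases fin_two_eq i with rfl | rfl <;> rcases fin_two_eq j with rfl | rfl <;>
    simp [Matrix.mul_apply, Fin.sum_univ_two, Matrix.conjTranspose_apply, h01, h10]

/-! ### Equivalence of rules under a change of basis in every cell. -/

section LocalConj

variable {φ φ' : ℝ} {U V W : QMat}

theorem localConj_eq (W : QMat) (R : CellRule) (A : QMat) :
    localConj W R A = tensorOp (fun _ => W) * R (Wᴴ * A * W) * (tensorOp fun _ => W)ᴴ := rfl

theorem tensorOp_mul_onSite_mul {L : Type} [Fintype L] [DecidableEq L] (hW : W * Wᴴ = 1) (x : L)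
    (A : QMat) : tensorOp (fun _ => W) * onSite x A * (tensorOp fun _ => W)ᴴ
      = onSite x (W * A * Wᴴ) := by
  rw [tensorOp_mul_onSite, tensorOp_conjTranspose, tensorOp_mul, onSite_eq_tensorOp]
  congr 1
  funext y
  by_cases hy : y = x
  · subst hy; simp
  · simp [hy, hW]

/-- A rule with a trivial phase is not equivalent to one with a non-trivial phase. -/
theorem phase_ne_one_of_eq_localConj (hφ : phase φ 1 1 ≠ 1) (hU : Uᴴ * U = 1)
    (hW : W * Wᴴ = 1) (h : qubitQCA φ U = localConj W (qubitQCA φ' V)) : phase φ' 1 1 ≠ 1 := by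
  intro hφ'
  have hone : qubitQCA φ' V = qubitQCA 0 V :=
    qubitQCA_congr (by rw [hφ']; simp [phase]) (c := 1) (by simp) (by simp)
  have hsite : ∀ A, qubitQCA 0 V A = onSite 1 (Vᴴ * A * V) := by
    intro A
    ext s t
    rw [qubitQCA_apply]
    simp [phase]
  -- This matrix element depends on the neighbour a, whereas a rule with trivial phase produces
  -- one-cell operators, also after a change of basis.
  have key : ∀ a, qubitQCA φ U (U * Matrix.single 0 1 1 * Uᴴ) ![a, 0, 0] ![a, 1, 0]
      = phase φ a 1 := by
    intro a
    rw [qubitQCA_apply_cell, conj_conj_cancel hU]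
    simp
  simp only [h, localConj_eq, hone, hsite, tensorOp_mul_onSite_mul hW, onSite_apply_cell] at key
  have := (key 1).symm.trans (key 0)
  exact hφ (by simpa using this)

/-- A change of basis between two rules with non-trivial phases is monomial. -/
theorem isMonomial_of_eq_localConj (hφ' : phase φ' 1 1 ≠ 1) (hU : Uᴴ * U = 1)
    (hW : W * Wᴴ = 1) (h : qubitQCA φ U = localConj W (qubitQCA φ' V)) : IsMonomial W := by
  have hW' : Wᴴ * W = 1 := mul_eq_one_comm.1 hW
  -- The image is a one-cell operator. The second rule must therefore produce the one-cell operator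
  -- W†|0⟩⟨0|W, which its non-trivial phase allows only if the off-diagonal entries vanish.
  have e1 : qubitQCA φ U (U * proj1 0 * Uᴴ) = onSite 1 (proj1 0) := by
    ext s t
    rw [qubitQCA_apply, conj_conj_cancel hU]
    by_cases hst : s = t
    · subst hst
      rw [mul_right_comm, star_mul']
      linear_combination onSite 1 (proj1 0) s s * (star (phase φ (s 0) (s 1)) * phase φ (s 0) (s 1)
        * star_phase_mul φ (s 1) (s 2) + star_phase_mul φ (s 0) (s 1))
    · have : onSite (1 : Fin 3) (proj1 0) s t = 0 := by
        rw [onSite]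
        split_ifs with h1
        · have h2 : s 1 ≠ t 1 := fun h2 =>
            hst (funext fun y => if hy : y = 1 then hy ▸ h2 else h1 y hy)
          rw [proj1, Matrix.single_apply_of_ne]
          rintro ⟨h3, h4⟩
          exact h2 (h3.symm.trans h4)
        · rfl
      rw [this, mul_zero, zero_mul]
  set 𝕎 : QOp (Fin 3) := tensorOp fun _ => W with h𝕎
  have hWW : 𝕎ᴴ * 𝕎 = 1 := by
    rw [h𝕎, tensorOp_conjTranspose, tensorOp_mul]
    simp only [hW', tensorOp_one]
  have e2 : qubitQCA φ' V (Wᴴ * (U * proj1 0 * Uᴴ) * W) = onSite 1 (Wᴴ * proj1 0 * W) := by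
    have h1 : 𝕎ᴴ * onSite 1 (proj1 0) * 𝕎 = onSite 1 (Wᴴ * proj1 0 * W) := by
      have := tensorOp_mul_onSite_mul (W := Wᴴ) (L := Fin 3)
        (by rw [Matrix.conjTranspose_conjTranspose, hW']) 1 (proj1 0)
      simpa only [tensorOp_conjTranspose, Matrix.conjTranspose_conjTranspose, h𝕎] using this
    rw [← h1, ← e1, h, localConj_eq]
    calc _ = (𝕎ᴴ * 𝕎) * qubitQCA φ' V (Wᴴ * (U * proj1 0 * Uᴴ) * W) * (𝕎ᴴ * 𝕎) := by
          rw [hWW, Matrix.one_mul, Matrix.mul_one]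
      _ = _ := by simp only [Matrix.mul_assoc, ← h𝕎]
  have e3 : ∀ a, phase φ' a 1 * (Vᴴ * (Wᴴ * (U * proj1 0 * Uᴴ) * W) * V) 0 1
      = (Wᴴ * proj1 0 * W) 0 1 := by
    intro a
    have := congrFun₂ e2 ![a, 0, 0] ![a, 1, 0]
    rw [qubitQCA_apply_cell, onSite_apply_cell] at this
    rw [← this]
    simp [mul_comm]
  have h0 := e3 0
  have h1 := e3 1
  rw [phase_zero_left, one_mul] at h0
  rw [h0] at h1
  have h2 : (Wᴴ * proj1 0 * W) 0 1 = 0 := by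
    have : (phase φ' 1 1 - 1) * (Wᴴ * proj1 0 * W) 0 1 = 0 := by linear_combination h1
    exact (mul_eq_zero.1 this).resolve_left (sub_ne_zero.2 hφ')
  refine (isMonomial_or_generic hW').resolve_right fun hgen => ?_
  have h3 : (Wᴴ * proj1 0 * W) 0 1 = star (W 0 0) * W 0 1 := by
    simp [proj1, Matrix.mul_apply, Fin.sum_univ_two, Matrix.conjTranspose_apply,
      Matrix.single_apply]
  rw [h3] at h2
  exact mul_ne_zero (star_ne_zero.2 (hgen 0 0)) (hgen 0 1) h2

/-- A product operator whose factor maps `|σ i⟩` to a multiple of `|i⟩`. -/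
theorem tensorOp_mul_mul_apply {σ : Fin 2 → Fin 2} (hσ : ∀ i j, j ≠ σ i → W i j = 0)
    (R : QOp (Fin 3)) (s t : Fin 3 → Fin 2) :
    (tensorOp (fun _ => W) * R * (tensorOp fun _ => W)ᴴ : QOp (Fin 3)) s t
      = (∏ i, W (s i) (σ (s i))) * R (fun i => σ (s i)) (fun i => σ (t i))
        * star (∏ i, W (t i) (σ (t i))) := by
  have h0 : ∀ s u : Fin 3 → Fin 2, u ≠ (fun i => σ (s i)) →
      tensorOp (fun _ : Fin 3 => W) s u = 0 := by
    intro s u hu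
    obtain ⟨i, hi⟩ := Function.ne_iff.1 hu
    exact Finset.prod_eq_zero (Finset.mem_univ i) (hσ _ _ hi)
  rw [Matrix.mul_apply, Finset.sum_eq_single fun i => σ (t i)]
  · rw [Matrix.mul_apply, Finset.sum_eq_single fun i => σ (s i)]
    · rfl
    · intro u _ hu
      rw [h0 s u hu, zero_mul]
    · simp
  · intro u _ hu
    rw [Matrix.conjTranspose_apply, h0 t u hu, star_zero, mul_zero]
  · simp

/-- A monomial W only relabels the basis by σ: its non-zero entries have modulus one and cancel in
pairs. -/
theorem localConj_apply_cell {σ : Fin 2 → Fin 2} (hσ : Function.Involutive σ)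
    (hWσ : ∀ i j, j ≠ σ i → W i j = 0) (hW : Wᴴ * W = 1) (h01 : V 0 1 = 0) (h10 : V 1 0 = 0)
    (a c : Fin 2) :
    localConj W (qubitQCA φ' V) (Matrix.single 0 1 1) ![a, 0, c] ![a, 1, c]
      = star (phase φ' (σ a) (σ 0) * phase φ' (σ 0) (σ c))
        * (star (V (σ 0) (σ 0)) * V (σ 1) (σ 1))
        * (phase φ' (σ a) (σ 1) * phase φ' (σ 1) (σ c)) := by
  have hw : ∀ i, star (W i (σ i)) * W i (σ i) = 1 := by
    intro i
    have h1 := congrFun₂ hW (σ i) (σ i)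
    rw [Matrix.mul_apply, Matrix.one_apply_eq, Finset.sum_eq_single i] at h1
    · simpa using h1
    · intro k _ hk
      rw [hWσ k (σ i) fun h => hk (hσ.injective h.symm), mul_zero]
    · simp
  have hB : (Wᴴ * Matrix.single 0 1 1 * W : QMat) (σ 0) (σ 1) = star (W 0 (σ 0)) * W 1 (σ 1) := by
    simp [Matrix.mul_apply, Fin.sum_univ_two, Matrix.conjTranspose_apply, Matrix.single_apply]
  have hs : ∀ b, (fun i => σ ((![a, b, c] : Fin 3 → Fin 2) i)) = ![σ a, σ b, σ c] := by
    intro b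
    funext i
    fin_cases i <;> rfl
  rw [localConj_eq, tensorOp_mul_mul_apply hWσ, hs, hs, qubitQCA_apply_cell,
    conj_apply_of_diagonal h01 h10, hB]
  simp only [Fin.prod_univ_three, Matrix.cons_val_zero, Matrix.cons_val_one, Matrix.cons_val,
    star_mul']
  have ha := hw a
  have hc := hw c
  have h0 := hw 0
  have h1 := hw 1
  generalize W a (σ a) = wa at *
  generalize W c (σ c) = wc at *
  generalize W 0 (σ 0) = w0 at *
  generalize W 1 (σ 1) = w1 at *
  generalize phase φ' (σ a) (σ 0) = x1
  generalize phase φ' (σ 0) (σ c) = x2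
  generalize phase φ' (σ a) (σ 1) = x3
  generalize phase φ' (σ 1) (σ c) = x4
  generalize V (σ 0) (σ 0) = v0
  generalize V (σ 1) (σ 1) = v1
  calc _ = (star wa * wa) * (star wc * wc) * (star w0 * w0) * (star w1 * w1)
        * (star x1 * star x2 * (star v0 * v1) * (x3 * x4)) := by ring
    _ = _ := by rw [ha, hc, h0, h1]; ring

/-- The relations between the parameters of two equivalent rules, the second having a diagonal
gate. -/
theorem parameters_of_eq_localConj (hφ : phase φ 1 1 ≠ 1) (hU : Uᴴ * U = 1) (hV : Vᴴ * V = 1)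
    (h01 : V 0 1 = 0) (h10 : V 1 0 = 0)
    (hW : W * Wᴴ = 1) (h : qubitQCA φ U = localConj W (qubitQCA φ' V)) :
    phase φ' 1 1 ≠ 1 ∧ phase φ 1 1 = phase φ' 1 1 ∧ star (U 0 0) * U 1 1 ≠ 0 ∧
      (star (U 0 0) * U 1 1 = star (V 0 0) * V 1 1 ∨
        star (U 0 0) * U 1 1 = star (phase φ' 1 1) ^ 2 * star (star (V 0 0) * V 1 1)) := by
  have hφ' := phase_ne_one_of_eq_localConj hφ hU hW h
  have hW' : Wᴴ * W = 1 := mul_eq_one_comm.1 hW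
  have hv : star (V 0 0) * V 1 1 ≠ 0 := by
    have c00 := unitary_columns hV 0 0
    have c11 := unitary_columns hV 1 1
    rw [if_pos rfl, h10] at c00
    rw [if_pos rfl, h01] at c11
    refine mul_ne_zero (star_ne_zero.2 fun h => ?_) fun h => ?_
    · simp [h] at c00
    · simp [h] at c11
  have hT : ∀ a, qubitQCA φ U (Matrix.single 0 1 1) ![a, 0, 0] ![a, 1, 0]
      = phase φ a 1 * (star (U 0 0) * U 1 1) := by
    intro a
    rw [qubitQCA_apply_cell]
    simp [Matrix.mul_apply, Fin.sum_univ_two, Matrix.conjTranspose_apply, Matrix.single_apply,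
      mul_comm]
  have hz := star_phase_mul φ' 1 1
  have hz0 := phase_ne_zero φ' 1 1
  have key : ∀ {u v : ℂ}, v ≠ 0 → u = v → phase φ 1 1 * u = phase φ' 1 1 * v →
      phase φ 1 1 = phase φ' 1 1 := by
    intro u v hv huv h
    rw [huv] at h
    exact mul_right_cancel₀ hv h
  -- The neighbour states a = 0 and a = 1 yield the gate ratio and the phase. In the second case W
  -- exchanges the basis states, which conjugates the ratio and adds the phases of two bonds.
  rcases isMonomial_of_eq_localConj hφ' hU hW h with ⟨w01, w10⟩ | ⟨w00, w11⟩
  · have hWσ : ∀ i j, j ≠ id i → W i j = 0 := by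
      intro i j hij
      rcases fin_two_eq i with rfl | rfl <;> rcases fin_two_eq j with rfl | rfl <;> simp_all
    have hR := fun a => localConj_apply_cell (φ' := φ') (σ := id) (fun _ => rfl) hWσ hW' h01 h10 a 0
    rw [← h] at hR
    simp only [hT, id] at hR
    have h0 := hR 0
    have h1 := hR 1
    simp only [phase_zero_left, phase_zero_right, star_one, one_mul, mul_one] at h0 h1
    exact ⟨hφ', key hv h0 (by rw [h1]; ring), h0 ▸ hv, Or.inl h0⟩
  · have hWσ : ∀ i j, j ≠ 1 - i → W i j = 0 := by
      intro i j hij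
      rcases fin_two_eq i with rfl | rfl <;> rcases fin_two_eq j with rfl | rfl <;> simp_all
    have hR := fun a => localConj_apply_cell (φ' := φ') (σ := fun i => 1 - i)
      (fun i => sub_sub_cancel 1 i) hWσ hW' h01 h10 a 0
    rw [← h] at hR
    have e0 : (1 : Fin 2) - 0 = 1 := by decide
    have e1 : (1 : Fin 2) - 1 = 0 := by decide
    simp only [hT, e0, e1] at hR
    have h0 := hR 0
    have h1 := hR 1
    simp only [e0, e1, phase_zero_left, phase_zero_right, one_mul, mul_one, star_mul']
      at h0 h1
    have h0' : star (U 0 0) * U 1 1 = star (phase φ' 1 1) ^ 2 * star (star (V 0 0) * V 1 1) := by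
      rw [h0]
      simp only [star_mul', star_star]
      ring
    have hv' : star (phase φ' 1 1) ^ 2 * star (star (V 0 0) * V 1 1) ≠ 0 :=
      mul_ne_zero (pow_ne_zero _ (star_ne_zero.2 hz0)) (star_ne_zero.2 hv)
    refine ⟨hφ', key hv' h0' ?_, h0' ▸ hv', Or.inr h0'⟩
    rw [h1]
    simp only [star_mul', star_star]
    linear_combination -(star (phase φ' 1 1) * (V 0 0 * star (V 1 1))) * hz

end LocalConj

/-! ### The phase `e^{iφ} = -1` -/

/-- For a diagonal gate every bond sign is squared. For an anti-diagonal gate, a bond and its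
complement give -ε_a ε_b with ε = ±1; each tile carries two bonds, and every ε occurs twice around
the ring. -/
theorem tilePhase_mul_tilePhase {φ : ℝ} (hφ : phase φ 1 1 = -1) {U : QMat} (hU : IsMonomial U)
    {f : ℕ} [NeZero f] {s t : ZMod f → Fin 2 × Fin 2}
    (h : ∀ x, (U ⊗ₖ U) (s x) (t x) ≠ 0) : tilePhase φ f s * tilePhase φ f t = 1 := by
  have h1 : ∀ x, U (s x).1 (t x).1 ≠ 0 := fun x => left_ne_zero_of_mul (h x)
  have h2 : ∀ x, U (s x).2 (t x).2 ≠ 0 := fun x => right_ne_zero_of_mul (h x)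
  rw [tilePhase, tilePhase, ← Finset.prod_mul_distrib]
  rcases hU with ⟨h01, h10⟩ | ⟨h00, h11⟩
  · have hU : ∀ {a b : Fin 2}, U a b ≠ 0 → b = a := by
      intro a b hab
      rcases fin_two_eq a with rfl | rfl <;> rcases fin_two_eq b with rfl | rfl <;> simp_all
    have hsq : ∀ a b, phase φ a b * phase φ a b = 1 := by
      intro a b
      rcases fin_two_eq a with rfl | rfl <;> rcases fin_two_eq b with rfl | rfl <;> simp [hφ]
    refine Finset.prod_eq_one fun x _ => ?_
    rw [hU (h1 x), hU (h2 x), hU (h1 (x + 1)), mul_mul_mul_comm, hsq, hsq, one_mul]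
  · have hU : ∀ {a b : Fin 2}, U a b ≠ 0 → b = 1 - a := by
      intro a b hab
      rcases fin_two_eq a with rfl | rfl <;> rcases fin_two_eq b with rfl | rfl <;> simp_all
    let ε : Fin 2 → ℂ := ![1, -1]
    have hε : ∀ a, ε a * ε a = 1 := by
      intro a
      rcases fin_two_eq a with rfl | rfl <;> simp [ε]
    have hflip : ∀ a b, phase φ a b * phase φ (1 - a) (1 - b) = -(ε a * ε b) := by
      intro a b
      rcases fin_two_eq a with rfl | rfl <;> rcases fin_two_eq b with rfl | rfl <;> simp [hφ, ε]
    have hterm : ∀ x, phase φ (s x).1 (s x).2 * phase φ (s x).2 (s (x + 1)).1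
        * (phase φ (t x).1 (t x).2 * phase φ (t x).2 (t (x + 1)).1)
        = ε (s x).1 * ε (s (x + 1)).1 := by
      intro x
      rw [hU (h1 x), hU (h2 x), hU (h1 (x + 1)), mul_mul_mul_comm, hflip, hflip]
      linear_combination ε (s x).1 * ε (s (x + 1)).1 * hε (s x).2
    have hshift : ∏ x, ε (s (x + 1)).1 = ∏ x, ε (s x).1 :=
      Equiv.prod_comp (Equiv.addRight (1 : ZMod f)) fun x => ε (s x).1
    simp only [hterm]
    rw [Finset.prod_mul_distrib, hshift, ← Finset.prod_mul_distrib]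
    simp only [hε, Finset.prod_const_one]

/-- Two steps are a product operator. -/
theorem tileStep_sq_of_phase_eq_neg_one {φ : ℝ} (hφ : phase φ 1 1 = -1) {U : QMat}
    (hU : IsMonomial U) (f : ℕ) [NeZero f] :
    tileStep φ U f * tileStep φ U f = tensorOp fun _ => (U ⊗ₖ U) * (U ⊗ₖ U) := by
  have h : Matrix.diagonal (tilePhase φ f)
      * (tensorOp (fun _ => U ⊗ₖ U) * Matrix.diagonal (tilePhase φ f))
      = tensorOp fun _ => U ⊗ₖ U := by
    ext s t
    rw [Matrix.diagonal_mul, Matrix.mul_diagonal]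
    by_cases h0 : tensorOp (fun _ => U ⊗ₖ U) s t = 0
    · rw [h0, zero_mul, mul_zero]
    · have := tilePhase_mul_tilePhase hφ hU (s := s) (t := t) fun x =>
        Finset.prod_ne_zero_iff.1 h0 x (Finset.mem_univ x)
      linear_combination tensorOp (fun _ => U ⊗ₖ U) s t * this
  rw [tileStep, Matrix.mul_assoc, h, tensorOp_mul]

/-- At e^{iφ} = -1 two steps form a product operator, so the coarse evolution maps one-cell
operators to one-cell operators. The original rule does not: its images depend on the neighbours
through the phase. -/
theorem IsRenormalisation.phase_sq_ne_one_of_self {φ : ℝ} (hφ : phase φ 1 1 ≠ 1) {U : QMat}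
    (hU : Uᴴ * U = 1) {P} {ψ : TileFrame}
    (h : IsRenormalisation (qubitQCA φ U) (qubitQCA φ U) P ψ) : phase φ 1 1 ^ 2 ≠ 1 := by
  intro hsq
  have hmon := h.isMonomial_of_self hφ hU
  have hneg : phase φ 1 1 = -1 := (sq_eq_one_iff.1 hsq).resolve_left hφ
  obtain ⟨Sw, hS, hSw⟩ := h.tile_eq hU
  have hψ := h.2.2.1
  set g := (U ⊗ₖ U) * (U ⊗ₖ U) with hg
  have hg' : gᴴ * g = 1 := conjTranspose_mul_self_mul (kronecker_conjTranspose_mul_self hU hU)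
    (kronecker_conjTranspose_mul_self hU hU)
  set j := frameMat ψ with hj
  have hJ : tileJ ψ 5 = tensorOp fun _ : ZMod 5 => j := rfl
  have hform : ∀ A, ∃ B, Sw (onSite 1 A) = onSite 1 B := by
    intro A
    refine ⟨j * gᴴ * (jᴴ * A * j * (g * jᴴ)), ?_⟩
    have h1 := onTile_mul_step_sq hU hψ hSw 1 A
    rw [tileStep_sq_of_phase_eq_neg_one hneg hmon, hJ, onTile, tensorOp_conjTranspose, tensorOp_mul,
      tensorOp_mul] at h1
    have h2 := congrArg (fun M => tensorOp (fun _ : ZMod 5 => j * gᴴ) * M) h1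
    have h3 : j * gᴴ * (g * jᴴ) = 1 := by
      rw [Matrix.mul_assoc, ← Matrix.mul_assoc gᴴ, hg', Matrix.one_mul,
        frameMat_mul_conjTranspose hψ]
    simp only [tensorOp_mul, ← Matrix.mul_assoc (tensorOp _) (tensorOp _)] at h2
    simp only [← hg, ← hj, h3, tensorOp_one, Matrix.one_mul] at h2
    rw [← h2, onSite_eq_tensorOp]
    congr 1
    funext y
    by_cases hy : y = 1
    · subst hy
      simp only [Function.update_self]
    · simp only [Function.update_of_ne hy, Matrix.one_mul, h3]
  obtain ⟨B, hB⟩ := hform (U * Matrix.single 0 1 1 * Uᴴ)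
  let s : Fin 2 → Fin 2 → ZMod 5 → Fin 2 := fun a b =>
    Function.update (Function.update (fun _ => 0) 0 a) 1 b
  have hs : ∀ a b, s a b ∘ ![(1 : ZMod 5) - 1, 1, 1 + 1] = ![a, b, 0] := by
    intro a b
    funext i
    fin_cases i
    exacts [rfl, rfl, rfl]
  have hsa : ∀ a b b' y, y ≠ 1 → s a b y = s a b' y := by
    intro a b b' y hy
    simp only [s, Function.update_of_ne hy]
  have key : ∀ a, B 0 1 = phase φ a 1 := by
    intro a
    have h1 := congrFun₂ (hB.symm.trans (hS 1 _)) (s a 0) (s a 1)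
    rw [onSite, if_pos (hsa a 0 1), embedOp, if_pos fun y hy =>
      hsa a 0 1 y fun h => hy ⟨1, h.symm⟩, hs, hs, qubitQCA_apply_cell, conj_conj_cancel hU] at h1
    simpa [s] using h1
  have := (key 1).symm.trans (key 0)
  exact hφ (by simpa using this)

/-! ### Fixed points -/

theorem FlowDiag.parameters {φ ϑ φ' θ' : ℝ} {P ψ} (h : FlowDiag φ ϑ P ψ φ' θ') :
    φ' = 2 * φ ∨ φ' = 0 ∨ (P = projQ2 ∧ φ' = -2 * φ ∧ θ' = φ) := by
  cases h <;> simp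

theorem FlowAnti.parameters {φ φ' θ' : ℝ} {P ψ} (h : FlowAnti φ P ψ φ' θ') :
    φ' = 2 * φ ∨ φ' = 0 ∨ (P = projQ2 ∧ φ' = -2 * φ ∧ θ' = φ) := by
  cases h <;> simp

theorem star_phase (φ : ℝ) : star (phase φ 1 1) = phase (-φ) 1 1 := by
  rw [phase_one_one, phase_one_one, Complex.star_def, ← Complex.exp_conj]
  simp

theorem phase_add (φ φ' : ℝ) : phase (φ + φ') 1 1 = phase φ 1 1 * phase φ' 1 1 := by
  rw [phase_one_one, phase_one_one, phase_one_one, ← Complex.exp_add]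
  push_cast
  ring_nf

theorem zGate_ratio (θ : ℝ) : star (zGate θ 0 0) * zGate θ 1 1 = phase (2 * θ) 1 1 := by
  rw [zGate_eq, phase_one_one]
  simp only [Matrix.diagonal_apply_eq, Matrix.cons_val_zero, Matrix.cons_val_one, Complex.star_def,
    ← Complex.exp_conj, ← Complex.exp_add]
  congr 1
  simp
  ring

theorem zGate_apply_ne (θ : ℝ) {i j : Fin 2} (h : i ≠ j) : zGate θ i j = 0 := by
  rw [zGate_eq, Matrix.diagonal_apply_ne _ h]

theorem eq_int_mul_of_phase_eq_one {φ : ℝ} (h : phase φ 1 1 = 1) :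
    ∃ k : ℤ, φ = k * (2 * Real.pi) := by
  by_contra! h'
  exact phase_one_one_ne_one h' h

/-- The parameters of a self-renormalisation. -/
theorem parameters_of_flow {φ φ' θ' : ℝ} (hφ : phase φ 1 1 ≠ 1) {U : QMat} (hU : Uᴴ * U = 1)
    {P} {ψ ψ₀ : TileFrame}
    (hf : φ' = 2 * φ ∨ φ' = 0 ∨ (P = projQ2 ∧ φ' = -2 * φ ∧ θ' = φ))
    (h : IsLocallyEquivalent ψ (qubitQCA φ U) ψ₀ φ' θ') :
    P = projQ2 ∧ phase (3 * φ) 1 1 = 1 ∧ star (U 0 0) * U 1 1 = phase (2 * φ) 1 1 := by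
  obtain ⟨W, hW, -, h⟩ := h
  obtain ⟨h1, h2, -, h3⟩ := parameters_of_eq_localConj hφ hU (zGate_conjTranspose_mul θ')
    (zGate_apply_ne θ' (by decide)) (zGate_apply_ne θ' (by decide))
    (Matrix.mem_unitaryGroup_iff.1 hW) h
  rcases hf with rfl | rfl | ⟨hP, rfl, rfl⟩
  · refine absurd ?_ hφ
    rw [two_mul, phase_add] at h2
    exact mul_left_cancel₀ (phase_ne_zero φ 1 1) (h2.symm.trans (mul_one _).symm)
  · exact absurd (by simp [phase]) h1
  · refine ⟨hP, ?_, ?_⟩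
    · rw [show 3 * θ' = θ' - (-2 * θ') by ring, sub_eq_add_neg, phase_add, h2, ← phase_add,
        add_neg_cancel]
      simp [phase]
    · rw [zGate_ratio] at h3
      rcases h3 with h3 | h3
      · exact h3
      -- For φ' = -2φ and θ' = φ the exchanged basis gives the exponent 4φ - 2φ, the same as the
      -- other alternative.
      · rw [h3, star_phase, star_phase, sq, ← phase_add, ← phase_add]
        congr 1
        ring

/-- The ratio of the diagonal entries of the gate must be e^{2iφ}. It is 1 when sin θ = 0 and the
product star(U₀₀)U₁₁ is 0 for an anti-diagonal gate, so only a diagonal gate with ratio different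
from 1 survives. -/
theorem IsRenormalisation.self_cases {φ θ : ℝ} (hφ : phase φ 1 1 ≠ 1)
    {n : EuclideanSpace ℝ (Fin 3)} (hn : ‖n‖ = 1) {P ψ}
    (h : IsRenormalisation (qubitQCA φ (rotGate n θ)) (qubitQCA φ (rotGate n θ)) P ψ) :
    P = projQ2 ∧ n 0 = 0 ∧ n 1 = 0 ∧ ∃ m l : ℤ,
      φ = 2 * m * Real.pi / 3 ∧ n 2 * θ = 2 * m * Real.pi / 3 + l * Real.pi := by
  have hU := rotGate_conjTranspose_mul hn θ
  have hsq := h.phase_sq_ne_one_of_self hφ hU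
  rcases h.flow_cases hsq hn with ⟨h0, h1, ψ₀, φ', θ', hf, he⟩ | ⟨hs, ψ₀, φ', θ', hf, he⟩
    | ⟨h2, hc, ψ₀, φ', θ', hf, he⟩
  · obtain ⟨hP, h3, hu⟩ := parameters_of_flow hφ hU hf.parameters he
    refine ⟨hP, h0, h1, ?_⟩
    obtain ⟨m, hm⟩ := eq_int_mul_of_phase_eq_one h3
    rw [rotGate_eq_zGate hn h0 h1, zGate_ratio] at hu
    obtain ⟨l, hl⟩ := eq_int_mul_of_phase_eq_one (φ := 2 * (n 2 * θ) - 2 * φ) (by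
      rw [sub_eq_add_neg, phase_add, hu, ← phase_add, add_neg_cancel]
      simp [phase])
    exact ⟨m, l, by linarith, by linarith⟩
  · obtain ⟨-, -, hu⟩ := parameters_of_flow hφ hU hf.parameters he
    refine absurd ?_ hsq
    have hcos : (Real.cos θ : ℂ) * Real.cos θ = 1 := by
      have := Real.cos_sq_add_sin_sq θ
      rw [hs] at this
      exact_mod_cast (by linarith : Real.cos θ * Real.cos θ = 1)
    rw [phase_one_one_pow, Nat.cast_ofNat, ← hu, rotGate_eq hn, hs]
    generalize Real.cos θ = c at hcos
    simpa using hcos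
  · obtain ⟨-, -, hu⟩ := parameters_of_flow hφ hU hf.parameters he
    rw [(rotGate_of_cos_eq_zero hn h2 hc).1, star_zero, zero_mul] at hu
    exact absurd hu.symm (phase_ne_zero _ _ _)

theorem zGate_add_int_mul_pi (θ : ℝ) (l : ℤ) :
    zGate (θ + l * Real.pi) = phase (l * Real.pi) 1 1 • zGate θ := by
  -- The factor is the sign (-1)^l, equal to its own inverse, so it is common to both diagonal
  -- entries.
  have h2 : phase (l * Real.pi) 1 1 = Complex.exp (-(Complex.I * ((l * Real.pi : ℝ) : ℂ))) := by
    rw [phase_one_one, Complex.exp_eq_exp_iff_exists_int]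
    exact ⟨l, by push_cast; ring⟩
  rw [zGate_eq, zGate_eq, ← Matrix.diagonal_smul]
  congr 1
  funext i
  rcases fin_two_eq i with rfl | rfl
  · rw [h2]
    simp only [Matrix.cons_val_zero, Pi.smul_apply, smul_eq_mul, ← Complex.exp_add]
    congr 1
    push_cast
    ring
  · rw [phase_one_one]
    simp only [Matrix.cons_val_one, Matrix.cons_val_fin_one, Pi.smul_apply, smul_eq_mul]
    rw [← Complex.exp_add]
    congr 1
    push_cast
    ring

/-- The self-renormalisations through `Q₂`. -/
theorem isRenormalisation_self (m l : ℤ) :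
    IsRenormalisation
      (qubitQCA (2 * m * Real.pi / 3) (zGate (2 * m * Real.pi / 3 + l * Real.pi)))
      (qubitQCA (2 * m * Real.pi / 3) (zGate (2 * m * Real.pi / 3 + l * Real.pi)))
      projQ2 ![ket 0 1, ket 1 0] := by
  have h := isRenormalisation_of_flowDiag (.q2 : FlowDiag (2 * m * Real.pi / 3)
    (2 * m * Real.pi / 3 + l * Real.pi) projQ2 ![ket 0 1, ket 1 0] _ _)
  -- The phases φ and -2φ agree modulo 2π because 3φ = 2mπ, and the shift by lπ changes the gate
  -- only by a sign.
  have e : qubitQCA (2 * m * Real.pi / 3) (zGate (2 * m * Real.pi / 3 + l * Real.pi))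
      = qubitQCA (-2 * (2 * m * Real.pi / 3)) (zGate (2 * m * Real.pi / 3)) := by
    refine qubitQCA_congr ?_ (star_phase_mul (l * Real.pi) 1 1) (zGate_add_int_mul_pi _ l)
    rw [phase_one_one, phase_one_one, Complex.exp_eq_exp_iff_exists_int]
    exact ⟨m, by push_cast; ring⟩
  rwa [← e] at h

end

theorem mainTheorem8 :
    -- the flow when one step is diagonal in the computational basis
    (∀ (φ θ : ℝ) (n : EuclideanSpace ℝ (Fin 3)), ‖n‖ = 1 → n 0 = 0 → n 1 = 0 →
      ∀ P ψ φ' θ', FlowDiag φ (n 2 * θ) P ψ φ' θ' →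
        IsRenormalisation (qubitQCA φ (rotGate n θ)) (qubitQCA φ' (zGate θ')) P ψ) ∧
    -- the flow when one step is anti-diagonal in the computational basis
    (∀ (φ θ : ℝ) (n : EuclideanSpace ℝ (Fin 3)), ‖n‖ = 1 → n 2 = 0 → Real.cos θ = 0 →
      ∀ P ψ φ' θ', FlowAnti φ P ψ φ' θ' →
        IsRenormalisation (qubitQCA φ (rotGate n θ)) (qubitQCA φ' (zGate θ')) P ψ) ∧
    -- for φ ∉ {0, π} there is no other renormalisation
    (∀ (φ θ : ℝ) (n : EuclideanSpace ℝ (Fin 3)), ‖n‖ = 1 →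
      (∀ k : ℤ, φ ≠ k * Real.pi) →
      ∀ S P ψ, IsRenormalisation (qubitQCA φ (rotGate n θ)) S P ψ →
        (n 0 = 0 ∧ n 1 = 0 ∧ ∃ ψ₀ φ' θ', FlowDiag φ (n 2 * θ) P ψ₀ φ' θ' ∧
          IsLocallyEquivalent ψ S ψ₀ φ' θ') ∨
        (Real.sin θ = 0 ∧ ∃ ψ₀ φ' θ', FlowDiag φ 0 P ψ₀ φ' θ' ∧
          IsLocallyEquivalent ψ S ψ₀ φ' θ') ∨
        (n 2 = 0 ∧ Real.cos θ = 0 ∧ ∃ ψ₀ φ' θ', FlowAnti φ P ψ₀ φ' θ' ∧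
          IsLocallyEquivalent ψ S ψ₀ φ' θ')) ∧
    -- the only fixed points with φ ≠ 0 are φ = θ = 2mπ/3, through the projection Q₂
    (∀ (φ θ : ℝ) (n : EuclideanSpace ℝ (Fin 3)), ‖n‖ = 1 →
      (∀ k : ℤ, φ ≠ k * (2 * Real.pi)) →
      ((∃ P ψ, IsRenormalisation (qubitQCA φ (rotGate n θ)) (qubitQCA φ (rotGate n θ)) P ψ) ↔
        n 0 = 0 ∧ n 1 = 0 ∧ ∃ m l : ℤ,
          φ = 2 * m * Real.pi / 3 ∧ n 2 * θ = 2 * m * Real.pi / 3 + l * Real.pi) ∧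
      (∀ P ψ, IsRenormalisation (qubitQCA φ (rotGate n θ)) (qubitQCA φ (rotGate n θ)) P ψ →
        P = projQ2)) ∧
    (∀ m : ℤ, IsRenormalisation
      (qubitQCA (2 * m * Real.pi / 3) (zGate (2 * m * Real.pi / 3)))
      (qubitQCA (2 * m * Real.pi / 3) (zGate (2 * m * Real.pi / 3)))
      projQ2 ![ket 0 1, ket 1 0]) := by
  refine ⟨?_, ?_, ?_, ?_, ?_⟩
  · intro φ θ n hn h0 h1 P ψ φ' θ' hf
    rw [rotGate_eq_zGate hn h0 h1]
    exact isRenormalisation_of_flowDiag hf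
  · intro φ θ n hn h2 hc P ψ φ' θ' hf
    obtain ⟨e0, e1⟩ := rotGate_of_cos_eq_zero hn h2 hc
    exact isRenormalisation_of_flowAnti (rotGate_conjTranspose_mul hn θ) e0 e1 hf
  · intro φ θ n hn hφ S P ψ h
    exact h.flow_cases (phase_sq_ne_one hφ) hn
  · intro φ θ n hn hφ
    have hφ' := phase_one_one_ne_one hφ
    refine ⟨⟨?_, ?_⟩, fun P ψ h => (h.self_cases hφ' hn).1⟩
    · rintro ⟨P, ψ, h⟩
      exact (h.self_cases hφ' hn).2
    · rintro ⟨h0, h1, m, l, rfl, h⟩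
      refine ⟨projQ2, ![ket 0 1, ket 1 0], ?_⟩
      rw [rotGate_eq_zGate hn h0 h1, h]
      exact isRenormalisation_self m l
  · intro m
    simpa using isRenormalisation_self m 0
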